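/- Let $k$ be an algebraically closed field of characteristic zero and $V$ a $k$-vector space with basis $x_1,x_2,x_3$. For $\omega\in V^{\otimes 3}$ write $\omega=\sum_i x_i\otimes\partial_i\omega$ with $\partial_i\omega\in V^{\otimes 2}$, and let $\mathcal D(\omega)=T(V)/(\partial_1\omega,\partial_2\omega,\partial_3\omega)$, graded by word length. Call $\omega$ a symmetric regular superpotential if it is invariant under all permutations of the three tensor factors (in particular under the cyclic one, i.e. it is a superpotential) and $S=\mathcal D(\omega)$ is a $3$-dimensional quantum polynomial algebra, that is, a noetherian connected graded algebra with $\operatorname{gldim}S=3$, $\operatorname{Ext}^3_S(k,S)\cong k$, $\operatorname{Ext}^i_S(k,S)=0$ for $i\ne3$, and Hilbert series $(1-t)^{-3}$. For a quadratic algebra $B=T(V)/(R)$ with $R\subseteq V\otimes V$ let $B^!=T(V^*)/(R^\perp)$. Let $S=\mathcal D(\omega)$ with $\omega$ a symmetric regular superpotential, let $f\in S_2$ be a central regular element, and let $A=S/(f)$ (a noncommutative conic associated to a symmetric regular superpotential). Then there is a central regular element $f^!\in A^!_2$, unique up to a nonzero scalar, with $A^!/(f^!)=S^!$ (as quotients of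 $T(V^*)$); put $C(A)=A^![(f^!)^{-1}]_0$, the degree zero part of the localization. For every $k$-algebra $B$ the following are equivalent: (i) $B$ is a $4$-dimensional commutative Frobenius algebra (a finite dimensional algebra that has a nondegenerate bilinear form $\beta$ with $\beta(ab,c)=\beta(a,bc)$); (ii) $B\cong C(A)$ for some noncommutative conic $A=S/(f)$ associated to a symmetric regular superpotential; (iii) $B$ is isomorphic to one of $$k^4,\quad k[u]/(u^2)\times k^2,\quad k[u]/(u^2)\times k[u]/(u^2),\quad k[u]/(u^3)\times k,\quad k[u]/(u^4),\quad k[u,v]/(u^2,v^2).$$ Moreover, the six algebras in (iii) are pairwise non-isomorphic. -/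

import Mathlib

open CategoryTheory

noncomputable section Definitions

namespace NCConic

universe u v

/-! ### Quotients of algebras and graded pieces -/

/-- The quotient `B / (s)` of the `k`-algebra `B` by the two-sided ideal generated by `s`. -/
abbrev AlgQuot {B : Type u} [Ring B] (s : Set B) : Type u :=
  RingQuot (fun a b : B => a ∈ s ∧ b = 0)

/-- The canonical projection `B → B / (s)`. -/
abbrev AlgQuot.proj (k : Type u) [Field k] {B : Type u} [Ring B] [Algebra k B] (s : Set B) :
    B →ₐ[k] AlgQuot s :=
  RingQuot.mkAlgHom k (fun a b : B => a ∈ s ∧ b = 0)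

/-- The span of the words of length `m` in `x₁, …, xₙ`. If `B = T(V)/I` with `I` a homogeneous
ideal and `x` the images of a basis of `V`, this is the degree `m` piece `B_m`. -/
def degPart (k : Type u) [Field k] {B : Type u} [Ring B] [Algebra k B] {n : ℕ}
    (x : Fin n → B) (m : ℕ) : Submodule k B :=
  (Submodule.span k (Set.range x)) ^ m

/-- The value in `B` of a tensor `r ∈ V ⊗ V`, given by its coefficients `r i j` at `xᵢ ⊗ xⱼ`. -/
def quadEval (k : Type u) [Field k] {B : Type u} [Ring B] [Algebra k B] {n : ℕ}
    (x : Fin n → B) : (Fin n → Fin n → k) →ₗ[k] B where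
  toFun r := ∑ i, ∑ j, r i j • (x i * x j)
  map_add' r s := by simp [add_smul, Finset.sum_add_distrib]
  map_smul' c r := by simp [mul_smul, Finset.smul_sum]

/-! ### Quantum polynomial algebras -/

/-- The (left) global dimension of a ring: the supremum of the projective dimensions of its
modules. -/
def globalDimension (S : Type u) [Ring S] : WithBot ℕ∞ :=
  ⨆ M : ModuleCat.{u} S, projectiveDimension M

/-- The trivial module `k = S / S_{≥ 1}` of an `ℕ`-graded algebra `S`. -/
def trivialModule {k : Type u} [Field k] {S : Type u} [Ring S] [Algebra k S]
    (gr : ℕ → Submodule k S) : ModuleCat.{u} S :=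
  ModuleCat.of S (S ⧸ (Ideal.span {a : S | ∃ m, 1 ≤ m ∧ a ∈ gr m} : Ideal S))

/-- `S`, graded by `gr`, is a `d`-dimensional quantum polynomial algebra: a noetherian connected
graded `k`-algebra of global dimension `d` which satisfies the Gorenstein condition and has
Hilbert series `(1 - t)^{-d}`. -/
structure IsQuantumPolynomialAlgebra {k : Type u} [Field k] {S : Type u} [Ring S] [Algebra k S]
    (gr : ℕ → Submodule k S) (d : ℕ) : Prop where
  nontrivial : Nontrivial S
  gradedMonoid : SetLike.GradedMonoid gr
  isInternal : DirectSum.IsInternal gr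
  connected : gr 0 = 1
  locallyFinite : ∀ m, Module.Finite k (gr m)
  noetherian_left : IsNoetherianRing S
  noetherian_right : IsNoetherianRing Sᵐᵒᵖ
  globalDimension_eq : globalDimension S = d
  gorenstein_top :
    Nonempty (Abelian.Ext (trivialModule gr) (ModuleCat.of S S) d ≃ₗ[k] k)
  gorenstein_ne : ∀ i, i ≠ d →
    Subsingleton (Abelian.Ext (trivialModule gr) (ModuleCat.of S S) i)
  hilbert : PowerSeries.mk (fun m => (Module.finrank k (gr m) : ℤ)) *
    (1 - (PowerSeries.X : PowerSeries ℤ)) ^ d = 1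

/-! ### Potentials and derivation-quotient algebras

`V` is a vector space with basis `x₁, x₂, x₃`; a potential `ω ∈ V ⊗ V ⊗ V` is given by its
coefficients `ω i j l` at `xᵢ ⊗ xⱼ ⊗ xₗ`, and `T(V)` is the free algebra on `x₁, x₂, x₃`. -/

/-- Potentials, i.e. elements of `V ⊗ V ⊗ V`. -/
abbrev Potential (k : Type u) : Type u := Fin 3 → Fin 3 → Fin 3 → k

/-- The potential is invariant under all permutations of the tensor factors. -/
def IsSymmetric {k : Type u} (ω : Potential k) : Prop :=
  ∀ (σ : Equiv.Perm (Fin 3)) (a : Fin 3 → Fin 3),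
    ω (a (σ 0)) (a (σ 1)) (a (σ 2)) = ω (a 0) (a 1) (a 2)

/-- The potential is fixed by `xᵢ ⊗ xⱼ ⊗ xₗ ↦ xⱼ ⊗ xₗ ⊗ xᵢ`. -/
def IsSuperpotential {k : Type u} (ω : Potential k) : Prop :=
  ∀ i j l, ω l i j = ω i j l

/-- The derivation-quotient algebra `D(ω) = T(V) / (∂₁ω, ∂₂ω, ∂₃ω)`, where
`∂ᵢω = ∑ ω i j l • xⱼ ⊗ xₗ`, so that `ω = ∑ xᵢ ⊗ ∂ᵢω`. -/
abbrev DerQuot {k : Type u} [Field k] (ω : Potential k) : Type u :=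
  AlgQuot (Set.range fun i : Fin 3 => quadEval k (FreeAlgebra.ι k) (ω i))

/-- The generators `x₁, x₂, x₃` of `D(ω)`. -/
def derGen {k : Type u} [Field k] (ω : Potential k) (i : Fin 3) : DerQuot ω :=
  AlgQuot.proj k _ (FreeAlgebra.ι k i)

/-- The potential `ω` is regular: `D(ω)`, with its standard grading, is a `3`-dimensional quantum
polynomial algebra. -/
def IsRegularPotential {k : Type u} [Field k] (ω : Potential k) : Prop :=
  IsQuantumPolynomialAlgebra (degPart k (derGen ω)) 3

/-- Symmetric regular superpotentials. -/
structure IsSymmetricRegularSuperpotential {k : Type u} [Field k] (ω : Potential k) : Prop where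
  symmetric : IsSymmetric ω
  superpotential : IsSuperpotential ω
  regular : IsRegularPotential ω

/-! ### Quadratic duals

Let `B` be a quadratic algebra with basis `x₁, …, xₙ` of `B₁ = V`, that is `B = T(V)/(R)` with
`R ⊆ V ⊗ V`; then `R` is the kernel of `V ⊗ V → B`. -/

/-- The quadratic relations of `B`, i.e. the kernel of `V ⊗ V → B`. -/
def relSpace (k : Type u) [Field k] {B : Type u} [Ring B] [Algebra k B] {n : ℕ}
    (x : Fin n → B) : Submodule k (Fin n → Fin n → k) :=
  LinearMap.ker (quadEval k x)

/-- The orthogonal complement `R^⊥ ⊆ V* ⊗ V*`, in the coordinates of the dual basis. -/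
def perp {k : Type u} [Field k] {n : ℕ} (R : Submodule k (Fin n → Fin n → k)) :
    Submodule k (Fin n → Fin n → k) where
  carrier := {s | ∀ r ∈ R, ∑ i, ∑ j, s i j * r i j = 0}
  add_mem' {s t} hs ht r hr := by
    simp only [Pi.add_apply, add_mul, Finset.sum_add_distrib]
    rw [hs r hr, ht r hr, add_zero]
  zero_mem' r _ := by simp
  smul_mem' c s hs r hr := by
    simp only [Pi.smul_apply, smul_eq_mul, mul_assoc, ← Finset.mul_sum]
    rw [hs r hr, mul_zero]

/-- The quadratic dual `B^! = T(V*) / (R^⊥)`. -/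
abbrev QuadDual (k : Type u) [Field k] {B : Type u} [Ring B] [Algebra k B] {n : ℕ}
    (x : Fin n → B) : Type u :=
  AlgQuot (quadEval k (FreeAlgebra.ι k : Fin n → FreeAlgebra k (Fin n)) ''
    (perp (relSpace k x) : Set (Fin n → Fin n → k)))

/-- The canonical projection `T(V*) → B^!`. -/
abbrev quadDualProj (k : Type u) [Field k] {B : Type u} [Ring B] [Algebra k B] {n : ℕ}
    (x : Fin n → B) : FreeAlgebra k (Fin n) →ₐ[k] QuadDual k x :=
  AlgQuot.proj k _

/-- The generators of `B^!` (the dual basis). -/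
def dualGen (k : Type u) [Field k] {B : Type u} [Ring B] [Algebra k B] {n : ℕ}
    (x : Fin n → B) (i : Fin n) : QuadDual k x :=
  quadDualProj k x (FreeAlgebra.ι k i)

/-! ### Localization at a central element and its degree zero part -/

/-- The powers of a central element satisfy the Ore condition. -/
instance centralOreSet {B : Type u} [Ring B] (c : Subring.center B) :
    OreLocalization.OreSet (Submonoid.powers (c : B)) where
  ore_right_cancel r₁ r₂ s h := by
    have hs : (s : B) ∈ Subring.center B := by
      obtain ⟨_, m, rfl⟩ := s
      exact pow_mem c.2 m
    rw [Subring.mem_center_iff] at hs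
    exact ⟨s, by rw [← hs r₁, ← hs r₂, h]⟩
  oreNum r _ := r
  oreDenom _ s := s
  ore_eq r s := by
    have hs : (s : B) ∈ Subring.center B := by
      obtain ⟨_, m, rfl⟩ := s
      exact pow_mem c.2 m
    exact (Subring.mem_center_iff.mp hs r).symm

/-- The localization `B[c⁻¹]` at a central element `c`. -/
abbrev CentralLoc {B : Type u} [Ring B] (c : Subring.center B) : Type u :=
  OreLocalization (Submonoid.powers (c : B)) B

/-- The fraction `a / c^m` in `B[c⁻¹]`. -/
def frac {B : Type u} [Ring B] (c : Subring.center B) (a : B) (m : ℕ) : CentralLoc c :=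
  OreLocalization.oreDiv a (⟨(c : B) ^ m, m, rfl⟩ : Submonoid.powers (c : B))

theorem frac_mul {B : Type u} [Ring B] (c : Subring.center B) (a b : B) (m n : ℕ) :
    frac c a m * frac c b n = frac c (a * b) (n + m) := by
  unfold frac
  have hc := Subring.mem_center_iff.mp (pow_mem c.2 n) a
  rw [OreLocalization.oreDiv_mul_char _ _ _ _ a
    (⟨(c : B) ^ n, n, rfl⟩ : Submonoid.powers (c : B)) hc.symm]
  congr 1
  exact Subtype.ext (pow_add _ _ _).symm

theorem frac_add {B : Type u} [Ring B] (c : Subring.center B) (a b : B) (m n : ℕ) :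
    frac c a m + frac c b n = frac c ((c : B) ^ n * a + (c : B) ^ m * b) (n + m) := by
  unfold frac
  have hc := Subring.mem_center_iff.mp (pow_mem c.2 n) ((c : B) ^ m)
  rw [OreLocalization.oreDiv_add_char _ _ ((c : B) ^ m)
    (⟨(c : B) ^ n, n, rfl⟩ : Submonoid.powers (c : B)) hc.symm]
  congr 1
  exact Subtype.ext (pow_add _ _ _).symm

/-- The degree zero part `B[c⁻¹]₀ = {a / c^m | a ∈ B_{2m}}` of the localization of the graded
algebra `B` at a central element `c` of degree two. -/
def degreeZeroLoc (k : Type u) [Field k] {B : Type u} [Ring B] [Algebra k B] {n : ℕ}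
    (x : Fin n → B) (c : Subring.center B) (hc : (c : B) ∈ degPart k x 2) :
    Subalgebra k (CentralLoc c) where
  carrier := {q | ∃ (m : ℕ) (a : B), a ∈ degPart k x (2 * m) ∧ q = frac c a m}
  mul_mem' := by
    rintro _ _ ⟨m, a, ha, rfl⟩ ⟨p, b, hb, rfl⟩
    refine ⟨p + m, a * b, ?_, frac_mul c a b m p⟩
    have := Submodule.mul_mem_mul ha hb
    rwa [degPart, degPart, ← pow_add, show 2 * m + 2 * p = 2 * (p + m) by ring] at this
  add_mem' := by
    rintro _ _ ⟨m, a, ha, rfl⟩ ⟨p, b, hb, rfl⟩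
    have hpow : ∀ q, (c : B) ^ q ∈ degPart k x (2 * q) := fun q => by
      have := Submodule.pow_mem_pow _ hc q
      rwa [degPart, ← pow_mul] at this
    refine ⟨p + m, _, Submodule.add_mem _ ?_ ?_, frac_add c a b m p⟩
    · have := Submodule.mul_mem_mul (hpow p) ha
      rwa [degPart, degPart, ← pow_add, show 2 * p + 2 * m = 2 * (p + m) by ring] at this
    · have := Submodule.mul_mem_mul (hpow m) hb
      rwa [degPart, degPart, ← pow_add, show 2 * m + 2 * p = 2 * (p + m) by ring] at this
  algebraMap_mem' r := by
    refine ⟨0, algebraMap k B r, ?_, ?_⟩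
    · rw [degPart, mul_zero, pow_zero]
      exact Submodule.algebraMap_mem r
    · unfold frac
      have h1 : (⟨(c : B) ^ 0, 0, rfl⟩ : Submonoid.powers (c : B)) = 1 :=
        Subtype.ext (pow_zero _)
      rw [h1]
      rfl

/-! ### Noncommutative conics and the algebra `C(A)` -/

/-- `f` is a central regular element of `S = D(ω)` of degree two. -/
structure IsConicElement {k : Type u} [Field k] (ω : Potential k) (f : DerQuot ω) : Prop where
  degree_two : f ∈ degPart k (derGen ω) 2
  central : f ∈ Subring.center (DerQuot ω)
  regular : IsRegular f

/-- The noncommutative conic `A = S / (f)`, where `S = D(ω)`. -/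
abbrev Conic {k : Type u} [Field k] {ω : Potential k} (f : DerQuot ω) : Type u :=
  AlgQuot ({f} : Set (DerQuot ω))

/-- The generators `x₁, x₂, x₃` of `A = S / (f)`. -/
def conicGen {k : Type u} [Field k] {ω : Potential k} (f : DerQuot ω) (i : Fin 3) : Conic f :=
  AlgQuot.proj k _ (derGen ω i)

/-- `g` is an element `f^!` for the conic `A = S / (f)`: a central regular element of `A^!` of
degree two with `A^! / (f^!) = S^!`, the equality of quotients of `T(V*)`. -/
structure IsDualElement {k : Type u} [Field k] {ω : Potential k} (f : DerQuot ω)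
    (g : Subring.center (QuadDual k (conicGen f))) : Prop where
  degree_two : (g : QuadDual k (conicGen f)) ∈ degPart k (dualGen k (conicGen f)) 2
  regular : IsRegular (g : QuadDual k (conicGen f))
  quotient_eq : ∀ t : FreeAlgebra k (Fin 3),
    AlgQuot.proj k {(g : QuadDual k (conicGen f))} (quadDualProj k (conicGen f) t) = 0 ↔
      quadDualProj k (derGen ω) t = 0

/-- The algebra `C(A) = A^![(f^!)⁻¹]₀` of the conic `A = S / (f)`. -/
abbrev AlgebraC {k : Type u} [Field k] {ω : Potential k} (f : DerQuot ω)
    (g : Subring.center (QuadDual k (conicGen f))) (hg : IsDualElement f g) :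
    Subalgebra k (CentralLoc g) :=
  degreeZeroLoc k (dualGen k (conicGen f)) g hg.degree_two

/-- `B` is isomorphic to `C(A)` for a noncommutative conic `A` associated to a symmetric regular
superpotential. -/
def IsAlgebraCOfSymmetricConic (k : Type u) [Field k] (B : Type v) [Ring B] [Algebra k B] :
    Prop :=
  ∃ (ω : Potential k) (f : DerQuot ω) (g : Subring.center (QuadDual k (conicGen f)))
    (hg : IsDualElement f g),
    IsSymmetricRegularSuperpotential ω ∧ IsConicElement ω f ∧
      Nonempty (B ≃ₐ[k] AlgebraC f g hg)

/-! ### Frobenius algebras -/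

/-- A Frobenius algebra: a finite dimensional algebra which has a nondegenerate associative
bilinear pairing. -/
def IsFrobeniusAlgebra (k : Type u) [Field k] (B : Type v) [Ring B] [Algebra k B] : Prop :=
  Module.Finite k B ∧ ∃ β : B →ₗ[k] B →ₗ[k] k,
    β.Nondegenerate ∧ ∀ a b c, β (a * b) c = β a (b * c)

/-- `B` is a `4`-dimensional commutative Frobenius algebra. -/
structure IsCommFrobeniusOfDimFour (k : Type u) [Field k] (B : Type v) [Ring B] [Algebra k B] :
    Prop where
  frobenius : IsFrobeniusAlgebra k B
  comm : ∀ a b : B, a * b = b * a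
  finrank_eq : Module.finrank k B = 4

/-- The truncated polynomial algebra `k[u]/(u^m)`. -/
abbrev TruncPoly (k : Type u) [Field k] (m : ℕ) : Type u :=
  Polynomial k ⧸ Ideal.span {(Polynomial.X : Polynomial k) ^ m}

/-- The algebra `k[u,v]/(u²,v²)`. -/
abbrev TruncPolyTwo (k : Type u) [Field k] : Type u :=
  MvPolynomial (Fin 2) k ⧸
    Ideal.span {(MvPolynomial.X 0 : MvPolynomial (Fin 2) k) ^ 2, MvPolynomial.X 1 ^ 2}

/-- `B` is isomorphic to the `i`-th algebra in the list `k⁴`, `k[u]/(u²) × k²`,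
`k[u]/(u²) × k[u]/(u²)`, `k[u]/(u³) × k`, `k[u]/(u⁴)`, `k[u,v]/(u²,v²)`. -/
def IsListed (k : Type u) [Field k] (B : Type v) [Ring B] [Algebra k B] : Fin 6 → Prop
  | 0 => Nonempty (B ≃ₐ[k] (Fin 4 → k))
  | 1 => Nonempty (B ≃ₐ[k] (TruncPoly k 2 × (Fin 2 → k)))
  | 2 => Nonempty (B ≃ₐ[k] (TruncPoly k 2 × TruncPoly k 2))
  | 3 => Nonempty (B ≃ₐ[k] (TruncPoly k 3 × k))
  | 4 => Nonempty (B ≃ₐ[k] TruncPoly k 4)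
  | 5 => Nonempty (B ≃ₐ[k] TruncPolyTwo k)

end NCConic

end Definitions

open NCConic

/-!
Apart from `D(ω) ≠ 0`, the proof uses two consequences of regularity of a symmetric superpotential
`ω`, both read off from the Hilbert series: the derivatives `∂ᵢω` are independent, and
`R ⊗ V ∩ V ⊗ R = k ω`, where `R` is their span
(`IsSymmetricRegularSuperpotential.isNondegenerateCubic`). Hence the quadratic dual of `D(ω)` is the
commutative graded algebra with Hilbert function `1, 3, 3, 1` whose Macaulay inverse system is
generated by `ω`.

*The element `f^!`.* A central element `f` of degree two is represented by a symmetric tensor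
(`IsNondegenerateCubic.symm_of_central`), so `A^!` is commutative; it is the quotient of a polynomial
ring in three variables by two quadrics `q₁, q₂`. An element `f^!` is the class of a third quadric
that spans `R^⊥` together with `q₁, q₂`. Its regularity (`isRegular_quadEval`) is a count of
dimensions: `A^!_n` has dimension at least four for `n ≥ 2` since it is the quotient by two
quadrics, while `A^!_{n+2} = f^! A^!_n` for `n ≥ 2` because `D(ω)^!` vanishes in degree four.

*`C(A)` is Frobenius.* The map `a ↦ a / f^!` identifies `A^!_2` with `C(A)`, which is commutative of
dimension four. The functional `A^!_3 → D(ω)^!_3 = k`, composed with multiplication by a linear form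
`ℓ` for which `ℓ² / f^!` is a unit, is nondegenerate
(`IsConicDualAlgebra.isCommFrobeniusOfDimFour`).

*Classification.* A commutative Frobenius algebra is a product of local ones, and a local one has a
socle of dimension one. This leaves the algebras `k[u]/(u^n)` and, in dimension four, the algebra
`k[u, v]/(u², v²)` (`IsCommFrobeniusOfDimFour.exists_isListed`). The listed algebras are told apart
by their nilpotent and idempotent elements (`IsListed.invariants`).

*Realization.* For the algebras `S` with relations `y z + z y + a x²`, `x z + z x + b y²`,
`x y + y x` the elements `f = α x² + β y² + z²` are central and regular, and `C(S / (f))` is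
`k[u, v]/(u² - a v - α, v² - b u - β)`, with `u = X Z / Z²` and `v = Y Z / Z²`
(`exists_algEquiv_algebraC`). Each listed algebra has such a presentation. That `S` is a quantum
polynomial algebra (`isSymmetricRegularSuperpotential_cliffordPotential`) follows from the basis
`z^c x^i y^j` and from Koszul complexes. For every `S`-module `M` there is a resolution
`0 → S ⊗ M → (S ⊗ M)³ → (S ⊗ M)³ → S ⊗ M → M`, which bounds the global dimension; for `M = k` it is
self-dual, which gives the Gorenstein condition and shows that the bound is attained. The algebra is
noetherian because it is finite over the central subalgebra generated by `x²`, `y²`, `z²`.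
-/

universe u v

namespace NCConic

/-! ### Quadratic presentations and their low degree relations -/

section Tensor

variable {k : Type u} [Field k] {n : ℕ}

/-- The value in `B` of a tensor of degree three. -/
noncomputable def cubicEval (k : Type u) [Field k] {B : Type u} [Ring B] [Algebra k B]
    {n : ℕ} (x : Fin n → B) :
    (Fin n → Fin n → Fin n → k) →ₗ[k] B :=
  ∑ i, (LinearMap.mulLeft k (x i)) ∘ₗ (quadEval k x) ∘ₗ (LinearMap.proj i)

theorem cubicEval_apply {B : Type u} [Ring B] [Algebra k B] (x : Fin n → B)
    (t : Fin n → Fin n → Fin n → k) : cubicEval k x t = ∑ i, x i * quadEval k x (t i) := by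
  simp [cubicEval]

/-- The value in `B` of a tensor of degree four. -/
noncomputable def quarticEval (k : Type u) [Field k] {B : Type u} [Ring B] [Algebra k B]
    {n : ℕ} (x : Fin n → B) :
    (Fin n → Fin n → Fin n → Fin n → k) →ₗ[k] B :=
  ∑ i, (LinearMap.mulLeft k (x i)) ∘ₗ (cubicEval k x) ∘ₗ (LinearMap.proj i)

theorem quarticEval_apply {B : Type u} [Ring B] [Algebra k B] (x : Fin n → B)
    (t : Fin n → Fin n → Fin n → Fin n → k) :
    quarticEval k x t = ∑ i, x i * cubicEval k x (t i) := by
  simp [quarticEval]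

theorem quadEval_apply {B : Type u} [Ring B] [Algebra k B] (x : Fin n → B)
    (r : Fin n → Fin n → k) : quadEval k x r = ∑ i, ∑ j, r i j • (x i * x j) := rfl

theorem map_quadEval {B C : Type u} [Ring B] [Algebra k B] [Ring C] [Algebra k C]
    (φ : B →ₐ[k] C) (x : Fin n → B) (r : Fin n → Fin n → k) :
    φ (quadEval k x r) = quadEval k (fun i => φ (x i)) r := by
  simp [quadEval_apply]

theorem map_cubicEval {B C : Type u} [Ring B] [Algebra k B] [Ring C] [Algebra k C]
    (φ : B →ₐ[k] C) (x : Fin n → B) (t : Fin n → Fin n → Fin n → k) :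
    φ (cubicEval k x t) = cubicEval k (fun i => φ (x i)) t := by
  simp [cubicEval_apply, map_quadEval]

/-- `V ⊗ W` for `W ⊆ V ⊗ V`. -/
def tensorLeft (W : Submodule k (Fin n → Fin n → k)) :
    Submodule k (Fin n → Fin n → Fin n → k) where
  carrier := {t | ∀ i, t i ∈ W}
  add_mem' ha hb i := W.add_mem (ha i) (hb i)
  zero_mem' _ := W.zero_mem
  smul_mem' c _ ha i := W.smul_mem c (ha i)

/-- `W ⊗ V` for `W ⊆ V ⊗ V`. -/
def tensorRight (W : Submodule k (Fin n → Fin n → k)) :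
    Submodule k (Fin n → Fin n → Fin n → k) where
  carrier := {t | ∀ l, (fun i j => t i j l) ∈ W}
  add_mem' ha hb i := W.add_mem (ha i) (hb i)
  zero_mem' _ := W.zero_mem
  smul_mem' c _ ha i := W.smul_mem c (ha i)

theorem cubicEval_eq_sum_right {B : Type u} [Ring B] [Algebra k B] (x : Fin n → B)
    (t : Fin n → Fin n → Fin n → k) :
    cubicEval k x t = ∑ l, quadEval k x (fun i j => t i j l) * x l := by
  simp only [cubicEval_apply, quadEval_apply, Finset.mul_sum, Finset.sum_mul]
  rw [Finset.sum_congr rfl fun i _ => Finset.sum_comm, Finset.sum_comm]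
  simp [mul_assoc]

/-- `x : Fin n → B` presents `B` as the quadratic algebra `T(V) / (W)`: the `xᵢ` generate `B`, they
satisfy the relations in `W`, and `B` is universal for these relations. -/
structure IsQuadraticPresentation (k : Type u) [Field k] {B : Type u} [Ring B] [Algebra k B] {n : ℕ}
    (x : Fin n → B) (W : Submodule k (Fin n → Fin n → k)) : Prop where
  adjoin_eq : Algebra.adjoin k (Set.range x) = ⊤
  rel : ∀ w ∈ W, quadEval k x w = 0
  lift : ∀ (A : Type u) [Ring A] [Algebra k A] (y : Fin n → A),
    (∀ w ∈ W, quadEval k y w = 0) → ∃ φ : B →ₐ[k] A, ∀ i, φ (x i) = y i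

namespace IsQuadraticPresentation

variable {B : Type u} [Ring B] [Algebra k B] {x : Fin n → B}
  {W : Submodule k (Fin n → Fin n → k)}

/-- The operator `xᵢ ⊗ -` on `k ⊕ V ⊕ (V ⊗ V)/W ⊕ Q`, where `Q` is a quotient `φ` of
`V ⊗ V ⊗ V`. -/
noncomputable def modelOp {Q : Type u} [AddCommGroup Q] [Module k Q]
    (W : Submodule k (Fin n → Fin n → k))
    (φ : (Fin n → Fin n → Fin n → k) →ₗ[k] Q) (hφ : tensorLeft W ≤ LinearMap.ker φ) (i : Fin n) :
    Module.End k (k × (Fin n → k) × ((Fin n → Fin n → k) ⧸ W) × Q) :=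
  LinearMap.prod 0 <| LinearMap.prod
    (LinearMap.single k (fun _ : Fin n => k) i ∘ₗ LinearMap.fst k _ _) <| LinearMap.prod
      (W.mkQ ∘ₗ LinearMap.single k (fun _ : Fin n => Fin n → k) i ∘ₗ LinearMap.fst k _ _ ∘ₗ
        LinearMap.snd k _ _)
      (W.liftQ (φ ∘ₗ LinearMap.single k (fun _ : Fin n => Fin n → Fin n → k) i) (by
          intro w hw
          refine hφ ?_
          intro j
          simp only [LinearMap.coe_single]
          rcases eq_or_ne i j with rfl | h
          · simpa using hw
          · simp [Pi.single_eq_of_ne' h]) ∘ₗ LinearMap.fst k _ _ ∘ₗ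
        LinearMap.snd k _ _ ∘ₗ LinearMap.snd k _ _)

theorem modelOp_apply {Q : Type u} [AddCommGroup Q] [Module k Q]
    (φ : (Fin n → Fin n → Fin n → k) →ₗ[k] Q) (hφ : tensorLeft W ≤ LinearMap.ker φ) (i : Fin n)
    (c : k) (v : Fin n → k) (r : Fin n → Fin n → k) (q : Q) :
    modelOp W φ hφ i (c, v, W.mkQ r, q) =
      (0, Pi.single i c, W.mkQ (Pi.single i v), φ (Pi.single i r)) := rfl

theorem sum_single_two (r : Fin n → Fin n → k) :
    ∑ i, ∑ j, r i j • (Pi.single i (Pi.single j 1) : Fin n → Fin n → k) = r := by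
  ext a b
  simp [Finset.sum_apply, Pi.single_apply, ite_apply]

theorem sum_single_three (t : Fin n → Fin n → Fin n → k) :
    ∑ i, (Pi.single i (t i) : Fin n → Fin n → Fin n → k) = t :=
  Finset.univ_sum_single t

/-- The degree three relations of `T(V)/(W)` are `V ⊗ W + W ⊗ V`. The algebra acts on
`k ⊕ V ⊕ (V ⊗ V)/W ⊕ (V ⊗ V ⊗ V)/(V ⊗ W + W ⊗ V)`, and a tensor is recovered modulo the relations
from its action on `1`. -/
theorem eval_model (h : IsQuadraticPresentation k x W) {Q : Type u} [AddCommGroup Q] [Module k Q]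
    (φ : (Fin n → Fin n → Fin n → k) →ₗ[k] Q) (hl : tensorLeft W ≤ LinearMap.ker φ)
    (hr : tensorRight W ≤ LinearMap.ker φ) :
    ∃ L : B →ₗ[k] ((Fin n → Fin n → k) ⧸ W) × Q,
      (∀ r, L (quadEval k x r) = (W.mkQ r, 0)) ∧ ∀ t, L (cubicEval k x t) = (0, φ t) := by
  have hop (c : k) (v : Fin n → k) (r : Fin n → Fin n → k) (q : Q) (s : Fin n → Fin n → k) :
      quadEval k (modelOp W φ hl) s (c, v, W.mkQ r, q) =
        (0, 0, c • W.mkQ s, φ (fun i j l => s i j * v l)) := by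
    simp only [quadEval_apply, LinearMap.sum_apply, LinearMap.smul_apply, Module.End.mul_apply,
      modelOp_apply, Prod.smul_mk, Prod.fst_sum, Prod.snd_sum, Prod.ext_iff]
    refine ⟨by simp, by simp, ?_, ?_⟩
    · rw [← map_smul]
      simp only [← map_smul, ← map_sum]
      congr 1
      conv_rhs => rw [← sum_single_two s]
      simp only [Finset.smul_sum]
      refine Finset.sum_congr rfl fun i _ => Finset.sum_congr rfl fun j _ => ?_
      ext a b
      simp only [Pi.smul_apply, Pi.single_apply, smul_eq_mul, apply_ite]
      split_ifs <;> simp [mul_comm, Pi.single_apply]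
    · simp only [← map_smul, ← map_sum]
      congr 1
      ext a b c
      simp [Finset.sum_apply, Pi.single_apply, ite_apply]
  obtain ⟨Φ, hΦ⟩ := h.lift _ (modelOp W φ hl) (by
    intro w hw
    refine LinearMap.ext fun ⟨c, v, r, q⟩ => ?_
    obtain ⟨r, rfl⟩ := W.mkQ_surjective r
    rw [hop]
    have h1 : W.mkQ w = 0 := by simpa using hw
    have h2 : φ (fun i j l => w i j * v l) = 0 := by
      refine hr fun l => ?_
      have : (fun i j => w i j * v l) = v l • w := by ext; simp [mul_comm]
      rw [this]
      exact W.smul_mem _ hw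
    simp [h1, h2])
  have hΦ' : (fun i => Φ (x i)) = modelOp W φ hl := funext hΦ
  refine ⟨LinearMap.snd k _ _ ∘ₗ LinearMap.snd k _ _ ∘ₗ
    LinearMap.applyₗ (1, 0, W.mkQ 0, 0) ∘ₗ Φ.toLinearMap, ?_, ?_⟩
  · intro r
    simp only [LinearMap.comp_apply, AlgHom.toLinearMap_apply, map_quadEval, hΦ',
      LinearMap.applyₗ_apply_apply, hop]
    have : (fun i j l => r i j * (0 : Fin n → k) l) = 0 := by ext; simp
    rw [this, map_zero, one_smul]
    rfl
  · intro t
    simp only [LinearMap.comp_apply, AlgHom.toLinearMap_apply, map_cubicEval, hΦ',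
      LinearMap.applyₗ_apply_apply]
    simp only [cubicEval_apply, LinearMap.sum_apply, Module.End.mul_apply, hop]
    have h0 (i) : (fun a j l => t i a j * (0 : Fin n → k) l) = 0 := by ext; simp
    simp only [h0, map_zero, one_smul, modelOp_apply, Prod.snd_sum,
      LinearMap.snd_apply, Pi.single_zero]
    rw [Prod.ext_iff, Prod.fst_sum, Prod.snd_sum, ← map_sum, sum_single_three]
    simp

theorem mem_of_quadEval_eq_zero (h : IsQuadraticPresentation k x W) {r : Fin n → Fin n → k}
    (hr : quadEval k x r = 0) : r ∈ W := by
  obtain ⟨L, hL, -⟩ := h.eval_model (Q := PUnit) 0 (by simp) (by simp)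
  have := hL r
  rw [hr, map_zero] at this
  simpa using (congrArg Prod.fst this).symm

theorem relSpace_eq (h : IsQuadraticPresentation k x W) : relSpace k x = W :=
  le_antisymm (fun _ hr => h.mem_of_quadEval_eq_zero hr) fun w hw => h.rel w hw

theorem mem_of_cubicEval_eq_zero (h : IsQuadraticPresentation k x W)
    {t : Fin n → Fin n → Fin n → k}
    (ht : cubicEval k x t = 0) : t ∈ tensorLeft W ⊔ tensorRight W := by
  obtain ⟨L, -, hL⟩ := h.eval_model (tensorLeft W ⊔ tensorRight W).mkQ (by simp) (by simp)
  have := hL t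
  rw [ht, map_zero] at this
  simpa using (congrArg Prod.snd this).symm

end IsQuadraticPresentation

end Tensor

/-! ### Presentations of quotients and quadratic duals -/

section Quotients

variable {k : Type u} [Field k] {n : ℕ}

theorem AlgQuot.proj_surjective {B : Type u} [Ring B] [Algebra k B] (s : Set B) :
    Function.Surjective (AlgQuot.proj k s) := RingQuot.mkAlgHom_surjective k _

theorem AlgQuot.proj_eq_zero {B : Type u} [Ring B] [Algebra k B] {s : Set B} {b : B}
    (hb : b ∈ s) : AlgQuot.proj k s b = 0 := by
  have := RingQuot.mkAlgHom_rel k (s := fun a b : B => a ∈ s ∧ b = 0) (x := b) (y := 0) ⟨hb, rfl⟩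
  rwa [map_zero] at this

theorem AlgQuot.exists_lift {B : Type u} [Ring B] [Algebra k B] {s : Set B}
    {A : Type v} [Ring A] [Algebra k A] (φ : B →ₐ[k] A) (hφ : ∀ b ∈ s, φ b = 0) :
    ∃ ψ : AlgQuot s →ₐ[k] A, ∀ b, ψ (AlgQuot.proj k s b) = φ b :=
  ⟨RingQuot.liftAlgHom k ⟨φ, fun {a b} h => by rw [hφ a h.1, h.2, map_zero]⟩, fun b =>
    RingQuot.liftAlgHom_mkAlgHom_apply ..⟩

theorem adjoin_range_comp {B C : Type u} [Ring B] [Algebra k B] [Ring C] [Algebra k C]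
    {x : Fin n → B} (hx : Algebra.adjoin k (Set.range x) = ⊤) (π : B →ₐ[k] C)
    (hπ : Function.Surjective π) : Algebra.adjoin k (Set.range fun i => π (x i)) = ⊤ := by
  have : Set.range (fun i => π (x i)) = π '' Set.range x := by
    rw [← Set.range_comp]; rfl
  rw [this, ← AlgHom.map_adjoin, hx, Algebra.map_top, (AlgHom.range_eq_top π).2 hπ]

theorem isQuadraticPresentation_quotient {s : Set (FreeAlgebra k (Fin n))}
    {W : Submodule k (Fin n → Fin n → k)}
    (hW : ∀ (A : Type u) [Ring A] [Algebra k A] (y : Fin n → A),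
      (∀ b ∈ s, FreeAlgebra.lift k y b = 0) ↔ ∀ w ∈ W, quadEval k y w = 0) :
    IsQuadraticPresentation k (fun i => AlgQuot.proj k s (FreeAlgebra.ι k i)) W where
  adjoin_eq := adjoin_range_comp (FreeAlgebra.adjoin_range_ι k (Fin n)) _
    (AlgQuot.proj_surjective s)
  rel := by
    have : FreeAlgebra.lift k (fun i => AlgQuot.proj k s (FreeAlgebra.ι k i)) =
        AlgQuot.proj k s := by ext; simp
    refine (hW _ _).1 fun b hb => ?_
    rw [this, AlgQuot.proj_eq_zero hb]
  lift A _ _ y hy := by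
    obtain ⟨ψ, hψ⟩ := AlgQuot.exists_lift (FreeAlgebra.lift k y) ((hW A y).2 hy)
    exact ⟨ψ, fun i => by rw [hψ, FreeAlgebra.lift_ι_apply]⟩

theorem lift_quadEval {A : Type u} [Ring A] [Algebra k A] (y : Fin n → A)
    (r : Fin n → Fin n → k) :
    FreeAlgebra.lift k y (quadEval k (FreeAlgebra.ι k) r) = quadEval k y r := by
  rw [map_quadEval]; simp

/-- The span of the relations `∂ᵢω`. -/
def derSpan (ω : Potential k) : Submodule k (Fin 3 → Fin 3 → k) :=
  Submodule.span k (Set.range ω)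

theorem derQuot_presentation (ω : Potential k) :
    IsQuadraticPresentation k (derGen ω) (derSpan ω) := by
  refine isQuadraticPresentation_quotient fun A _ _ y => ?_
  simp only [Set.forall_mem_range, lift_quadEval, derSpan]
  constructor
  · intro h
    change _ ≤ LinearMap.ker (quadEval k y)
    rw [Submodule.span_le]
    rintro _ ⟨i, rfl⟩
    exact h i
  · exact fun h i => h _ (Submodule.subset_span ⟨i, rfl⟩)

theorem quadDual_presentation {B : Type u} [Ring B] [Algebra k B] (x : Fin n → B) :
    IsQuadraticPresentation k (dualGen k x) (perp (relSpace k x)) := by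
  refine isQuadraticPresentation_quotient fun A _ _ y => ?_
  simp only [Set.forall_mem_image, lift_quadEval]
  rfl

theorem conic_presentation {ω : Potential k} (r : Fin 3 → Fin 3 → k) :
    IsQuadraticPresentation k (conicGen (quadEval k (derGen ω) r))
      (derSpan ω ⊔ Submodule.span k {r}) where
  adjoin_eq := adjoin_range_comp (derQuot_presentation ω).adjoin_eq _
    (AlgQuot.proj_surjective _)
  rel := by
    change _ ≤ LinearMap.ker (quadEval k _)
    have key (w) : quadEval k (conicGen (quadEval k (derGen ω) r)) w =
        AlgQuot.proj k {quadEval k (derGen ω) r} (quadEval k (derGen ω) w) :=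
      (map_quadEval _ _ _).symm
    rw [sup_le_iff, Submodule.span_singleton_le_iff_mem]
    refine ⟨fun w hw => ?_, ?_⟩
    · rw [LinearMap.mem_ker, key, (derQuot_presentation ω).rel w hw, map_zero]
    · exact (key r).trans (AlgQuot.proj_eq_zero (Set.mem_singleton _))
  lift A _ _ y hy := by
    obtain ⟨φ, hφ⟩ := (derQuot_presentation ω).lift A y fun w hw =>
      hy w (Submodule.mem_sup_left hw)
    obtain ⟨ψ, hψ⟩ := AlgQuot.exists_lift (s := {quadEval k (derGen ω) r}) φ (by
      rintro _ rfl
      rw [map_quadEval, show (fun i => φ (derGen ω i)) = y from funext hφ]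
      exact hy r (Submodule.mem_sup_right (Submodule.mem_span_singleton_self r)))
    exact ⟨ψ, fun i => (hψ _).trans (hφ i)⟩

end Quotients

/-! ### Orthogonal complements -/

section Perp

variable {k : Type u} [Field k] {n : ℕ}

/-- The standard pairing on `V ⊗ V`. -/
noncomputable def quadPairing (k : Type u) [Field k] (n : ℕ) :
    LinearMap.BilinForm k (Fin n → Fin n → k) :=
  LinearMap.mk₂ k (fun r s => ∑ i, ∑ j, r i j * s i j)
    (fun a b c => by simp [add_mul, Finset.sum_add_distrib])
    (fun c a b => by simp [Finset.mul_sum, mul_assoc])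
    (fun a b c => by simp [mul_add, Finset.sum_add_distrib])
    (fun c a b => by simp [Finset.mul_sum, mul_left_comm])

theorem quadPairing_apply (r s : Fin n → Fin n → k) :
    quadPairing k n r s = ∑ i, ∑ j, r i j * s i j := rfl

theorem quadPairing_comm (r s : Fin n → Fin n → k) :
    quadPairing k n r s = quadPairing k n s r := by
  simp [quadPairing_apply, mul_comm]

theorem quadPairing_isRefl : (quadPairing k n).IsRefl := fun r s h => by
  rw [quadPairing_comm]; exact h

theorem quadPairing_nondegenerate : (quadPairing k n).Nondegenerate := by
  have h1 : (quadPairing k n).SeparatingLeft := by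
    intro r hr
    ext i j
    have := hr (Pi.single i (Pi.single j 1))
    simpa [quadPairing_apply, Pi.single_apply, ite_apply] using this
  exact ⟨h1, fun r hr => h1 r fun s => by rw [quadPairing_comm]; exact hr s⟩

theorem mem_perp {R : Submodule k (Fin n → Fin n → k)} {s : Fin n → Fin n → k} :
    s ∈ perp R ↔ ∀ r ∈ R, quadPairing k n s r = 0 := Iff.rfl

theorem perp_eq_orthogonal (R : Submodule k (Fin n → Fin n → k)) :
    perp R = (quadPairing k n).orthogonal R := by
  ext s
  simp only [mem_perp, LinearMap.BilinForm.mem_orthogonal_iff, quadPairing_comm s]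

theorem finrank_perp (R : Submodule k (Fin n → Fin n → k)) :
    Module.finrank k (perp R) + Module.finrank k R = n * n := by
  have := LinearMap.BilinForm.finrank_orthogonal (quadPairing_nondegenerate (k := k) (n := n)) R
  have hle := Submodule.finrank_le R
  rw [← perp_eq_orthogonal] at this
  have hn : Module.finrank k (Fin n → Fin n → k) = n * n := by
    rw [Module.finrank_pi_fintype]; simp
  omega

theorem perp_perp (R : Submodule k (Fin n → Fin n → k)) : perp (perp R) = R := by
  rw [perp_eq_orthogonal, perp_eq_orthogonal, LinearMap.BilinForm.orthogonal_orthogonal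
    quadPairing_nondegenerate quadPairing_isRefl]

theorem perp_anti {R R' : Submodule k (Fin n → Fin n → k)} (h : R ≤ R') : perp R' ≤ perp R :=
  fun _ hs r hr => hs r (h hr)

end Perp

end NCConic

namespace NCConic

/-! ### Low degree structure of symmetric regular superpotentials -/

section DegPart

variable {k : Type u} [Field k] {n : ℕ} {B : Type u} [Ring B] [Algebra k B]

theorem range_sum_mulLeft {E : Type u} [AddCommGroup E] [Module k E] (x : Fin n → B)
    (L : E →ₗ[k] B) :
    LinearMap.range (∑ i, (LinearMap.mulLeft k (x i)) ∘ₗ L ∘ₗ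
      (LinearMap.proj i : (Fin n → E) →ₗ[k] E)) =
      Submodule.span k (Set.range x) * LinearMap.range L := by
  apply le_antisymm
  · rintro _ ⟨t, rfl⟩
    simp only [LinearMap.sum_apply, LinearMap.comp_apply, LinearMap.mulLeft_apply]
    exact Submodule.sum_mem _ fun i _ => Submodule.mul_mem_mul
      (Submodule.subset_span ⟨i, rfl⟩) ⟨_, rfl⟩
  · rw [← Submodule.span_eq (LinearMap.range L), Submodule.span_mul_span, Submodule.span_le]
    rintro _ ⟨_, ⟨i, rfl⟩, _, ⟨e, rfl⟩, rfl⟩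
    refine ⟨Pi.single i e, ?_⟩
    simp [Pi.single_apply, apply_ite]

theorem range_quadEval (x : Fin n → B) :
    LinearMap.range (quadEval k x) = degPart k x 2 := by
  have h1 : LinearMap.range (∑ i, (LinearMap.toSpanSingleton k B (x i)) ∘ₗ
      (LinearMap.proj i : (Fin n → k) →ₗ[k] k)) = Submodule.span k (Set.range x) := by
    ext b
    rw [Submodule.mem_span_range_iff_exists_fun]
    simp [LinearMap.mem_range]
  have h2 := range_sum_mulLeft x (∑ i, (LinearMap.toSpanSingleton k B (x i)) ∘ₗ
      (LinearMap.proj i : (Fin n → k) →ₗ[k] k))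
  rw [degPart, pow_two]
  rw [h1] at h2
  rw [← h2]
  congr 1
  ext
  simp [quadEval_apply, Finset.sum_apply, Pi.single_apply, ite_apply]

theorem range_cubicEval (x : Fin n → B) :
    LinearMap.range (cubicEval k x) = degPart k x 3 := by
  rw [cubicEval, range_sum_mulLeft, range_quadEval, degPart, degPart, ← pow_succ']

theorem range_quarticEval (x : Fin n → B) :
    LinearMap.range (quarticEval k x) = degPart k x 4 := by
  rw [quarticEval, range_sum_mulLeft, range_cubicEval, degPart, degPart, ← pow_succ']

theorem finrank_tensorLeft (W : Submodule k (Fin n → Fin n → k)) :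
    Module.finrank k (tensorLeft W) = n * Module.finrank k W := by
  let e : tensorLeft W ≃ₗ[k] (Fin n → W) :=
    { toFun := fun t i => ⟨t.1 i, t.2 i⟩
      invFun := fun s => ⟨fun i => s i, fun i => (s i).2⟩
      map_add' := fun _ _ => rfl
      map_smul' := fun _ _ => rfl
      left_inv := fun _ => rfl
      right_inv := fun _ => rfl }
  rw [e.finrank_eq, Module.finrank_pi_fintype]; simp

theorem finrank_tensorRight (W : Submodule k (Fin n → Fin n → k)) :
    Module.finrank k (tensorRight W) = n * Module.finrank k W := by
  let e : tensorRight W ≃ₗ[k] (Fin n → W) :=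
    { toFun := fun t l => ⟨fun i j => t.1 i j l, t.2 l⟩
      invFun := fun s => ⟨fun i j l => (s l).1 i j, fun l => (s l).2⟩
      map_add' := fun _ _ => rfl
      map_smul' := fun _ _ => rfl
      left_inv := fun _ => rfl
      right_inv := fun _ => rfl }
  rw [e.finrank_eq, Module.finrank_pi_fintype]; simp

end DegPart

section Potential

variable {k : Type u} [Field k]

/-- The part of the structure of a symmetric regular superpotential `ω` that determines `C(A)`:
`ω` is a symmetric tensor, its derivatives are linearly independent and span a space `R`, and
`R ⊗ V ∩ V ⊗ R` is spanned by `ω`. -/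
structure IsNondegenerateCubic (ω : Potential k) : Prop where
  swap_left : ∀ i j l, ω j i l = ω i j l
  swap_right : ∀ i j l, ω i l j = ω i j l
  finrank_eq : Module.finrank k (derSpan ω) = 3
  inf_eq : ∀ t ∈ tensorLeft (derSpan ω), t ∈ tensorRight (derSpan ω) → ∃ c : k, t = c • ω

/-- The coefficients of `(1 - t)⁻³` in degrees two and three. -/
theorem hilbert_coeff {h : ℕ → ℤ}
    (hh : PowerSeries.mk h * (1 - (PowerSeries.X : PowerSeries ℤ)) ^ 3 = 1) :
    h 2 = 6 ∧ h 3 = 10 := by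
  have e : PowerSeries.mk h * (1 - (PowerSeries.X : PowerSeries ℤ)) ^ 3 =
      PowerSeries.mk h - 3 * (PowerSeries.mk h * PowerSeries.X ^ 1) +
        3 * (PowerSeries.mk h * PowerSeries.X ^ 2) - PowerSeries.mk h * PowerSeries.X ^ 3 := by
    ring
  rw [e] at hh
  have key (n : ℕ) := congrArg (PowerSeries.coeff n) hh
  have h3 (p : PowerSeries ℤ) (n : ℕ) :
      PowerSeries.coeff n (3 * p) = 3 * PowerSeries.coeff n p := by
    rw [show (3 : PowerSeries ℤ) = PowerSeries.C 3 from (map_ofNat _ 3).symm,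
      PowerSeries.coeff_C_mul]
  have k0 := key 0
  have k1 := key 1
  have k2 := key 2
  have k3 := key 3
  simp only [map_add, map_sub, h3, PowerSeries.coeff_mk, PowerSeries.coeff_mul_X_pow',
    PowerSeries.coeff_one] at k0 k1 k2 k3
  norm_num at k0 k1 k2 k3
  constructor <;> lia

theorem derSpan_symm {ω : Potential k} (hω : ∀ i j l, ω i l j = ω i j l)
    {w : Fin 3 → Fin 3 → k} (hw : w ∈ derSpan ω) (i j : Fin 3) : w j i = w i j := by
  induction hw using Submodule.span_induction with
  | mem x h => obtain ⟨a, rfl⟩ := h; exact hω a i j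
  | zero => rfl
  | add x y _ _ hx hy => simp [hx, hy]
  | smul a x _ hx => simp [hx]

omit [Field k] in
theorem IsSymmetric.swap_left {ω : Potential k} (h : IsSymmetric ω) (i j l : Fin 3) :
    ω j i l = ω i j l := by
  simpa [Equiv.swap_apply_def] using h (Equiv.swap 0 1) ![i, j, l]

omit [Field k] in
theorem IsSymmetric.swap_right {ω : Potential k} (h : IsSymmetric ω) (i j l : Fin 3) :
    ω i l j = ω i j l := by
  simpa [Equiv.swap_apply_def] using h (Equiv.swap 1 2) ![i, j, l]

/-- The Hilbert series gives `dim R = 3` and `dim (R ⊗ V + V ⊗ R) ≥ 27 - 10`, so that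
`dim (R ⊗ V ∩ V ⊗ R) ≤ 9 + 9 - 17 = 1`. -/
theorem IsSymmetricRegularSuperpotential.isNondegenerateCubic {ω : Potential k}
    (h : IsSymmetricRegularSuperpotential ω) : IsNondegenerateCubic ω := by
  obtain ⟨h2, h3⟩ := hilbert_coeff h.regular.hilbert
  have hP := derQuot_presentation ω
  have hfin : Module.finrank k (derSpan ω) = 3 := by
    have := (quadEval k (derGen ω)).finrank_range_add_finrank_ker
    rw [range_quadEval, Module.finrank_pi_fintype] at this
    change _ + Module.finrank k (relSpace k (derGen ω)) = _ at this
    rw [hP.relSpace_eq] at this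
    simp at this
    lia
  have hne : ω ≠ 0 := by
    rintro rfl
    have : derSpan (0 : Potential k) = ⊥ := by
      rw [derSpan, Submodule.span_eq_bot]
      rintro _ ⟨i, rfl⟩; rfl
    rw [this] at hfin
    simp at hfin
  have hl : ω ∈ tensorLeft (derSpan ω) := fun i => Submodule.subset_span ⟨i, rfl⟩
  have hr : ω ∈ tensorRight (derSpan ω) := fun l => by
    have : (fun i j => ω i j l) = ω l := by
      ext i j
      rw [← h.symmetric.swap_left l i j, h.symmetric.swap_right i j l]
    rw [this]
    exact hl l
  have hker : Module.finrank k (LinearMap.ker (cubicEval k (derGen ω))) = 17 := by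
    have := (cubicEval k (derGen ω)).finrank_range_add_finrank_ker
    rw [range_cubicEval, Module.finrank_pi_fintype] at this
    simp [Module.finrank_pi_fintype] at this
    lia
  have hle : LinearMap.ker (cubicEval k (derGen ω)) ≤
      tensorLeft (derSpan ω) ⊔ tensorRight (derSpan ω) :=
    fun t ht => hP.mem_of_cubicEval_eq_zero ht
  have hle' := Submodule.finrank_mono hle
  have hsum := Submodule.finrank_sup_add_finrank_inf_eq (tensorLeft (derSpan ω))
    (tensorRight (derSpan ω))
  rw [finrank_tensorLeft, finrank_tensorRight, hfin] at hsum
  rw [hker] at hle'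
  refine ⟨h.symmetric.swap_left, h.symmetric.swap_right, hfin, fun t htl htr => ?_⟩
  have hspan : Submodule.span k {ω} = tensorLeft (derSpan ω) ⊓ tensorRight (derSpan ω) := by
    apply Submodule.eq_of_le_of_finrank_le
    · rw [Submodule.span_singleton_le_iff_mem]
      exact ⟨hl, hr⟩
    · rw [finrank_span_singleton hne]
      generalize Module.finrank k ↥(tensorLeft (derSpan ω) ⊓ tensorRight (derSpan ω)) = d at *
      have hd : d ≤ 1 := by omega
      exact hd
  have : t ∈ Submodule.span k {ω} := hspan ▸ ⟨htl, htr⟩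
  obtain ⟨c, rfl⟩ := Submodule.mem_span_singleton.1 this
  exact ⟨c, rfl⟩

namespace IsNondegenerateCubic

variable {ω : Potential k} (h : IsNondegenerateCubic ω)
include h

theorem symm_of_mem {w : Fin 3 → Fin 3 → k} (hw : w ∈ derSpan ω) (i j : Fin 3) :
    w j i = w i j := derSpan_symm h.swap_right hw i j

theorem linearIndependent : LinearIndependent k ω := by
  rw [linearIndependent_iff_card_eq_finrank_span, Set.finrank]
  exact h.finrank_eq.symm

/-- The derivatives `∂ᵢω` are not all multiples of one tensor. -/
theorem not_le_span_singleton (w : Fin 3 → Fin 3 → k) :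
    ¬ ∀ i, ω i ∈ Submodule.span k {w} := by
  intro hw
  have : derSpan ω ≤ Submodule.span k {w} := by
    rw [derSpan, Submodule.span_le]
    rintro _ ⟨i, rfl⟩
    exact hw i
  have h1 := Submodule.finrank_mono this
  have h2 := finrank_span_le_card (R := k) ({w} : Set (Fin 3 → Fin 3 → k))
  rw [h.finrank_eq] at h1
  simp at h2
  omega

theorem eq_zero_of_sum_smul {c : Fin 3 → k} (hc : ∀ j l, ∑ i, c i * ω i j l = 0) : c = 0 := by
  have := Fintype.linearIndependent_iff.1 h.linearIndependent c (by
    ext j l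
    simpa [Finset.sum_apply] using hc j l)
  exact funext this

/-- If `v ⊗ v ∈ R`, then `v ⊗ v ⊗ v` is a multiple of `ω`, whose derivatives are then dependent. -/
theorem eq_zero_of_sq_mem {v : Fin 3 → k} (hv : (fun i j => v i * v j) ∈ derSpan ω) : v = 0 := by
  obtain ⟨c, hc⟩ := h.inf_eq (fun i j l => v i * v j * v l)
    (fun i => by
      have : (fun j l => v i * v j * v l) = v i • (fun i j => v i * v j) := by
        ext; simp [mul_assoc]
      exact (congrArg (· ∈ derSpan ω) this).mpr (Submodule.smul_mem _ _ hv))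
    (fun l => by
      have : (fun i j => v i * v j * v l) = v l • (fun i j => v i * v j) := by
        ext; simp [mul_comm]
      exact (congrArg (· ∈ derSpan ω) this).mpr (Submodule.smul_mem _ _ hv))
  by_contra hv0
  obtain ⟨a, ha⟩ := Function.ne_iff.1 hv0
  have hc0 : c ≠ 0 := by
    rintro rfl
    have := congrFun (congrFun (congrFun hc a) a) a
    simp at this ha
    exact ha this
  refine h.not_le_span_singleton (fun i j => v i * v j) fun i => ?_
  rw [Submodule.mem_span_singleton]
  refine ⟨c⁻¹ * v i, ?_⟩
  ext j l
  have := congrFun (congrFun (congrFun hc i) j) l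
  simp only [Pi.smul_apply, smul_eq_mul] at this ⊢
  field_simp
  linear_combination this

theorem transpose_mem_perp {q : Fin 3 → Fin 3 → k} (hq : q ∈ perp (derSpan ω)) :
    (fun i j => q j i) ∈ perp (derSpan ω) := by
  intro r hr
  rw [← hq r hr, Finset.sum_comm]
  simp [h.symm_of_mem hr]

/-- A functional on `V ⊗ V ⊗ V` that vanishes on `V ⊗ R` and `R ⊗ V`. -/
theorem sum_skew_eq_zero {q : Fin 3 → Fin 3 → k} (hq : q ∈ perp (derSpan ω)) (p : Fin 3 → k)
    {t : Fin 3 → Fin 3 → Fin 3 → k}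
    (ht : t ∈ tensorLeft (derSpan ω) ⊔ tensorRight (derSpan ω)) :
    ∑ i, ∑ j, ∑ l, t i j l * (q i j * p l + q j l * p i - q i l * p j) = 0 := by
  obtain ⟨a, ha, b, hb, rfl⟩ := Submodule.mem_sup.1 ht
  simp only [Pi.add_apply, add_mul, Finset.sum_add_distrib]
  have h1 : ∑ i, ∑ j, ∑ l, a i j l * (q i j * p l + q j l * p i - q i l * p j) = 0 := by
    refine Finset.sum_eq_zero fun i _ => ?_
    have e1 : ∑ j, ∑ l, a i j l * (q i j * p l) = ∑ j, ∑ l, a i j l * (q i l * p j) := by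
      rw [Finset.sum_comm]
      simp [h.symm_of_mem (ha i)]
    have e2 : ∑ j, ∑ l, a i j l * (q j l * p i) = 0 := by
      have := hq _ (ha i)
      calc _ = p i * ∑ j, ∑ l, q j l * a i j l := by
            simp only [Finset.mul_sum]
            exact Finset.sum_congr rfl fun _ _ => Finset.sum_congr rfl fun _ _ => by ring
        _ = 0 := by rw [this, mul_zero]
    simp only [mul_sub, mul_add, Finset.sum_sub_distrib, Finset.sum_add_distrib, e1, e2]
    ring
  have h2 : ∑ i, ∑ j, ∑ l, b i j l * (q i j * p l + q j l * p i - q i l * p j) = 0 := by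
    have : ∑ i, ∑ j, ∑ l, b i j l * (q i j * p l + q j l * p i - q i l * p j) =
        ∑ l, ∑ i, ∑ j, b i j l * (q i j * p l + q j l * p i - q i l * p j) := by
      rw [Finset.sum_congr rfl fun i _ => Finset.sum_comm, Finset.sum_comm]
    rw [this]
    refine Finset.sum_eq_zero fun l _ => ?_
    have e1 : ∑ i, ∑ j, b i j l * (q j l * p i) = ∑ i, ∑ j, b i j l * (q i l * p j) := by
      rw [Finset.sum_comm]
      refine Finset.sum_congr rfl fun i _ => Finset.sum_congr rfl fun j _ => ?_
      rw [h.symm_of_mem (hb l) i j]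
    have e2 : ∑ i, ∑ j, b i j l * (q i j * p l) = 0 := by
      have := hq _ (hb l)
      calc _ = p l * ∑ i, ∑ j, q i j * b i j l := by
            simp only [Finset.mul_sum]
            exact Finset.sum_congr rfl fun _ _ => Finset.sum_congr rfl fun _ _ => by ring
        _ = 0 := by rw [this, mul_zero]
    simp only [mul_sub, mul_add, Finset.sum_sub_distrib, Finset.sum_add_distrib, e1, e2]
    ring
  rw [h1, h2, add_zero]

/-- A central element of degree two is represented by a symmetric tensor. Otherwise its
antisymmetric part yields `v ≠ 0` with `v ⊗ v ∈ R`. -/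
theorem symm_of_central [NeZero (2 : k)] {r : Fin 3 → Fin 3 → k}
    (hr : quadEval k (derGen ω) r ∈ Subring.center (DerQuot ω)) (i j : Fin 3) :
    r j i = r i j := by
  rw [Subring.mem_center_iff] at hr
  have hmem (m : Fin 3) : (fun i j l => (if i = m then r j l else 0) -
      (if l = m then r i j else 0)) ∈ tensorLeft (derSpan ω) ⊔ tensorRight (derSpan ω) := by
    apply (derQuot_presentation ω).mem_of_cubicEval_eq_zero
    have e : (fun i j l => (if i = m then r j l else 0) - (if l = m then r i j else 0)) =
        (fun i j l => (if i = m then r j l else 0)) -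
          (fun i j l => (if l = m then r i j else 0)) := rfl
    rw [e, map_sub, cubicEval_apply, cubicEval_eq_sum_right, sub_eq_zero]
    have e1 (i : Fin 3) : quadEval k (derGen ω) (fun j l => if i = m then r j l else 0) =
        if i = m then quadEval k (derGen ω) r else 0 := by
      split_ifs
      · rfl
      · exact map_zero _
    simp only [e1, mul_ite, ite_mul, mul_zero, zero_mul, Finset.sum_ite_eq', Finset.mem_univ,
      if_true]
    exact hr _
  have hq (l : Fin 3) (m : Fin 3) (q) (hq : q ∈ perp (derSpan ω)) :
      ∑ j, (q m j + q j m) * (r j l - r l j) = 0 := by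
    have := h.sum_skew_eq_zero (q := fun i j => q i j + q j i)
      ((perp _).add_mem hq (h.transpose_mem_perp hq)) (Pi.single l 1) (hmem m)
    have two := two_ne_zero (α := k)
    refine (mul_eq_zero_iff_left two).1 ?_
    rw [← this]
    fin_cases l <;> fin_cases m <;> simp [Fin.sum_univ_three] <;> ring
  have hv (l : Fin 3) : (fun j => r j l - r l j) = 0 := by
    apply h.eq_zero_of_sq_mem
    rw [← perp_perp (derSpan ω)]
    intro q hq'
    have := fun m => hq l m q hq'
    simp only [Fin.sum_univ_three] at this ⊢
    have two := two_ne_zero (α := k)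
    refine (mul_eq_zero_iff_left two).1 ?_
    linear_combination (r 0 l - r l 0) * this 0 + (r 1 l - r l 1) * this 1 +
      (r 2 l - r l 2) * this 2
  exact sub_eq_zero.1 (congrFun (hv i) j)

/-- In degree three the quadratic dual of `D(ω)` is spanned by a tensor that is dual to `ω`. -/
theorem cubicEval_mem {A : Type u} [Ring A] [Algebra k A] (x : Fin 3 → A) (N : Submodule k A)
    (hl : ∀ w ∈ perp (derSpan ω), ∀ i, x i * quadEval k x w ∈ N)
    (hr : ∀ w ∈ perp (derSpan ω), ∀ i, quadEval k x w * x i ∈ N)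
    {t : Fin 3 → Fin 3 → Fin 3 → k} (ht : ∑ i, ∑ j, ∑ l, t i j l * ω i j l = 0) :
    cubicEval k x t ∈ N := by
  by_contra hN
  obtain ⟨θ, hθ, hθN⟩ := Submodule.exists_le_ker_of_notMem hN
  obtain ⟨c, hc⟩ := h.inf_eq (fun i j l => θ (x i * (x j * x l)))
    (fun i => by
      rw [← perp_perp (derSpan ω)]
      intro w hw
      have : θ _ = 0 := hθN (hl w hw i)
      rw [quadEval_apply] at this
      simpa [Finset.mul_sum, mul_comm] using this)
    (fun i => by
      rw [← perp_perp (derSpan ω)]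
      intro w hw
      have : θ _ = 0 := hθN (hr w hw i)
      rw [quadEval_apply] at this
      simpa [Finset.sum_mul, mul_comm, mul_assoc] using this)
  apply hθ
  have e : θ (cubicEval k x t) = ∑ i, ∑ j, ∑ l, t i j l * θ (x i * (x j * x l)) := by
    simp [cubicEval_apply, quadEval_apply, Finset.mul_sum]
  have hc' (i j l) : θ (x i * (x j * x l)) = c * ω i j l :=
    congrFun (congrFun (congrFun hc i) j) l
  rw [e]
  simp only [hc', mul_left_comm _ c, ← Finset.mul_sum, ht, mul_zero]

/-- In degree four the quadratic dual of `D(ω)` vanishes: a functional on it is a symmetric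
tensor of the form `c ⊗ ω`. -/
theorem quarticEval_mem {A : Type u} [Ring A] [Algebra k A] (x : Fin 3 → A) (N : Submodule k A)
    (h1 : ∀ w ∈ perp (derSpan ω), ∀ i j, x i * (x j * quadEval k x w) ∈ N)
    (h2 : ∀ w ∈ perp (derSpan ω), ∀ i j, x i * (quadEval k x w * x j) ∈ N)
    (h3 : ∀ w ∈ perp (derSpan ω), ∀ i j, quadEval k x w * (x i * x j) ∈ N)
    (t : Fin 3 → Fin 3 → Fin 3 → Fin 3 → k) : quarticEval k x t ∈ N := by
  by_contra hN
  obtain ⟨θ, hθ, hθN⟩ := Submodule.exists_le_ker_of_notMem hN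
  have hc (i : Fin 3) : ∃ c : k, (fun j l m => θ (x i * (x j * (x l * x m)))) = c • ω := by
    refine h.inf_eq _ (fun j => ?_) (fun m => ?_)
    · rw [← perp_perp (derSpan ω)]
      intro w hw
      have : θ _ = 0 := hθN (h1 w hw i j)
      rw [quadEval_apply] at this
      simpa [Finset.mul_sum, mul_comm] using this
    · rw [← perp_perp (derSpan ω)]
      intro w hw
      have : θ _ = 0 := hθN (h2 w hw i m)
      rw [quadEval_apply] at this
      simpa [Finset.mul_sum, Finset.sum_mul, mul_comm, mul_assoc] using this
  choose c hc using hc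
  have hc' (i j l m) : θ (x i * (x j * (x l * x m))) = c i * ω j l m :=
    congrFun (congrFun (congrFun (hc i) j) l) m
  have hsymm (i j l m) : c j * ω i l m = c i * ω j l m := by
    have hD : (fun i j => θ (x i * (x j * (x l * x m)))) ∈ derSpan ω := by
      rw [← perp_perp (derSpan ω)]
      intro w hw
      have : θ _ = 0 := hθN (h3 w hw l m)
      rw [quadEval_apply] at this
      simpa [Finset.sum_mul, mul_comm, mul_assoc] using this
    rw [← hc', ← hc', h.symm_of_mem hD i j]
  have hc0 : c = 0 := by
    by_contra hne
    obtain ⟨a, ha⟩ := Function.ne_iff.1 hne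
    refine h.not_le_span_singleton (ω a) fun i => ?_
    rw [Submodule.mem_span_singleton]
    refine ⟨(c a)⁻¹ * c i, ?_⟩
    ext l m
    have := hsymm a i l m
    simp only [Pi.zero_apply] at ha
    simp only [Pi.smul_apply, smul_eq_mul]
    field_simp
    exact this
  apply hθ
  simp [quarticEval_apply, cubicEval_apply, quadEval_apply, Finset.mul_sum, hc', hc0]

end IsNondegenerateCubic

end Potential

end NCConic

namespace NCConic

/-! ### A regularity criterion for three ternary quadrics -/

section Quadrics

open MvPolynomial

variable {k : Type u} [Field k]

theorem finrank_homogeneousSubmodule_three (n : ℕ) :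
    Module.finrank k (homogeneousSubmodule (Fin 3) k n) = (n + 2).choose 2 := by
  classical
  have hset : {d : Fin 3 →₀ ℕ | d.degree = n} =
      ((Finset.univ : Finset (Fin 3)).finsuppAntidiag n : Set (Fin 3 →₀ ℕ)) := by
    ext d
    simp [Finset.mem_finsuppAntidiag, Finsupp.degree_eq_sum]
  have hb := Module.finrank_eq_nat_card_basis (basisRestrictSupport k
    ((Finset.univ : Finset (Fin 3)).finsuppAntidiag n : Set (Fin 3 →₀ ℕ)))
  rw [homogeneousSubmodule_eq_finsupp_supported, hset]
  refine hb.trans ?_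
  rw [Nat.card_coe_set_eq, Set.ncard_coe_finset, Finset.card_finsuppAntidiag_nat_eq_choose]
  simp only [Finset.card_univ, Fintype.card_fin]
  rw [show 3 + n - 1 = n + 2 by omega]
  exact Nat.choose_symm_add

instance finite_homogeneousSubmodule_three (n : ℕ) :
    Module.Finite k (homogeneousSubmodule (Fin 3) k n) :=
  Module.Finite.iff_fg.2 (homogeneousSubmodule_fg (Fin 3) k n)

theorem homogeneousComponent_mul_of_isHomogeneous {q : MvPolynomial (Fin 3) k} {m : ℕ}
    (hq : q.IsHomogeneous m) (p : MvPolynomial (Fin 3) k) (n : ℕ) :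
    homogeneousComponent (n + m) (p * q) = homogeneousComponent n p * q := by
  conv_lhs => rw [← sum_homogeneousComponent p, Finset.sum_mul, map_sum]
  have h (i : ℕ) : homogeneousComponent (n + m) (homogeneousComponent i p * q) =
      if n = i then homogeneousComponent i p * q else 0 := by
    rw [homogeneousComponent_of_mem ((homogeneousComponent_isHomogeneous i p).mul hq)]
    simp
  simp only [h, Finset.sum_ite_eq, Finset.mem_range]
  split_ifs with hn
  · rfl
  · rw [homogeneousComponent_eq_zero _ _ (by omega), zero_mul]

theorem homogeneousComponent_mem_span_pair {q₁ q₂ : MvPolynomial (Fin 3) k}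
    (h₁ : q₁.IsHomogeneous 2) (h₂ : q₂.IsHomogeneous 2) {p : MvPolynomial (Fin 3) k}
    (hp : p ∈ Ideal.span {q₁, q₂}) (n : ℕ) :
    homogeneousComponent (n + 2) p =
      homogeneousComponent n (Ideal.mem_span_pair.1 hp).choose * q₁ +
      homogeneousComponent n (Ideal.mem_span_pair.1 hp).choose_spec.choose * q₂ := by
  have := (Ideal.mem_span_pair.1 hp).choose_spec.choose_spec
  conv_lhs => rw [← this]
  rw [map_add, homogeneousComponent_mul_of_isHomogeneous h₁,
    homogeneousComponent_mul_of_isHomogeneous h₂]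

/-- The image of the forms of degree `n` in the quotient by an ideal. -/
noncomputable def formsMod (I : Ideal (MvPolynomial (Fin 3) k)) (n : ℕ) :
    Submodule k (MvPolynomial (Fin 3) k ⧸ I) :=
  (homogeneousSubmodule (Fin 3) k n).map (Ideal.Quotient.mkₐ k I).toLinearMap

instance (I : Ideal (MvPolynomial (Fin 3) k)) (n : ℕ) : Module.Finite k (formsMod I n) := by
  unfold formsMod; infer_instance

theorem finrank_formsMod (I : Ideal (MvPolynomial (Fin 3) k)) (n : ℕ) :
    Module.finrank k (formsMod I n) + Module.finrank k (LinearMap.ker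
      ((Ideal.Quotient.mkₐ k I).toLinearMap ∘ₗ (homogeneousSubmodule (Fin 3) k n).subtype)) =
    (n + 2).choose 2 := by
  rw [← finrank_homogeneousSubmodule_three (k := k), formsMod, ← LinearMap.range_domRestrict,
    ← LinearMap.finrank_range_add_finrank_ker ((Ideal.Quotient.mkₐ k I).toLinearMap ∘ₗ
      (homogeneousSubmodule (Fin 3) k n).subtype)]
  rfl

/-- Two independent ternary quadrics `q₁, q₂` leave at least four forms in each degree `≥ 2`,
because of the Koszul relation `q₂ q₁ - q₁ q₂ = 0`. -/
theorem four_le_finrank_formsMod {q₁ q₂ : MvPolynomial (Fin 3) k}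
    (h₁ : q₁.IsHomogeneous 2) (h₂ : q₂.IsHomogeneous 2) (hne : q₁ ≠ 0) (n : ℕ) :
    4 ≤ Module.finrank k (formsMod (Ideal.span {q₁, q₂}) (n + 2)) := by
  set I : Ideal (MvPolynomial (Fin 3) k) := Ideal.span {q₁, q₂} with hI
  let Φ : (homogeneousSubmodule (Fin 3) k n × homogeneousSubmodule (Fin 3) k n) →ₗ[k]
      MvPolynomial (Fin 3) k :=
    LinearMap.coprod ((LinearMap.mulRight k q₁) ∘ₗ (homogeneousSubmodule (Fin 3) k n).subtype)
      ((LinearMap.mulRight k q₂) ∘ₗ (homogeneousSubmodule (Fin 3) k n).subtype)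
  have hΦ (a b : homogeneousSubmodule (Fin 3) k n) : Φ (a, b) = a.1 * q₁ + b.1 * q₂ := rfl
  have hsum := finrank_formsMod I (n + 2)
  have hrank := Φ.finrank_range_add_finrank_ker
  rw [Module.finrank_prod, finrank_homogeneousSubmodule_three] at hrank
  have hker : Module.finrank k (LinearMap.ker ((Ideal.Quotient.mkₐ k I).toLinearMap ∘ₗ
      (homogeneousSubmodule (Fin 3) k (n + 2)).subtype)) ≤
      Module.finrank k (LinearMap.range Φ) := by
    rw [← Submodule.finrank_map_subtype_eq]
    refine Submodule.finrank_mono ?_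
    rintro _ ⟨⟨p, hp⟩, hpI, rfl⟩
    have hpI : p ∈ I := Ideal.Quotient.eq_zero_iff_mem.1 hpI
    have := homogeneousComponent_mem_span_pair h₁ h₂ hpI n
    rw [homogeneousComponent_eq_self hp] at this
    exact ⟨(⟨_, homogeneousComponent_isHomogeneous n _⟩,
      ⟨_, homogeneousComponent_isHomogeneous n _⟩), this.symm⟩
  have hkoszul : n.choose 2 ≤ Module.finrank k (LinearMap.ker Φ) := by
    obtain hn | ⟨m, rfl⟩ : n < 2 ∨ ∃ m, n = m + 2 := by
      rcases lt_or_ge n 2 with h | h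
      · exact .inl h
      · exact .inr ⟨n - 2, by omega⟩
    · rw [Nat.choose_eq_zero_of_lt hn]; exact Nat.zero_le _
    let K : homogeneousSubmodule (Fin 3) k m →ₗ[k] LinearMap.ker Φ :=
      { toFun := fun h => ⟨(⟨h.1 * q₂, h.2.mul h₂⟩, ⟨-(h.1 * q₁), (h.2.mul h₁).neg⟩), by
          rw [LinearMap.mem_ker, hΦ]; ring⟩
        map_add' := fun a b => by
          ext1; ext1 <;> ext1 <;> simp [add_mul]; ring
        map_smul' := fun c a => by
          ext1; ext1 <;> ext1 <;> simp }
    rw [← finrank_homogeneousSubmodule_three (k := k) m]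
    refine LinearMap.finrank_le_finrank_of_injective (f := K) fun a b hab => ?_
    have h2 := congrArg (fun z => (z.1.2 : MvPolynomial (Fin 3) k)) hab
    exact Subtype.ext (mul_right_cancel₀ hne (neg_injective h2))
  have hc : (n + 4).choose 2 + n.choose 2 = 2 * (n + 2).choose 2 + 4 := by
    simp [Nat.choose_succ_succ']
    ring
  rw [show n + 2 + 2 = n + 4 by rfl] at hsum
  omega

/-- If `q₁, q₂, q₃` are quadrics whose quotient ring has no forms of degree four and at most a line
of forms of degree three, then `q₃` is regular modulo `(q₁, q₂)`: multiplication by `q₃` maps the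
forms of degree `n` onto those of degree `n + 2`, and both spaces have dimension four. -/
theorem mem_span_pair_of_mul_mem {q₁ q₂ q₃ : MvPolynomial (Fin 3) k}
    (h₁ : q₁.IsHomogeneous 2) (h₂ : q₂.IsHomogeneous 2) (h₃ : q₃.IsHomogeneous 2)
    (hli : LinearIndependent k ![q₁, q₂])
    (hfour : ∀ p : MvPolynomial (Fin 3) k, p.IsHomogeneous 4 →
      ∃ h : MvPolynomial (Fin 3) k, h.IsHomogeneous 2 ∧ p - q₃ * h ∈ Ideal.span {q₁, q₂})
    (c : MvPolynomial (Fin 3) k)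
    (hthree : ∀ p : MvPolynomial (Fin 3) k, p.IsHomogeneous 3 →
      ∃ (h : MvPolynomial (Fin 3) k) (t : k), h.IsHomogeneous 1 ∧
        p - q₃ * h - t • c ∈ Ideal.span {q₁, q₂})
    {p : MvPolynomial (Fin 3) k} (hp : q₃ * p ∈ Ideal.span {q₁, q₂}) :
    p ∈ Ideal.span {q₁, q₂} := by
  set I : Ideal (MvPolynomial (Fin 3) k) := Ideal.span {q₁, q₂} with hI
  have hne : q₁ ≠ 0 := hli.ne_zero 0
  have hge := four_le_finrank_formsMod h₁ h₂ hne
  let G : (MvPolynomial (Fin 3) k ⧸ I) →ₗ[k] (MvPolynomial (Fin 3) k ⧸ I) :=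
    LinearMap.mulLeft k (Ideal.Quotient.mk I q₃)
  -- Multiplication by `q₃` is onto from degree two on, since forms of degree four generate.
  have hsurj (n : ℕ) : formsMod I (n + 4) ≤ (formsMod I (n + 2)).map G := by
    rintro _ ⟨p, hp, rfl⟩
    have hp' : p ∈ homogeneousSubmodule (Fin 3) k 4 * homogeneousSubmodule (Fin 3) k n := by
      rw [← homogeneousSubmodule_one_pow k 4, ← homogeneousSubmodule_one_pow k n, ← pow_add,
        homogeneousSubmodule_one_pow, add_comm 4 n]
      exact hp
    clear hp
    refine Submodule.mul_induction_on hp' (fun a ha b hb => ?_) fun a b ha hb => ?_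
    · obtain ⟨h, hh, hmem⟩ := hfour a ha
      refine ⟨Ideal.Quotient.mk I (b * h), ⟨b * h, IsHomogeneous.mul hb hh, rfl⟩, ?_⟩
      change Ideal.Quotient.mk I q₃ * Ideal.Quotient.mk I (b * h) = Ideal.Quotient.mk I (a * b)
      rw [← map_mul, eq_comm, Ideal.Quotient.eq]
      have := I.mul_mem_left b hmem
      convert this using 1
      ring
    · rw [map_add]; exact Submodule.add_mem _ ha hb
  have hle2 : Module.finrank k (formsMod I 2) ≤ 4 := by
    have := finrank_formsMod I 2
    have h2 : 2 ≤ Module.finrank k (LinearMap.ker ((Ideal.Quotient.mkₐ k I).toLinearMap ∘ₗ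
        (homogeneousSubmodule (Fin 3) k 2).subtype)) := by
      rw [← Submodule.finrank_map_subtype_eq]
      refine ((finrank_span_eq_card hli).trans (Fintype.card_fin 2)).symm.trans_le
        (Submodule.finrank_mono (Submodule.span_le.2 ?_))
      rintro _ ⟨i, rfl⟩
      fin_cases i
      · exact ⟨⟨q₁, h₁⟩, Ideal.Quotient.eq_zero_iff_mem.2 (Ideal.subset_span (by simp)), rfl⟩
      · exact ⟨⟨q₂, h₂⟩, Ideal.Quotient.eq_zero_iff_mem.2 (Ideal.subset_span (by simp)), rfl⟩
    have h6 : (2 + 2).choose 2 = 6 := rfl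
    omega
  have hle1 : Module.finrank k (formsMod I 1) ≤ 3 := by
    have := finrank_formsMod I 1
    have h6 : (1 + 2).choose 2 = 3 := rfl
    omega
  have hthree' : formsMod I 3 ≤
      (formsMod I 1).map G ⊔ Submodule.span k {Ideal.Quotient.mk I c} := by
    rintro _ ⟨p, hp, rfl⟩
    obtain ⟨h, t, hh, hmem⟩ := hthree p hp
    refine Submodule.mem_sup.2 ⟨_, ⟨_, ⟨h, hh, rfl⟩, rfl⟩, _,
      Submodule.smul_mem _ t (Submodule.mem_span_singleton_self _), ?_⟩
    rw [← Ideal.Quotient.eq_zero_iff_mem, map_sub, map_sub, sub_sub, sub_eq_zero] at hmem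
    exact hmem.symm
  have hsup : Module.finrank k (formsMod I 3) ≤ Module.finrank k ((formsMod I 1).map G) + 1 := by
    refine (Submodule.finrank_mono hthree').trans ((Submodule.finrank_add_le_finrank_add_finrank
      _ _).trans (Nat.add_le_add_left ?_ _))
    exact (finrank_span_le_card _).trans (by simp)
  have hG (n : ℕ) := Submodule.finrank_map_le G (formsMod I n)
  have hrank (n : ℕ) : Module.finrank k (formsMod I (n + 2)) ≤ 4 := by
    induction n using Nat.twoStepInduction with
    | zero => exact hle2
    | one =>
      have := hG 1
      change Module.finrank k (formsMod I 3) ≤ 4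
      omega
    | more n ih _ => exact ((Submodule.finrank_mono (hsurj n)).trans (hG _)).trans ih
  have hinj (n : ℕ) (hn : Module.finrank k (formsMod I n) ≤
      Module.finrank k ((formsMod I n).map G)) (a) (ha : a ∈ formsMod I n) (h0 : G a = 0) :
      a = 0 := by
    have hr := (G.domRestrict (formsMod I n)).finrank_range_add_finrank_ker
    rw [LinearMap.range_domRestrict] at hr
    have hk : LinearMap.ker (G.domRestrict (formsMod I n)) = ⊥ :=
      Submodule.finrank_eq_zero.1 (by omega)
    have : (⟨a, ha⟩ : formsMod I n) ∈ LinearMap.ker (G.domRestrict (formsMod I n)) := h0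
    rw [hk, Submodule.mem_bot] at this
    exact congrArg Subtype.val this
  have hinj' (n : ℕ) (a) (ha : a ∈ formsMod I n) (h0 : G a = 0) : a = 0 := by
    match n, ha with
    | 0, ha =>
      obtain ⟨p, hp, rfl⟩ := ha
      by_contra hne0
      have hpC : p = C (coeff 0 p) := by
        rw [← homogeneousComponent_zero, homogeneousComponent_eq_self hp]
      have hc0 : coeff 0 p ≠ 0 := by
        intro h
        rw [h, C_0] at hpC
        exact hne0 (by rw [hpC, map_zero])
      have hq : Ideal.Quotient.mk I q₃ = 0 := by
        have h1 : Ideal.Quotient.mk I (q₃ * p) = 0 := h0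
        have h2 := congrArg (· * Ideal.Quotient.mk I (C (coeff 0 p)⁻¹)) h1
        simp only [zero_mul] at h2
        rwa [← map_mul, hpC, mul_assoc, ← C_mul, coeff_C, if_pos rfl, mul_inv_cancel₀ hc0, C_1,
          mul_one] at h2
      have hG0 : G = 0 := by
        refine LinearMap.ext fun a => ?_
        change Ideal.Quotient.mk I q₃ * a = 0
        rw [hq, zero_mul]
      have h4 := (hge 2).trans (Submodule.finrank_mono (hsurj 0))
      rw [hG0, Submodule.map_zero, finrank_bot] at h4
      omega
    | 1, ha =>
      refine hinj 1 ?_ a ha h0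
      have := hge 1
      change 4 ≤ Module.finrank k (formsMod I 3) at this
      omega
    | n + 2, ha =>
      exact hinj (n + 2) ((hrank n).trans ((hge (n + 2)).trans (Submodule.finrank_mono (hsurj n))))
        a ha h0
  rw [← sum_homogeneousComponent p]
  refine Ideal.sum_mem _ fun n _ => ?_
  rw [← Ideal.Quotient.eq_zero_iff_mem]
  refine hinj' n _ ⟨_, homogeneousComponent_isHomogeneous n p, rfl⟩ ?_
  change Ideal.Quotient.mk I q₃ * Ideal.Quotient.mk I _ = 0
  rw [← map_mul, Ideal.Quotient.eq_zero_iff_mem, mul_comm,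
    ← homogeneousComponent_mul_of_isHomogeneous h₃, mul_comm p,
    homogeneousComponent_mem_span_pair h₁ h₂ hp n]
  exact Ideal.add_mem _ (Ideal.mul_mem_left _ _ (Ideal.subset_span (by simp)))
    (Ideal.mul_mem_left _ _ (Ideal.subset_span (by simp)))

end Quadrics

end NCConic

namespace NCConic

/-! ### The element dual to a conic -/

section DualElement

variable {k : Type u} [Field k]

theorem perp_eq_sup_span {n : ℕ} {D D' : Submodule k (Fin n → Fin n → k)} (hle : D ≤ D')
    (hfin : Module.finrank k D' = Module.finrank k D + 1) {s : Fin n → Fin n → k}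
    (hs : s ∈ perp D) (hs' : s ∉ perp D') : perp D = perp D' ⊔ Submodule.span k {s} := by
  symm
  apply Submodule.eq_of_le_of_finrank_le
  · rw [sup_le_iff, Submodule.span_singleton_le_iff_mem]
    exact ⟨perp_anti hle, hs⟩
  · have h1 := finrank_perp D
    have h2 := finrank_perp D'
    have h3 : perp D' < perp D' ⊔ Submodule.span k {s} := by
      refine lt_of_le_of_ne le_sup_left fun h => hs' ?_
      rw [h]
      exact Submodule.mem_sup_right (Submodule.mem_span_singleton_self s)
    have h4 := Submodule.finrank_lt_finrank_of_lt h3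
    omega

open MvPolynomial in
theorem degPart_X (m : ℕ) : degPart k (X : Fin 3 → MvPolynomial (Fin 3) k) m =
    homogeneousSubmodule (Fin 3) k m := by
  rw [degPart, ← homogeneousSubmodule_one_eq_span_X, homogeneousSubmodule_one_pow]

open MvPolynomial in
theorem antisymm_of_quadEval_X_eq_zero {w : Fin 3 → Fin 3 → k}
    (hw : quadEval k (X : Fin 3 → MvPolynomial (Fin 3) k) w = 0) (i j : Fin 3) :
    w j i = -w i j := by
  have key (v : Fin 3 → k) : ∑ i, ∑ j, w i j * (v i * v j) = 0 := by
    have := congrArg (MvPolynomial.eval v) hw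
    simpa [quadEval_apply, smul_eval] using this
  have hd (i : Fin 3) : w i i = 0 := by
    simpa [Pi.single_apply] using key (Pi.single i 1)
  rcases eq_or_ne i j with rfl | hij
  · simp [hd]
  have h3 := key (Pi.single i 1 + Pi.single j 1)
  simp [Pi.single_apply, mul_add, Finset.sum_add_distrib, hd] at h3
  linear_combination h3

/-- A pencil `R' ⊇ R` of symmetric relations makes the quadratic dual `A^!` the quotient of a
polynomial ring by two quadrics, to which the third quadric of the net `R^⊥` is regular. -/
theorem isRegular_quadEval [NeZero (2 : k)] {ω : Potential k} (h : IsNondegenerateCubic ω)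
    {D' : Submodule k (Fin 3 → Fin 3 → k)} (hle : derSpan ω ≤ D')
    (hsymm : ∀ w ∈ D', ∀ i j, w j i = w i j) (hfin : Module.finrank k D' = 4)
    {A : Type u} [CommRing A] [Algebra k A] {x : Fin 3 → A}
    (hx : IsQuadraticPresentation k x (perp D')) {s : Fin 3 → Fin 3 → k}
    (hs : s ∈ perp (derSpan ω)) (hs' : s ∉ perp D') : IsRegular (quadEval k x s) := by
  let E := quadEval k (MvPolynomial.X : Fin 3 → MvPolynomial (Fin 3) k)
  have hE (w) : (E w).IsHomogeneous 2 := by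
    have : E w ∈ degPart k (MvPolynomial.X : Fin 3 → MvPolynomial (Fin 3) k) 2 := by
      rw [← range_quadEval]; exact ⟨w, rfl⟩
    rwa [degPart_X] at this
  have hker : LinearMap.ker E ≤ perp D' := by
    intro w hw r hr
    have hw' := antisymm_of_quadEval_X_eq_zero hw
    have hsum : ∑ i, ∑ j, w i j * r i j = -∑ i, ∑ j, w i j * r i j := by
      conv_lhs => rw [Finset.sum_comm]
      simp only [← Finset.sum_neg_distrib]
      refine Finset.sum_congr rfl fun i _ => Finset.sum_congr rfl fun j _ => ?_
      rw [hw' i j, hsymm r hr i j]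
      ring
    have h2 : (2 : k) * ∑ i, ∑ j, w i j * r i j = 0 := by linear_combination hsum
    exact (mul_eq_zero_iff_left two_ne_zero).1 h2
  have hmap : Module.finrank k ((perp D').map E) = 2 := by
    have h1 := E.finrank_range_add_finrank_ker
    rw [range_quadEval, degPart_X, finrank_homogeneousSubmodule_three] at h1
    have h2 := (E.domRestrict (perp D')).finrank_range_add_finrank_ker
    rw [LinearMap.range_domRestrict, LinearMap.ker_domRestrict] at h2
    have h3 : Module.finrank k (Submodule.comap (perp D').subtype (LinearMap.ker E)) =
        Module.finrank k (LinearMap.ker E) :=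
      (Submodule.comapSubtypeEquivOfLe hker).finrank_eq
    have h4 := finrank_perp D'
    have h5 : Module.finrank k (Fin 3 → Fin 3 → k) = 9 := by
      rw [Module.finrank_pi_fintype]; simp
    have h6 : (2 + 2).choose 2 = 6 := rfl
    have h7 : Module.finrank k (Submodule.comap (perp D').subtype (LinearMap.ker E)) = 3 := by
      omega
    rw [h7] at h2
    omega
  have : Module.Finite k ((perp D').map E) := inferInstance
  let b := Module.finBasisOfFinrankEq k ((perp D').map E) hmap
  have hli : LinearIndependent k ![(b 0).1, (b 1).1] := by
    have := b.linearIndependent.map' ((perp D').map E).subtype (Submodule.ker_subtype _)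
    have e : ![(b 0).1, (b 1).1] = ((perp D').map E).subtype ∘ b := by
      funext i
      fin_cases i <;> rfl
    rw [e]
    exact this
  set q₁ : MvPolynomial (Fin 3) k := (b 0).1 with hq₁
  set q₂ : MvPolynomial (Fin 3) k := (b 1).1 with hq₂
  have hqmem (i : Fin 2) : ∃ w ∈ perp D', E w = (b i).1 := (b i).2
  have hI (w) (hw : w ∈ perp D') : E w ∈ Ideal.span {q₁, q₂} := by
    have := b.sum_repr ⟨E w, w, hw, rfl⟩
    rw [Fin.sum_univ_two] at this
    have := congrArg Subtype.val this
    simp only [Submodule.coe_add, Submodule.coe_smul] at this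
    rw [← this]
    exact Ideal.add_mem _ (Submodule.smul_of_tower_mem _ _ (Ideal.subset_span (by simp [hq₁])))
      (Submodule.smul_of_tower_mem _ _ (Ideal.subset_span (by simp [hq₂])))
  have hWs := perp_eq_sup_span hle (by rw [hfin, h.finrank_eq]) hs hs'
  have hI' (w) (hw : w ∈ perp (derSpan ω)) :
      ∃ c : k, ∃ e ∈ Ideal.span {q₁, q₂}, E w = e + c • E s := by
    rw [hWs] at hw
    obtain ⟨a, ha, _, hc, rfl⟩ := Submodule.mem_sup.1 hw
    obtain ⟨c, rfl⟩ := Submodule.mem_span_singleton.1 hc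
    exact ⟨c, E a, hI a ha, by rw [map_add, map_smul]⟩
  -- The forms that lie in `I + q₃ P_m`.
  let N (m : ℕ) : Submodule k (MvPolynomial (Fin 3) k) :=
    (Ideal.span {q₁, q₂}).restrictScalars k ⊔
      (MvPolynomial.homogeneousSubmodule (Fin 3) k m).map (LinearMap.mulLeft k (E s))
  have hN (m : ℕ) (w) (hw : w ∈ perp (derSpan ω)) (p : MvPolynomial (Fin 3) k)
      (hp : p.IsHomogeneous m) : E w * p ∈ N m := by
    obtain ⟨c, e, he, hw⟩ := hI' w hw
    refine Submodule.mem_sup.2 ⟨p * e, Ideal.mul_mem_left _ _ he, E s * (c • p),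
      ⟨c • p, Submodule.smul_mem _ c hp, rfl⟩, ?_⟩
    rw [hw, add_mul, smul_mul_assoc, mul_smul_comm, mul_comm p]
  have hX (i : Fin 3) : (MvPolynomial.X i : MvPolynomial (Fin 3) k).IsHomogeneous 1 :=
    MvPolynomial.isHomogeneous_X k i
  have hNmem {m : ℕ} {p : MvPolynomial (Fin 3) k} (hp : p ∈ N m) :
      ∃ h : MvPolynomial (Fin 3) k, h.IsHomogeneous m ∧ p - E s * h ∈ Ideal.span {q₁, q₂} := by
    obtain ⟨e, he, _, ⟨h, hh, rfl⟩, rfl⟩ := Submodule.mem_sup.1 hp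
    refine ⟨h, hh, ?_⟩
    simpa using he
  have hfour (p : MvPolynomial (Fin 3) k) (hp : p.IsHomogeneous 4) :
      ∃ h : MvPolynomial (Fin 3) k, h.IsHomogeneous 2 ∧ p - E s * h ∈ Ideal.span {q₁, q₂} := by
    have : p ∈ degPart k (MvPolynomial.X : Fin 3 → MvPolynomial (Fin 3) k) 4 := by
      rwa [degPart_X]
    rw [← range_quarticEval] at this
    obtain ⟨t, rfl⟩ := this
    refine hNmem (h.quarticEval_mem _ (N 2) (fun w hw i j => ?_) (fun w hw i j => ?_)
      (fun w hw i j => ?_) t)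
    · have := hN 2 w hw _ ((hX i).mul (hX j))
      convert this using 1
      ring
    · have := hN 2 w hw _ ((hX i).mul (hX j))
      convert this using 1
      ring
    · exact hN 2 w hw _ ((hX i).mul (hX j))
  obtain ⟨t₀, ht₀⟩ : ∃ t₀ : Fin 3 → Fin 3 → Fin 3 → k,
      ∑ i, ∑ j, ∑ l, t₀ i j l * ω i j l = 1 := by
    obtain ⟨i, j, l, hijl⟩ : ∃ i j l, ω i j l ≠ 0 := by
      by_contra! h0
      have := h.eq_zero_of_sum_smul (c := 1) (by simp [h0])
      simpa using congrFun this 0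
    refine ⟨Pi.single i (Pi.single j (Pi.single l (ω i j l)⁻¹)), ?_⟩
    simp [Pi.single_apply, ite_apply, hijl]
  have hthree (p : MvPolynomial (Fin 3) k) (hp : p.IsHomogeneous 3) :
      ∃ (h : MvPolynomial (Fin 3) k) (t : k), h.IsHomogeneous 1 ∧
        p - E s * h - t • cubicEval k MvPolynomial.X t₀ ∈ Ideal.span {q₁, q₂} := by
    have : p ∈ degPart k (MvPolynomial.X : Fin 3 → MvPolynomial (Fin 3) k) 3 := by
      rwa [degPart_X]
    rw [← range_cubicEval] at this
    obtain ⟨t, rfl⟩ := this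
    set d := ∑ i, ∑ j, ∑ l, t i j l * ω i j l with hd
    obtain ⟨q, hq, hmem⟩ := hNmem (h.cubicEval_mem MvPolynomial.X (N 1) (fun w hw i => by
      rw [mul_comm]
      exact hN 1 w hw _ (hX i)) (fun w hw i => hN 1 w hw _ (hX i)) (t := t - d • t₀) (by
        simp only [Pi.sub_apply, Pi.smul_apply, smul_eq_mul, sub_mul, Finset.sum_sub_distrib,
          mul_assoc, ← Finset.mul_sum, ht₀, mul_one, ← hd, sub_self]))
    refine ⟨q, d, hq, ?_⟩
    rw [map_sub, map_smul] at hmem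
    convert hmem using 1
    ring
  have key := fun p hp => mem_span_pair_of_mul_mem (q₁ := q₁) (q₂ := q₂) (q₃ := E s) (p := p)
    (by obtain ⟨w, -, hw⟩ := hqmem 0; rw [hq₁, ← hw]; exact hE w)
    (by obtain ⟨w, -, hw⟩ := hqmem 1; rw [hq₂, ← hw]; exact hE w) (hE s) hli hfour _ hthree hp
  -- Transport to `A` along the surjection `P → A`, whose kernel is `(q₁, q₂)`.
  let θ : MvPolynomial (Fin 3) k →ₐ[k] A := MvPolynomial.aeval x
  have hθX : (fun i => θ (MvPolynomial.X i)) = x := by ext i; simp [θ]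
  have hθE (w) : θ (E w) = quadEval k x w := by
    rw [map_quadEval, hθX]
  have hθ : Function.Surjective θ := by
    rw [← AlgHom.range_eq_top, ← hx.adjoin_eq, MvPolynomial.aeval_range]
  obtain ⟨ψ, hψ⟩ := hx.lift (MvPolynomial (Fin 3) k ⧸ Ideal.span {q₁, q₂})
    (fun i => Ideal.Quotient.mkₐ k _ (MvPolynomial.X i)) (fun w hw => by
      rw [← map_quadEval]
      exact Ideal.Quotient.eq_zero_iff_mem.2 (hI w hw))
  have hψθ : ψ.comp θ = Ideal.Quotient.mkₐ k _ := by
    ext i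
    simp [θ, hψ]
  have hθI {p} (hp : p ∈ Ideal.span {q₁, q₂}) : θ p = 0 := by
    have : Ideal.span {q₁, q₂} ≤ RingHom.ker θ := by
      rw [Ideal.span_le]
      rintro _ (rfl | rfl)
      · obtain ⟨w, hw, hw'⟩ := hqmem 0
        change θ (b 0).1 = 0
        rw [← hw', hθE, hx.rel w hw]
      · obtain ⟨w, hw, hw'⟩ := hqmem 1
        change θ (b 1).1 = 0
        rw [← hw', hθE, hx.rel w hw]
    exact this hp
  have hreg : ∀ a, quadEval k x s * a = 0 → a = 0 := by
    intro a ha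
    obtain ⟨p, rfl⟩ := hθ a
    rw [← hθE, ← map_mul] at ha
    refine hθI (key p ?_)
    rw [← Ideal.Quotient.eq_zero_iff_mem]
    have := congrArg ψ ha
    rw [map_zero] at this
    exact (DFunLike.congr_fun hψθ _).symm.trans this
  have hl : IsLeftRegular (quadEval k x s) := fun a b hab => by
    rw [← sub_eq_zero]
    apply hreg
    rw [mul_sub]
    exact sub_eq_zero.2 hab
  exact ⟨hl, fun a b hab => hl (by
    change a * _ = b * _ at hab
    change _ * a = _ * b
    rwa [mul_comm _ a, mul_comm _ b])⟩

end DualElement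

/-! ### The quadratic dual of a conic -/

section Conic

variable {k : Type u} [Field k]

theorem commute_of_adjoin_eq_top {n : ℕ} {A : Type u} [Ring A] [Algebra k A] {x : Fin n → A}
    (hx : Algebra.adjoin k (Set.range x) = ⊤) (hc : ∀ i j, x i * x j = x j * x i) (a b : A) :
    a * b = b * a := by
  have hb : b ∈ Algebra.adjoin k (Set.range x) := hx ▸ Algebra.mem_top
  have ha : a ∈ Algebra.adjoin k (Set.range x) := hx ▸ Algebra.mem_top
  induction ha, hb using Algebra.adjoin_induction₂ with
  | mem_mem a b ha hb => obtain ⟨i, rfl⟩ := ha; obtain ⟨j, rfl⟩ := hb; exact hc i j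
  | algebraMap_both r s => exact Algebra.commutes r _
  | algebraMap_left r b hb => exact Algebra.commutes r b
  | algebraMap_right r b hb => exact (Algebra.commutes r b).symm
  | add_left a b c _ _ _ h1 h2 => rw [add_mul, mul_add, h1, h2]
  | add_right a b c _ _ _ h1 h2 => rw [add_mul, mul_add, h1, h2]
  | mul_left a b c _ _ _ h1 h2 => rw [mul_assoc, h2, ← mul_assoc, h1, mul_assoc]
  | mul_right a b c _ _ _ h1 h2 => rw [← mul_assoc, h1, mul_assoc, h2, mul_assoc]

/-- A commutative ring structure on a ring whose multiplication commutes. -/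
abbrev commRingOfComm {A : Type u} [R : Ring A] (h : ∀ a b : A, a * b = b * a) : CommRing A :=
  { R with mul_comm := h }

theorem mul_comm_of_presentation {A : Type u} [Ring A] [Algebra k A] {x : Fin 3 → A}
    {D' : Submodule k (Fin 3 → Fin 3 → k)} (hsymm : ∀ w ∈ D', ∀ i j, w j i = w i j)
    (hx : IsQuadraticPresentation k x (perp D')) (a b : A) : a * b = b * a := by
  refine commute_of_adjoin_eq_top hx.adjoin_eq (fun i j => ?_) a b
  have := hx.rel (Pi.single i (Pi.single j 1) - Pi.single j (Pi.single i 1)) (by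
    intro r hr
    simp [Pi.single_apply, ite_apply, sub_mul, Finset.sum_sub_distrib, hsymm r hr i j])
  rw [map_sub, sub_eq_zero] at this
  simpa [quadEval_apply, Pi.single_apply, ite_apply, ite_smul] using this

/-- If `W = W' + k s`, then `T(V)/(W)` is the quotient of `T(V)/(W')` by the class of `s`. -/
theorem proj_eq_zero_iff {n : ℕ} {A T : Type u} [Ring A] [Algebra k A] [Ring T] [Algebra k T]
    {x : Fin n → A} {y : Fin n → T} {W W' : Submodule k (Fin n → Fin n → k)}
    (hx : IsQuadraticPresentation k x W') (hy : IsQuadraticPresentation k y W)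
    {s : Fin n → Fin n → k} (hW : W = W' ⊔ Submodule.span k {s})
    (pA : FreeAlgebra k (Fin n) →ₐ[k] A) (hA : ∀ i, pA (FreeAlgebra.ι k i) = x i)
    (pT : FreeAlgebra k (Fin n) →ₐ[k] T) (hT : ∀ i, pT (FreeAlgebra.ι k i) = y i)
    (t : FreeAlgebra k (Fin n)) :
    AlgQuot.proj k {quadEval k x s} (pA t) = 0 ↔ pT t = 0 := by
  obtain ⟨φ, hφ⟩ := hy.lift (AlgQuot {quadEval k x s})
    (fun i => AlgQuot.proj k {quadEval k x s} (x i)) (fun w hw => by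
      rw [hW] at hw
      obtain ⟨a, ha, b, hb, rfl⟩ := Submodule.mem_sup.1 hw
      obtain ⟨c, rfl⟩ := Submodule.mem_span_singleton.1 hb
      rw [← map_quadEval, map_add, hx.rel a ha, zero_add, map_smul, map_smul,
        AlgQuot.proj_eq_zero (Set.mem_singleton _), smul_zero])
  obtain ⟨χ, hχ⟩ := hx.lift T y (fun w hw => hy.rel w (hW ▸ Submodule.mem_sup_left hw))
  obtain ⟨ψ, hψ⟩ := AlgQuot.exists_lift (s := {quadEval k x s}) χ (by
    rintro _ rfl
    rw [map_quadEval, show (fun i => χ (x i)) = y from funext hχ]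
    exact hy.rel s (hW ▸ Submodule.mem_sup_right (Submodule.mem_span_singleton_self s)))
  have e1 : φ.comp pT = (AlgQuot.proj k {quadEval k x s}).comp pA := by
    ext i
    simp [hT, hA, hφ]
  have e2 : ψ.comp ((AlgQuot.proj k {quadEval k x s}).comp pA) = pT := by
    ext i
    simp [hT, hA, hψ, hχ]
  constructor
  · intro ht
    have := DFunLike.congr_fun e2 t
    exact this.symm.trans ((congrArg ψ ht).trans (map_zero _))
  · intro ht
    have := DFunLike.congr_fun e1 t
    exact this.symm.trans ((congrArg φ ht).trans (map_zero _))

/-- A conic `S / (f)`, with `f` the class of the symmetric tensor `r`. -/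
structure IsConicTensor (ω : Potential k) (r : Fin 3 → Fin 3 → k) : Prop where
  cubic : IsNondegenerateCubic ω
  symm : ∀ i j, r j i = r i j
  notMem : r ∉ derSpan ω

theorem IsConicElement.exists_tensor [NeZero (2 : k)] {ω : Potential k} {f : DerQuot ω}
    (hω : IsSymmetricRegularSuperpotential ω) (hf : IsConicElement ω f) :
    ∃ r, f = quadEval k (derGen ω) r ∧ IsConicTensor ω r := by
  have h2 := hf.degree_two
  rw [← range_quadEval] at h2
  obtain ⟨r, rfl⟩ := h2
  refine ⟨r, rfl, hω.isNondegenerateCubic,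
    hω.isNondegenerateCubic.symm_of_central hf.central, fun hr => ?_⟩
  have := hω.regular.nontrivial
  exact hf.regular.ne_zero ((derQuot_presentation ω).rel r hr)

namespace IsConicTensor

variable {ω : Potential k} {r : Fin 3 → Fin 3 → k} (h : IsConicTensor ω r)

/-- The relations `R + k r` of the conic `S / (f)`. -/
def _root_.NCConic.conicSpan (ω : Potential k) (r : Fin 3 → Fin 3 → k) :
    Submodule k (Fin 3 → Fin 3 → k) := derSpan ω ⊔ Submodule.span k {r}

/-- The algebra `A^!` of the conic `A = S / (f)`. -/
abbrev _root_.NCConic.ConicDual (ω : Potential k) (r : Fin 3 → Fin 3 → k) : Type u :=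
  QuadDual k (conicGen (quadEval k (derGen ω) r))

/-- The generators of `A^!`. -/
abbrev _root_.NCConic.conicDualGen (ω : Potential k) (r : Fin 3 → Fin 3 → k) :
    Fin 3 → ConicDual ω r :=
  dualGen k (conicGen (quadEval k (derGen ω) r))

theorem _root_.NCConic.conicDual_presentation (ω : Potential k) (r : Fin 3 → Fin 3 → k) :
    IsQuadraticPresentation k (conicDualGen ω r) (perp (conicSpan ω r)) := by
  rw [conicSpan, ← (conic_presentation r).relSpace_eq]
  exact quadDual_presentation _

theorem _root_.NCConic.derDual_presentation (ω : Potential k) :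
    IsQuadraticPresentation k (dualGen k (derGen ω)) (perp (derSpan ω)) := by
  rw [← (derQuot_presentation ω).relSpace_eq]
  exact quadDual_presentation _

theorem _root_.NCConic.derSpan_le_conicSpan : derSpan ω ≤ conicSpan ω r := le_sup_left

include h

theorem symm_of_mem {w : Fin 3 → Fin 3 → k} (hw : w ∈ conicSpan ω r) (i j : Fin 3) :
    w j i = w i j := by
  obtain ⟨a, ha, b, hb, rfl⟩ := Submodule.mem_sup.1 hw
  obtain ⟨c, rfl⟩ := Submodule.mem_span_singleton.1 hb
  simp [h.cubic.symm_of_mem ha i j, h.symm i j]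

theorem finrank_conicSpan : Module.finrank k (conicSpan ω r) = 4 := by
  have hlt : derSpan ω < conicSpan ω r := by
    refine lt_of_le_of_ne le_sup_left fun he => h.notMem ?_
    rw [he]
    exact Submodule.mem_sup_right (Submodule.mem_span_singleton_self r)
  have h1 := Submodule.finrank_lt_finrank_of_lt hlt
  have h2 := Submodule.finrank_add_le_finrank_add_finrank (derSpan ω) (Submodule.span k {r})
  have h3 := finrank_span_le_card (R := k) ({r} : Set (Fin 3 → Fin 3 → k))
  rw [h.cubic.finrank_eq] at h1 h2
  simp only [Set.toFinset_singleton, Finset.card_singleton] at h3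
  change Module.finrank k ↥(conicSpan ω r) ≤ _ at h2
  omega

theorem finrank_conicSpan_eq_add_one :
    Module.finrank k (conicSpan ω r) = Module.finrank k (derSpan ω) + 1 := by
  rw [h.finrank_conicSpan, h.cubic.finrank_eq]

theorem mul_comm (a b : ConicDual ω r) : a * b = b * a :=
  mul_comm_of_presentation (fun _ hw => h.symm_of_mem hw) (conicDual_presentation ω r) a b

theorem mem_center (a : ConicDual ω r) : a ∈ Subring.center (ConicDual ω r) :=
  Subring.mem_center_iff.2 fun b => h.mul_comm b a

theorem exists_mem_perp : ∃ s ∈ perp (derSpan ω), s ∉ perp (conicSpan ω r) := by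
  by_contra! hcon
  apply h.notMem
  rw [← perp_perp (derSpan ω)]
  have : perp (perp (conicSpan ω r)) ≤ perp (perp (derSpan ω)) := perp_anti hcon
  rw [perp_perp (conicSpan ω r)] at this
  exact this (Submodule.mem_sup_right (Submodule.mem_span_singleton_self r))

theorem isRegular [NeZero (2 : k)] {s : Fin 3 → Fin 3 → k} (hs : s ∈ perp (derSpan ω))
    (hs' : s ∉ perp (conicSpan ω r)) : IsRegular (quadEval k (conicDualGen ω r) s) := by
  let _ : CommRing (ConicDual ω r) := commRingOfComm h.mul_comm
  exact isRegular_quadEval h.cubic derSpan_le_conicSpan (fun _ hw => h.symm_of_mem hw)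
    h.finrank_conicSpan (conicDual_presentation ω r) hs hs'

theorem isDualElement [NeZero (2 : k)] {s : Fin 3 → Fin 3 → k} (hs : s ∈ perp (derSpan ω))
    (hs' : s ∉ perp (conicSpan ω r)) :
    IsDualElement (quadEval k (derGen ω) r)
      ⟨quadEval k (conicDualGen ω r) s, h.mem_center _⟩ where
  degree_two := by
    rw [← range_quadEval]
    exact ⟨s, rfl⟩
  regular := h.isRegular hs hs'
  quotient_eq t := by
    exact proj_eq_zero_iff (conicDual_presentation ω r) (derDual_presentation ω)
      (perp_eq_sup_span derSpan_le_conicSpan h.finrank_conicSpan_eq_add_one hs hs')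
      (quadDualProj k _) (fun _ => rfl) (quadDualProj k _) (fun _ => rfl) t

theorem nontrivial_conicDual : Nontrivial (ConicDual ω r) := by
  by_contra hn
  rw [not_nontrivial_iff_subsingleton] at hn
  obtain ⟨s, -, hs'⟩ := h.exists_mem_perp
  exact hs' ((conicDual_presentation ω r).mem_of_quadEval_eq_zero (Subsingleton.elim _ _))

/-- Every element `f^!` is the class of a tensor in `R^⊥` that is not in `(R + k r)^⊥`. -/
theorem exists_tensor_of_isDualElement {g : Subring.center (ConicDual ω r)}
    (hg : IsDualElement (quadEval k (derGen ω) r) g) :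
    ∃ s ∈ perp (derSpan ω), s ∉ perp (conicSpan ω r) ∧
      (g : ConicDual ω r) = quadEval k (conicDualGen ω r) s := by
  have h2 := hg.degree_two
  rw [← range_quadEval] at h2
  obtain ⟨s, hs⟩ := h2
  refine ⟨s, ?_, fun hs' => ?_, hs.symm⟩
  · apply (derDual_presentation ω).mem_of_quadEval_eq_zero
    have := (hg.quotient_eq (quadEval k (FreeAlgebra.ι k) s)).1 (by
      rw [map_quadEval]
      exact (congrArg _ hs).trans (AlgQuot.proj_eq_zero (Set.mem_singleton _)))
    rwa [map_quadEval] at this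
  · have := h.nontrivial_conicDual
    apply hg.regular.ne_zero
    rw [← hs, (conicDual_presentation ω r).rel s hs']

end IsConicTensor

/-- `f^!` exists and is unique up to a scalar. -/
theorem exists_isDualElement [NeZero (2 : k)] {ω : Potential k} {f : DerQuot ω}
    (hω : IsSymmetricRegularSuperpotential ω) (hf : IsConicElement ω f) :
    ∃ g : Subring.center (QuadDual k (conicGen f)), IsDualElement f g ∧
      ∀ g' : Subring.center (QuadDual k (conicGen f)), IsDualElement f g' →
        ∃ c : k, c ≠ 0 ∧
          (g' : QuadDual k (conicGen f)) = c • (g : QuadDual k (conicGen f)) := by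
  obtain ⟨r, rfl, h⟩ := hf.exists_tensor hω
  obtain ⟨s, hs, hs'⟩ := h.exists_mem_perp
  refine ⟨_, h.isDualElement hs hs', fun g' hg' => ?_⟩
  obtain ⟨s', hs₁, hs₂, he⟩ := h.exists_tensor_of_isDualElement hg'
  rw [perp_eq_sup_span derSpan_le_conicSpan h.finrank_conicSpan_eq_add_one hs hs'] at hs₁
  obtain ⟨a, ha, b, hb, rfl⟩ := Submodule.mem_sup.1 hs₁
  obtain ⟨c, rfl⟩ := Submodule.mem_span_singleton.1 hb
  refine ⟨c, ?_, ?_⟩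
  · rintro rfl
    exact hs₂ (by simpa using ha)
  · rw [he, map_add, (conicDual_presentation ω r).rel a ha, zero_add, map_smul]

end Conic

end NCConic

namespace NCConic

/-! ### The degree zero part of the localization -/

section Fractions

variable {k : Type u} [Field k] {B : Type u} [Ring B] [Algebra k B] (c : Subring.center B)

theorem frac_smul (r : k) (a : B) (m : ℕ) : frac c (r • a) m = r • frac c a m := by
  have e : algebraMap k (CentralLoc c) r = frac c (algebraMap k B r) 0 := by
    unfold frac
    rw [show (⟨(c : B) ^ 0, 0, rfl⟩ : Submonoid.powers (c : B)) = 1 from Subtype.ext (pow_zero _)]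
    rfl
  rw [Algebra.smul_def, Algebra.smul_def, e, frac_mul, add_zero]

theorem frac_add_same (a b : B) (m : ℕ) : frac c (a + b) m = frac c a m + frac c b m :=
  OreLocalization.add_oreDiv.symm

theorem frac_pow_mul (a : B) (j m : ℕ) : frac c ((c : B) ^ j * a) (j + m) = frac c a m := by
  unfold frac
  rw [OreLocalization.expand a (⟨(c : B) ^ m, m, rfl⟩ : Submonoid.powers (c : B)) ((c : B) ^ j)
    ⟨j + m, pow_add _ _ _⟩]
  congr 1
  exact Subtype.ext (pow_add _ _ _)

theorem frac_one (m : ℕ) : frac c ((c : B) ^ m) m = 1 := by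
  have := frac_pow_mul c 1 m 0
  rw [mul_one, add_zero] at this
  rw [this, OreLocalization.one_def, frac]
  congr 1
  exact Subtype.ext (pow_zero _)

theorem frac_injective {c : Subring.center B} (hc : IsRegular (c : B)) {a b : B} {m : ℕ}
    (h : frac c a m = frac c b m) : a = b := by
  obtain ⟨⟨_, n, rfl⟩, v, h1, h2⟩ := OreLocalization.oreDiv_eq_iff.1 h
  have hv : v = (c : B) ^ n := ((hc.pow m).right h2).symm
  subst hv
  exact ((hc.pow n).left h1).symm

end Fractions

/-- If the products `u a b` behave like `ℓ ℓ' / g` for linear forms `ℓ, ℓ'`, and they generate the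
unit ideal, then `ℓ² / g` is a unit for some `ℓ`. Each maximal ideal excludes the `ℓ` in a proper
subspace. -/
theorem exists_isUnit_sq {k : Type u} [Field k] [Infinite k] {C : Type v} [CommRing C]
    [Algebra k C] [Module.Finite k C] {E : Type u} [AddCommGroup E] [Module k E]
    (φ : E →ₗ[k] E →ₗ[k] C) (hφ : ∀ a b, φ a b * φ a b = φ a a * φ b b)
    (hone : ∀ M : Ideal C, (∀ a b, φ a b ∈ M) → M = ⊤) : ∃ a, IsUnit (φ a a) := by
  have : IsArtinianRing C := IsArtinianRing.of_finite k C
  let p (M : MaximalSpectrum C) : Submodule k E :=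
    { carrier := {a | ∀ b, φ a b ∈ M.asIdeal}
      add_mem' := fun ha hb c => by
        rw [map_add]
        exact M.asIdeal.add_mem (ha c) (hb c)
      zero_mem' := fun c => by simp
      smul_mem' := fun r a ha c => by
        rw [map_smul, LinearMap.smul_apply, Algebra.smul_def]
        exact M.asIdeal.mul_mem_left _ (ha c) }
  by_contra! hcon
  obtain ⟨M, hM⟩ := Subspace.exists_eq_top_of_iUnion_eq_univ (p := p) (by
    rw [Set.eq_univ_iff_forall]
    intro a
    obtain ⟨M, hM, ha⟩ := exists_max_ideal_of_mem_nonunits (hcon a)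
    refine Set.mem_iUnion.2 ⟨⟨M, hM⟩, fun b => ?_⟩
    have : φ a b * φ a b ∈ M := by
      rw [hφ]
      exact M.mul_mem_right _ ha
    exact (hM.isPrime.mem_or_mem this).elim id id)
  refine M.isMaximal.ne_top (hone _ fun a b => ?_)
  have : a ∈ p M := hM ▸ Submodule.mem_top
  exact this b

theorem isFrobeniusAlgebra_of_functional {k : Type u} [Field k] {B : Type v} [Ring B]
    [Algebra k B] [Module.Finite k B] (hcomm : ∀ a b : B, a * b = b * a) (ψ : B →ₗ[k] k)
    (hψ : ∀ a, (∀ b, ψ (a * b) = 0) → a = 0) : IsFrobeniusAlgebra k B := by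
  refine ⟨inferInstance, (LinearMap.mul k B).compr₂ ψ, ⟨hψ, fun a ha => hψ a fun b => ?_⟩,
    fun a b c => ?_⟩
  · rw [hcomm]; exact ha b
  · simp [mul_assoc]

namespace IsConicTensor

variable {k : Type u} [Field k] {ω : Potential k} {r : Fin 3 → Fin 3 → k}
  (h : IsConicTensor ω r) {s : Fin 3 → Fin 3 → k} (hs : s ∈ perp (derSpan ω))
  (hs' : s ∉ perp (conicSpan ω r))

include h hs hs' in
theorem quadEval_eq_smul {w : Fin 3 → Fin 3 → k} (hw : w ∈ perp (derSpan ω)) :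
    ∃ c : k, quadEval k (conicDualGen ω r) w = c • quadEval k (conicDualGen ω r) s := by
  rw [perp_eq_sup_span derSpan_le_conicSpan h.finrank_conicSpan_eq_add_one hs hs'] at hw
  obtain ⟨a, ha, b, hb, rfl⟩ := Submodule.mem_sup.1 hw
  obtain ⟨c, rfl⟩ := Submodule.mem_span_singleton.1 hb
  exact ⟨c, by rw [map_add, (conicDual_presentation ω r).rel a ha, zero_add, map_smul]⟩

theorem _root_.NCConic.degPart_mul_mem {A : Type u} [Ring A] [Algebra k A] {x : Fin 3 → A}
    {m n : ℕ} {a b : A}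
    (ha : a ∈ degPart k x m) (hb : b ∈ degPart k x n) : a * b ∈ degPart k x (m + n) := by
  have := Submodule.mul_mem_mul ha hb
  rwa [degPart, degPart, ← pow_add] at this

theorem _root_.NCConic.gen_mem_degPart {A : Type u} [Ring A] [Algebra k A]
    (x : Fin 3 → A) (i : Fin 3) :
    x i ∈ degPart k x 1 := by
  rw [degPart, pow_one]
  exact Submodule.subset_span ⟨i, rfl⟩

include h hs hs' in
/-- The forms of degree three that pair to zero with `ω` are multiples of `f^!`. -/
theorem cubicEval_eq_mul {t : Fin 3 → Fin 3 → Fin 3 → k}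
    (ht : ∑ i, ∑ j, ∑ l, t i j l * ω i j l = 0) :
    ∃ d ∈ degPart k (conicDualGen ω r) 1,
      cubicEval k (conicDualGen ω r) t = quadEval k (conicDualGen ω r) s * d := by
  obtain ⟨d, hd, he⟩ := h.cubic.cubicEval_mem (conicDualGen ω r)
    ((degPart k (conicDualGen ω r) 1).map
      (LinearMap.mulLeft k (quadEval k (conicDualGen ω r) s)))
    (fun w hw i => by
      obtain ⟨c, hc⟩ := h.quadEval_eq_smul hs hs' hw
      rw [hc, h.mul_comm, smul_mul_assoc]
      exact Submodule.smul_mem _ c ⟨_, gen_mem_degPart _ i, rfl⟩)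
    (fun w hw i => by
      obtain ⟨c, hc⟩ := h.quadEval_eq_smul hs hs' hw
      rw [hc, smul_mul_assoc]
      exact Submodule.smul_mem _ c ⟨_, gen_mem_degPart _ i, rfl⟩) ht
  exact ⟨d, hd, he.symm⟩

include h hs hs' in
/-- The forms of degree four are multiples of `f^!`. -/
theorem exists_eq_mul_of_mem_four {a : ConicDual ω r}
    (ha : a ∈ degPart k (conicDualGen ω r) 4) :
    ∃ d ∈ degPart k (conicDualGen ω r) 2, a = quadEval k (conicDualGen ω r) s * d := by
  rw [← range_quarticEval] at ha
  obtain ⟨t, rfl⟩ := ha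
  have hmem (i j : Fin 3) : conicDualGen ω r i * conicDualGen ω r j ∈
      degPart k (conicDualGen ω r) 2 :=
    degPart_mul_mem (gen_mem_degPart _ i) (gen_mem_degPart _ j)
  obtain ⟨d, hd, he⟩ := h.cubic.quarticEval_mem (conicDualGen ω r)
    ((degPart k (conicDualGen ω r) 2).map
      (LinearMap.mulLeft k (quadEval k (conicDualGen ω r) s)))
    (fun w hw i j => by
      obtain ⟨c, hc⟩ := h.quadEval_eq_smul hs hs' hw
      rw [hc, ← mul_assoc, h.mul_comm, smul_mul_assoc]
      exact Submodule.smul_mem _ c ⟨_, hmem i j, rfl⟩)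
    (fun w hw i j => by
      obtain ⟨c, hc⟩ := h.quadEval_eq_smul hs hs' hw
      rw [hc, h.mul_comm, mul_assoc, smul_mul_assoc]
      exact Submodule.smul_mem _ c ⟨_, hmem j i, rfl⟩)
    (fun w hw i j => by
      obtain ⟨c, hc⟩ := h.quadEval_eq_smul hs hs' hw
      rw [hc, smul_mul_assoc]
      exact Submodule.smul_mem _ c ⟨_, hmem i j, rfl⟩) t
  exact ⟨d, hd, he.symm⟩

include h in
/-- The functional on `A^!` given by pairing the forms of degree three with `ω`. -/
theorem exists_functional :
    ∃ Λ : ConicDual ω r →ₗ[k] k,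
      ∀ t, Λ (cubicEval k (conicDualGen ω r) t) = ∑ i, ∑ j, ∑ l, t i j l * ω i j l := by
  let φ : (Fin 3 → Fin 3 → Fin 3 → k) →ₗ[k] k :=
    { toFun := fun t => ∑ i, ∑ j, ∑ l, t i j l * ω i j l
      map_add' := fun a b => by simp [add_mul, Finset.sum_add_distrib]
      map_smul' := fun c a => by simp [Finset.mul_sum, mul_assoc] }
  have hφ (t) : φ t = ∑ i, ∑ j, ∑ l, t i j l * ω i j l := rfl
  have hω (i : Fin 3) : ω i ∈ conicSpan ω r :=
    derSpan_le_conicSpan (Submodule.subset_span ⟨i, rfl⟩)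
  obtain ⟨L, -, hL⟩ := (conicDual_presentation ω r).eval_model φ
    (fun t ht => by
      rw [LinearMap.mem_ker, hφ]
      exact Finset.sum_eq_zero fun i _ => ht i (ω i) (hω i))
    (fun t ht => by
      rw [LinearMap.mem_ker, hφ, Finset.sum_congr rfl fun i _ => Finset.sum_comm,
        Finset.sum_comm]
      refine Finset.sum_eq_zero fun l _ => ?_
      have := ht l (ω l) (hω l)
      rw [← this]
      refine Finset.sum_congr rfl fun i _ => Finset.sum_congr rfl fun j _ => ?_
      rw [h.cubic.swap_right i l j, h.cubic.swap_left l i j])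
  exact ⟨LinearMap.snd k _ _ ∘ₗ L, fun t => by simp [hL, hφ]⟩

theorem finrank_degPart_two (h : IsConicTensor ω r) :
    Module.finrank k (degPart k (conicDualGen ω r) 2) = 4 := by
  have h1 := (quadEval k (conicDualGen ω r)).finrank_range_add_finrank_ker
  rw [range_quadEval] at h1
  change _ + Module.finrank k (relSpace k (conicDualGen ω r)) = _ at h1
  rw [(conicDual_presentation ω r).relSpace_eq, Module.finrank_pi_fintype] at h1
  have h2 := finrank_perp (conicSpan ω r)
  rw [h.finrank_conicSpan] at h2
  simp at h1
  omega

end IsConicTensor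

/-- The properties of the algebra `A^!` of a conic and of its element `g = f^!` which determine the
structure of `C(A)`. -/
structure IsConicDualAlgebra {k : Type u} [Field k] (ω : Potential k) {B : Type u} [Ring B]
    [Algebra k B] (x : Fin 3 → B) (g : Subring.center B) : Prop where
  mul_comm : ∀ a b : B, a * b = b * a
  mem : (g : B) ∈ degPart k x 2
  regular : IsRegular (g : B)
  finrank_eq : Module.finrank k (degPart k x 2) = 4
  four : ∀ a ∈ degPart k x 4, ∃ d ∈ degPart k x 2, a = g * d
  cubic : ∀ t : Fin 3 → Fin 3 → Fin 3 → k, ∑ i, ∑ j, ∑ l, t i j l * ω i j l = 0 →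
    ∃ d ∈ degPart k x 1, cubicEval k x t = g * d
  functional : ∃ Λ : B →ₗ[k] k,
    ∀ t, Λ (cubicEval k x t) = ∑ i, ∑ j, ∑ l, t i j l * ω i j l
  independent : ∀ c : Fin 3 → k, (∀ j l, ∑ i, c i * ω i j l = 0) → c = 0

theorem IsConicTensor.isConicDualAlgebra {k : Type u} [Field k] {ω : Potential k}
    {r : Fin 3 → Fin 3 → k} (h : IsConicTensor ω r) {g : Subring.center (ConicDual ω r)}
    (hg : IsDualElement (quadEval k (derGen ω) r) g) :
    IsConicDualAlgebra ω (conicDualGen ω r) g := by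
  obtain ⟨s, hs, hs', he⟩ := h.exists_tensor_of_isDualElement hg
  refine ⟨h.mul_comm, hg.degree_two, hg.regular, h.finrank_degPart_two, fun a ha => ?_,
    fun t ht => ?_, h.exists_functional, fun c => h.cubic.eq_zero_of_sum_smul⟩
  · rw [he]; exact h.exists_eq_mul_of_mem_four hs hs' ha
  · rw [he]; exact h.cubicEval_eq_mul hs hs' ht

namespace IsConicDualAlgebra

variable {k : Type u} [Field k] {ω : Potential k} {B : Type u} [Ring B] [Algebra k B]
  {x : Fin 3 → B} {g : Subring.center B} (h : IsConicDualAlgebra ω x g)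

include h in
theorem exists_eq_pow_mul (m : ℕ) {a : B} (ha : a ∈ degPart k x (2 * (m + 1))) :
    ∃ d ∈ degPart k x 2, a = (g : B) ^ m * d := by
  induction m generalizing a with
  | zero => exact ⟨a, ha, by rw [pow_zero, one_mul]⟩
  | succ m ih =>
    have : a ∈ degPart k x 4 * degPart k x (2 * m) := by
      rw [degPart, degPart, ← pow_add, show 4 + 2 * m = 2 * (m + 1 + 1) by ring]
      exact ha
    have h2 : ∃ b ∈ degPart k x (2 * (m + 1)), a = g * b := by
      refine Submodule.mul_induction_on this (fun p hp q hq => ?_) ?_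
      · obtain ⟨d, hd, rfl⟩ := h.four p hp
        refine ⟨d * q, ?_, mul_assoc _ _ _⟩
        rw [show 2 * (m + 1) = 2 + 2 * m by ring]
        exact degPart_mul_mem hd hq
      · rintro _ _ ⟨b, hb, rfl⟩ ⟨c, hc, rfl⟩
        exact ⟨b + c, Submodule.add_mem _ hb hc, (mul_add _ _ _).symm⟩
    obtain ⟨b, hb, rfl⟩ := h2
    obtain ⟨d, hd, rfl⟩ := ih hb
    exact ⟨d, hd, by rw [pow_succ', mul_assoc]⟩

/-- The isomorphism of vector spaces `A^!_2 → C(A)`, `a ↦ a / f^!`. -/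
noncomputable def divDual : degPart k (x) 2 →ₗ[k]
    degreeZeroLoc k x g h.mem where
  toFun a := ⟨frac g a 1, 1, a, a.2, rfl⟩
  map_add' a b := Subtype.ext (frac_add_same g a.1 b.1 1)
  map_smul' c a := Subtype.ext (frac_smul g c a.1 1)

theorem divDual_coe (a : degPart k (x) 2) :
    (divDual h a : CentralLoc g) = frac g a 1 := rfl

theorem divDual_injective : Function.Injective (divDual h) := fun _ _ hab =>
  Subtype.ext (frac_injective h.regular (congrArg Subtype.val hab))

include h in
theorem divDual_surjective : Function.Surjective (divDual h) := by
  rintro ⟨_, m, a, ha, rfl⟩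
  have ha' : (g : B) * a ∈ degPart k (x) (2 * (m + 1)) := by
    rw [show 2 * (m + 1) = 2 + 2 * m by ring]
    exact degPart_mul_mem h.mem ha
  obtain ⟨d, hd, hda⟩ := h.exists_eq_pow_mul m ha'
  refine ⟨⟨d, hd⟩, Subtype.ext ?_⟩
  rw [divDual_coe]
  change frac g d 1 = frac g a m
  rw [← frac_pow_mul g d m 1, ← hda, ← pow_one (g : B), add_comm m 1,
    frac_pow_mul]

theorem divDual_mul {a b c : degPart k (x) 2}
    (habc : (a : B) * b = g * c) : divDual h a * divDual h b = divDual h c := by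
  apply Subtype.ext
  change frac g a 1 * frac g b 1 = frac g c 1
  rw [frac_mul, habc, ← pow_one (g : B), frac_pow_mul]

theorem divDual_self : divDual h ⟨g, h.mem⟩ = 1 := by
  apply Subtype.ext
  change frac g g 1 = 1
  have := frac_one g 1
  rwa [pow_one] at this

include h in
theorem degreeZeroLoc_mul_comm (a b : degreeZeroLoc k x g h.mem) : a * b = b * a := by
  obtain ⟨a, rfl⟩ := divDual_surjective h a
  obtain ⟨b, rfl⟩ := divDual_surjective h b
  apply Subtype.ext
  change frac g a 1 * frac g b 1 = frac g b 1 * frac g a 1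
  rw [frac_mul, frac_mul, h.mul_comm]

/-- `divDual` as an equivalence. -/
noncomputable def divDualEquiv : degPart k (x) 2 ≃ₗ[k]
    degreeZeroLoc k x g h.mem :=
  LinearEquiv.ofBijective (divDual h) ⟨divDual_injective h, divDual_surjective h⟩

include h in
theorem finrank_degreeZeroLoc : Module.finrank k (degreeZeroLoc k x g h.mem) = 4 := by
  rw [← (h.divDualEquiv).finrank_eq, h.finrank_eq]

include h in
theorem finite_degreeZeroLoc : Module.Finite k (degreeZeroLoc k x g h.mem) :=
  Module.finite_of_finrank_pos (by rw [h.finrank_degreeZeroLoc]; norm_num)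

/-- `C(A)` is Frobenius. The pairing of forms of degree two and three with values in
`A^!_5 / f^! ≅ A^!_3 → A^!_3 / f^! A^!_1 = S^!_3 ≅ k` is perfect, and multiplication by a linear
form `ℓ` with `ℓ² / f^!` a unit identifies `A^!_2` and `A^!_3`. -/
theorem isCommFrobeniusOfDimFour [Infinite k] :
    IsCommFrobeniusOfDimFour k (degreeZeroLoc k x g h.mem) := by
  have hfin := h.finite_degreeZeroLoc
  refine ⟨?_, h.degreeZeroLoc_mul_comm, h.finrank_degreeZeroLoc⟩
  obtain ⟨Λ, hΛ⟩ := h.functional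
  have hcomm : ∀ a b : B, a * b = b * a := h.mul_comm
  -- Linear forms, and the products `ℓ ℓ' / g`.
  let lin : (Fin 3 → k) →ₗ[k] B := Fintype.linearCombination k x
  have hlin (v) : lin v ∈ degPart k x 1 :=
    Submodule.sum_mem (degPart k x 1) (t := Finset.univ) (f := fun i => v i • x i)
      fun i _ => Submodule.smul_mem _ _ (gen_mem_degPart x i)
  let φ : (Fin 3 → k) →ₗ[k] (Fin 3 → k) →ₗ[k] degreeZeroLoc k x g h.mem :=
    LinearMap.mk₂ k (fun v w => divDual h ⟨lin v * lin w, degPart_mul_mem (hlin v) (hlin w)⟩)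
      (fun a b c => by
        rw [← map_add]; congr 1; ext1; simp [add_mul])
      (fun a b c => by
        rw [← map_smul]; congr 1; ext1; simp)
      (fun a b c => by
        rw [← map_add]; congr 1; ext1; simp [mul_add])
      (fun a b c => by
        rw [← map_smul]; congr 1; ext1; simp)
  have hφ (v w) : φ v w =
    divDual h ⟨lin v * lin w, degPart_mul_mem (hlin v) (hlin w)⟩ := rfl
  obtain ⟨v, hv⟩ : ∃ v, IsUnit (φ v v) := by
    let _ : CommRing (degreeZeroLoc k x g h.mem) :=
      commRingOfComm (h.degreeZeroLoc_mul_comm)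
    refine exists_isUnit_sq φ (fun a b => ?_) fun M hM => ?_
    · apply Subtype.ext
      change frac g (lin a * lin b) 1 * frac g (lin a * lin b) 1 =
        frac g (lin a * lin a) 1 * frac g (lin b * lin b) 1
      rw [frac_mul, frac_mul, ← mul_assoc, mul_assoc _ _ (lin a), hcomm (lin b), ← mul_assoc,
        ← mul_assoc]
    · rw [Ideal.eq_top_iff_one]
      obtain ⟨s, he⟩ : ∃ s, quadEval k x s = (g : B) := by
        have := h.mem
        rwa [← range_quadEval] at this
      have e : (1 : degreeZeroLoc k x g h.mem) =
          ∑ i, ∑ j, s i j • φ (Pi.single i 1) (Pi.single j 1) := by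
        rw [← divDual_self h]
        simp only [hφ, ← map_smul, ← map_sum]
        congr 1
        ext1
        simp only [Submodule.coe_sum, Submodule.coe_smul]
        rw [← he, quadEval_apply]
        simp [lin, Fintype.linearCombination_apply_single]
      rw [e]
      refine Ideal.sum_mem _ fun i _ => Ideal.sum_mem _ fun j _ => ?_
      rw [Algebra.smul_def]
      exact M.mul_mem_left _ (hM _ _)
  set ℓ : B := lin v with hℓ
  -- Multiplication by `ℓ` is injective on forms of degree two.
  have hinj (a : B) (ha : ℓ * a = 0) : a = 0 := by
    obtain ⟨q, hq⟩ := hv.exists_right_inv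
    obtain ⟨e, rfl⟩ := divDual_surjective h q
    have h1 : frac g (lin v * lin v * e) 2 = frac g ((g : B) ^ 2) 2 := by
      rw [frac_one]
      have := congrArg Subtype.val hq
      change frac g (lin v * lin v) 1 * frac g e 1 = 1 at this
      rwa [frac_mul] at this
    have h2 := frac_injective h.regular h1
    have h3 : (g : B) ^ 2 * a = 0 := by
      rw [← h2, hcomm _ a, ← mul_assoc, ← mul_assoc, hcomm a, ha, zero_mul, zero_mul]
    exact (h.regular.pow 2).left (by simpa using h3)
  let ψ : degreeZeroLoc k x g h.mem →ₗ[k] k :=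
    Λ ∘ₗ LinearMap.mulLeft k ℓ ∘ₗ (degPart k x 2).subtype ∘ₗ (h.divDualEquiv).symm.toLinearMap
  have hψ (c) : ψ (divDual h c) = Λ (ℓ * c) := by
    change Λ (ℓ * ((h.divDualEquiv).symm (h.divDualEquiv c) : B)) = _
    rw [LinearEquiv.symm_apply_apply]
  refine isFrobeniusAlgebra_of_functional (h.degreeZeroLoc_mul_comm) ψ fun a ha => ?_
  obtain ⟨a, rfl⟩ := divDual_surjective h a
  have ha' (b c : degPart k x 2) (hbc : (a : B) * b = g * c) : Λ (ℓ * c) = 0 := by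
    rw [← hψ, ← divDual_mul h hbc]
    exact ha _
  have hex (b : degPart k x 2) : ∃ c : degPart k x 2, (a : B) * b = g * c := by
    obtain ⟨c, hc, hbc⟩ := h.four _
      (degPart_mul_mem (m := 2) (n := 2) a.2 b.2)
    exact ⟨⟨c, hc⟩, hbc⟩
  -- Take `b = g`: the cubic form `ℓ a` is a multiple `g d`.
  have h1 : Λ (ℓ * a) = 0 := ha' ⟨g, h.mem⟩ a (hcomm _ _)
  have h3 : ℓ * a ∈ degPart k x 3 := degPart_mul_mem (m := 1) (n := 2) (hlin v) a.2
  rw [← range_cubicEval] at h3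
  obtain ⟨t, ht⟩ := h3
  rw [← ht, hΛ] at h1
  obtain ⟨d, hd, hd'⟩ := h.cubic t h1
  have hdℓ : ℓ * a = g * d := ht.symm.trans hd'
  have hΛd (b : degPart k x 2) : Λ (d * b) = 0 := by
    obtain ⟨c, hc⟩ := hex b
    have : ℓ * (c : B) = d * b := by
      apply h.regular.left
      change (g : B) * (ℓ * c) = g * (d * b)
      rw [← mul_assoc, hcomm _ ℓ, mul_assoc, ← hc, ← mul_assoc, hdℓ, mul_assoc]
    rw [← this]
    exact ha' b c hc
  have hd0 : d = 0 := by
    rw [degPart, pow_one] at hd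
    obtain ⟨c, rfl⟩ := (Submodule.mem_span_range_iff_exists_fun k).1 hd
    have hc : c = 0 := h.independent c fun j l => by
      have := hΛd ⟨x j * x l, degPart_mul_mem (gen_mem_degPart x j) (gen_mem_degPart x l)⟩
      have e : (∑ i, c i • x i) * (x j * x l) =
          cubicEval k x (fun i => Pi.single j (Pi.single l (c i))) := by
        simp [cubicEval_apply, quadEval_apply, Finset.sum_mul, Pi.single_apply, ite_apply,
          ite_smul]
      rw [e, hΛ] at this
      simpa [Pi.single_apply, ite_apply] using this
    simp [hc]
  rw [hd0, mul_zero] at hdℓ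
  have : a = 0 := Subtype.ext (hinj _ hdℓ)
  rw [this, map_zero]

end IsConicDualAlgebra

end NCConic

namespace NCConic

/-! ### Koszul complexes with coefficients -/

section Operators

variable {k : Type u} [Field k] {M : Type u} [AddCommGroup M] [Module k M]

/-- The free module on the monomials `z^c x^i y^j`, indexed by `(c, i, j)`, with coefficients
in `M`. -/
abbrev MonoModule (M : Type u) [AddCommGroup M] : Type u := (ℕ × ℕ × ℕ) →₀ M

variable (k M) in
/-- Right multiplication by `x` in the basis `z^c x^i y^j`, where `x y = - y x`. -/
noncomputable def opX : Module.End k (MonoModule M) :=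
  Finsupp.lsum k fun p => Finsupp.lsingle (p.1, p.2.1 + 1, p.2.2) ∘ₗ
    LinearMap.lsmul k M ((-1) ^ p.2.2)

variable (k M) in
/-- Right multiplication by `y` in the basis `z^c x^i y^j`. -/
noncomputable def opY : Module.End k (MonoModule M) :=
  Finsupp.lsum k fun p => Finsupp.lsingle (p.1, p.2.1, p.2.2 + 1)

variable (M) in
/-- Right multiplication by `z` in the basis `z^c x^i y^j`, where `y z = - z y - a x²` and
`x z = - z x - b y²`. -/
noncomputable def opZ (a b : k) : Module.End k (MonoModule M) :=
  Finsupp.lsum k fun p =>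
    Finsupp.lsingle (p.1 + 1, p.2.1, p.2.2) ∘ₗ LinearMap.lsmul k M ((-1) ^ (p.2.1 + p.2.2)) -
    (if Odd p.2.1 then Finsupp.lsingle (p.1, p.2.1 - 1, p.2.2 + 2) ∘ₗ
      LinearMap.lsmul k M ((-1) ^ p.2.2 * b) else 0) -
    (if Odd p.2.2 then Finsupp.lsingle (p.1, p.2.1 + 2, p.2.2 - 1) ∘ₗ
      LinearMap.lsmul k M a else 0)

/-- The action of an endomorphism on the coefficients. -/
noncomputable def coeffOp (n : Module.End k M) : Module.End k (MonoModule M) :=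
  Finsupp.mapRange.linearMap n

theorem opX_single (c i j : ℕ) (m : M) :
    opX k M (Finsupp.single (c, i, j) m) = Finsupp.single (c, i + 1, j) ((-1 : k) ^ j • m) := by
  simp [opX]

theorem opY_single (c i j : ℕ) (m : M) :
    opY k M (Finsupp.single (c, i, j) m) = Finsupp.single (c, i, j + 1) m := by
  simp [opY]

theorem opZ_single (a b : k) (c i j : ℕ) (m : M) :
    opZ M a b (Finsupp.single (c, i, j) m) =
      Finsupp.single (c + 1, i, j) ((-1 : k) ^ (i + j) • m) -
      (if Odd i then Finsupp.single (c, i - 1, j + 2) (((-1 : k) ^ j * b) • m) else 0) -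
      (if Odd j then Finsupp.single (c, i + 2, j - 1) (a • m) else 0) := by
  rw [opZ, Finsupp.lsum_single]
  simp only [LinearMap.sub_apply, LinearMap.comp_apply, Finsupp.lsingle_apply]
  split_ifs <;> simp

theorem coeffOp_single (n : Module.End k M) (p : ℕ × ℕ × ℕ) (m : M) :
    coeffOp n (Finsupp.single p m) = Finsupp.single p (n m) := by
  simp [coeffOp]

theorem monoModule_ext {E : Type v} [AddCommGroup E] [Module k E] {f g : MonoModule M →ₗ[k] E}
    (h : ∀ c i j m, f (Finsupp.single (c, i, j) m) = g (Finsupp.single (c, i, j) m)) : f = g :=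
  Finsupp.lhom_ext fun p m => h p.1 p.2.1 p.2.2 m

theorem opX_mul_opY : opX k M * opY k M + opY k M * opX k M = 0 := by
  refine monoModule_ext fun c i j m => ?_
  simp [opX_single, opY_single, pow_succ]

theorem opY_mul_opZ (a b : k) :
    opY k M * opZ M a b + opZ M a b * opY k M + a • (opX k M * opX k M) = 0 := by
  have h1 : ∀ n, ¬ Odd (2 * n) := fun n => by simp
  have h2 : ∀ n, Odd (2 * n + 1) := fun n => by simp
  have h3 : ∀ n, ¬ Odd (2 * n + 1 + 1) := fun n => by simp [parity_simps]
  refine monoModule_ext fun c i j m => ?_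
  simp only [LinearMap.add_apply, Module.End.mul_apply, LinearMap.smul_apply, opX_single,
    opY_single, opZ_single, map_sub, LinearMap.zero_apply]
  rcases Nat.even_or_odd' i with ⟨i, rfl | rfl⟩ <;>
    rcases Nat.even_or_odd' j with ⟨j, rfl | rfl⟩ <;>
    simp only [h1, h2, h3, if_true, if_false, opY_single, map_zero, smul_smul] <;>
    simp [pow_succ, pow_add, add_assoc]

theorem opX_mul_opZ (a b : k) :
    opX k M * opZ M a b + opZ M a b * opX k M + b • (opY k M * opY k M) = 0 := by
  have h1 : ∀ n, ¬ Odd (2 * n) := fun n => by simp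
  have h2 : ∀ n, Odd (2 * n + 1) := fun n => by simp
  have h3 : ∀ n, ¬ Odd (2 * n + 1 + 1) := fun n => by simp [parity_simps]
  refine monoModule_ext fun c i j m => ?_
  simp only [LinearMap.add_apply, Module.End.mul_apply, LinearMap.smul_apply, opX_single,
    opY_single, opZ_single, map_sub, LinearMap.zero_apply]
  rcases Nat.even_or_odd' i with ⟨i, rfl | rfl⟩ <;>
    rcases Nat.even_or_odd' j with ⟨j, rfl | rfl⟩ <;>
    simp only [h1, h2, h3, if_true, if_false, opX_single, map_zero, smul_smul] <;>
    simp [pow_succ, pow_add, add_assoc]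

theorem coeffOp_mul_opX (n : Module.End k M) : coeffOp n * opX k M = opX k M * coeffOp n := by
  refine monoModule_ext fun c i j m => ?_
  simp [opX_single, coeffOp_single]

theorem coeffOp_mul_opY (n : Module.End k M) : coeffOp n * opY k M = opY k M * coeffOp n := by
  refine monoModule_ext fun c i j m => ?_
  simp [opY_single, coeffOp_single]

theorem coeffOp_mul_opZ (a b : k) (n : Module.End k M) :
    coeffOp n * opZ M a b = opZ M a b * coeffOp n := by
  refine monoModule_ext fun c i j m => ?_
  simp only [Module.End.mul_apply, opZ_single, coeffOp_single, map_sub]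
  split_ifs <;> simp [coeffOp_single]

theorem coeffOp_mul (m n : Module.End k M) : coeffOp m * coeffOp n = coeffOp (m * n) := by
  refine monoModule_ext fun c i j m => ?_
  simp [coeffOp_single]

theorem coeffOp_add (m n : Module.End k M) : coeffOp (m + n) = coeffOp m + coeffOp n := by
  refine monoModule_ext fun c i j m => ?_
  simp [coeffOp_single]

theorem coeffOp_smul (r : k) (n : Module.End k M) : coeffOp (r • n) = r • coeffOp n := by
  refine monoModule_ext fun c i j m => ?_
  simp [coeffOp_single]

theorem coeffOp_neg (n : Module.End k M) : coeffOp (-n) = -coeffOp n := by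
  refine monoModule_ext fun c i j m => ?_
  simp [coeffOp_single]

theorem coeffOp_zero : coeffOp (0 : Module.End k M) = 0 := by
  refine monoModule_ext fun c i j m => ?_
  simp [coeffOp_single]

/-- Operators `x, y, z` that satisfy the relations `y z + z y + a x²`, `x z + z x + b y²` and
`x y + y x`. -/
structure IsCliffordTriple {R : Type*} [Ring R] [Algebra k R] (a b : k) (x y z : R) : Prop where
  yz : y * z + z * y + a • (x * x) = 0
  xz : x * z + z * x + b • (y * y) = 0
  xy : x * y + y * x = 0

theorem IsCliffordTriple.neg {R : Type*} [Ring R] [Algebra k R] {a b : k} {x y z : R}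
    (h : IsCliffordTriple a b x y z) : IsCliffordTriple a b (-x) (-y) (-z) := by
  constructor <;> simp only [neg_mul_neg]
  exacts [h.yz, h.xz, h.xy]

theorem IsCliffordTriple.opposite {R : Type*} [Ring R] [Algebra k R] {a b : k} {x y z : R}
    (h : IsCliffordTriple a b x y z) :
    IsCliffordTriple a b (MulOpposite.op x) (MulOpposite.op y) (MulOpposite.op z) := by
  constructor <;> apply MulOpposite.unop_injective <;> simp only [MulOpposite.unop_add,
    MulOpposite.unop_mul, MulOpposite.unop_smul, MulOpposite.unop_op, MulOpposite.unop_zero]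
  · rw [add_comm (z * y)]; exact h.yz
  · rw [add_comm (z * x)]; exact h.xz
  · rw [add_comm (y * x)]; exact h.xy

variable (k M) in
theorem isCliffordTriple_op (a b : k) : IsCliffordTriple a b (opX k M) (opY k M) (opZ M a b) :=
  ⟨opY_mul_opZ a b, opX_mul_opZ a b, opX_mul_opY⟩

theorem IsCliffordTriple.coeffOp {a b : k} {x y z : Module.End k M}
    (h : IsCliffordTriple a b x y z) :
    IsCliffordTriple a b (coeffOp x) (coeffOp y) (coeffOp z) := by
  constructor <;> simp only [coeffOp_mul, ← coeffOp_add, ← coeffOp_smul]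
  exacts [by rw [h.yz, coeffOp_zero], by rw [h.xz, coeffOp_zero], by rw [h.xy, coeffOp_zero]]

/-- Operators `dᵢ`, `eᵢ` for which `d₁ ∘ d₂ = 0` in the Koszul complex. -/
structure IsKoszulPair {R : Type*} [Ring R] [Algebra k R] (a b : k) (dx dy dz ex ey ez : R) :
    Prop where
  yz : dy * ez + dz * ey + a • (dx * ex) = 0
  xz : dx * ez + dz * ex + b • (dy * ey) = 0
  xy : dx * ey + dy * ex = 0

/-- If the operators `nᵢ` commute with the operators `pᵢ`, then the mixed terms cancel in the
Koszul relations between the `pᵢ - nᵢ` and the `pᵢ + nᵢ`. -/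
theorem IsCliffordTriple.isKoszulPair {R : Type*} [Ring R] [Algebra k R] {a b : k}
    {x y z x' y' z' : R} (h : IsCliffordTriple a b x y z) (h' : IsCliffordTriple a b x' y' z')
    (hc : ∀ p ∈ [x, y, z], ∀ n ∈ [x', y', z'], n * p = p * n) :
    IsKoszulPair a b (x - x') (y - y') (z - z') (x + x') (y + y') (z + z') := by
  simp only [List.mem_cons, List.not_mem_nil, or_false, forall_eq_or_imp, forall_eq] at hc
  obtain ⟨⟨h11, h12, h13⟩, ⟨h21, h22, h23⟩, h31, h32, h33⟩ := hc
  constructor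
  · have e : (y - y') * (z + z') + (z - z') * (y + y') + a • ((x - x') * (x + x')) =
        (y * z + z * y + a • (x * x)) - (y' * z' + z' * y' + a • (x' * x')) := by
      simp only [sub_mul, mul_add, h11, h23, h32, smul_sub, smul_add]
      abel
    rw [e, h.yz, h'.yz, sub_zero]
  · have e : (x - x') * (z + z') + (z - z') * (x + x') + b • ((y - y') * (y + y')) =
        (x * z + z * x + b • (y * y)) - (x' * z' + z' * x' + b • (y' * y')) := by
      simp only [sub_mul, mul_add, h22, h13, h31, smul_sub, smul_add]
      abel
    rw [e, h.xz, h'.xz, sub_zero]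
  · have e : (x - x') * (y + y') + (y - y') * (x + x') =
        (x * y + y * x) - (x' * y' + y' * x') := by
      simp only [sub_mul, mul_add, h12, h21]
      abel
    rw [e, h.xy, h'.xy, sub_zero]

theorem IsCliffordTriple.isKoszulPair_coeffOp {a b : k} {x y z : Module.End k M}
    (h : IsCliffordTriple a b x y z) :
    IsKoszulPair a b (opX k M - NCConic.coeffOp x) (opY k M - NCConic.coeffOp y)
      (opZ M a b - NCConic.coeffOp z) (opX k M + NCConic.coeffOp x) (opY k M + NCConic.coeffOp y)
      (opZ M a b + NCConic.coeffOp z) := by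
  refine (isCliffordTriple_op k M a b).isKoszulPair h.coeffOp ?_
  simp [coeffOp_mul_opX, coeffOp_mul_opY, coeffOp_mul_opZ]

/-! ### Exactness of the Koszul complex -/

theorem eq_zero_of_descending {v : ℕ → M} (hv : ∃ n, ∀ i ≥ n, v i = 0)
    (h : ∀ i, v (i + 1) = 0 → v i = 0) : ∀ i, v i = 0 := by
  obtain ⟨n, hn⟩ := hv
  intro i
  by_cases hi : n ≤ i
  · exact hn i hi
  · have key : ∀ d, v (n - d) = 0 := by
      intro d
      induction d with
      | zero => exact hn _ le_rfl
      | succ d ih =>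
        by_cases hd : n ≤ d
        · rwa [Nat.sub_eq_zero_of_le (by omega), ← Nat.sub_eq_zero_of_le hd]
        · apply h
          rwa [show n - (d + 1) + 1 = n - d by omega]
    have := key (n - i)
    rwa [show n - (n - i) = i by omega] at this

theorem exists_bound (u : MonoModule M) :
    ∃ n, ∀ c i j, n ≤ c ∨ n ≤ i ∨ n ≤ j → u (c, i, j) = 0 := by
  refine ⟨u.support.sup (fun p => p.1 + p.2.1 + p.2.2) + 1, fun c i j h => ?_⟩
  by_contra hne
  have := Finset.le_sup (f := fun p : ℕ × ℕ × ℕ => p.1 + p.2.1 + p.2.2)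
    (Finsupp.mem_support_iff.2 hne)
  simp only at this
  omega

theorem opX_apply_succ (u : MonoModule M) (c i j : ℕ) :
    opX k M u (c, i + 1, j) = (-1 : k) ^ j • u (c, i, j) := by
  have : (Finsupp.lapply (c, i + 1, j)) ∘ₗ opX k M =
      (-1 : k) ^ j • (Finsupp.lapply (c, i, j) : MonoModule M →ₗ[k] M) := by
    refine monoModule_ext fun c' i' j' m => ?_
    simp only [LinearMap.comp_apply, opX_single, Finsupp.lapply_apply, LinearMap.smul_apply,
      Finsupp.single_apply, Prod.mk.injEq, add_left_inj]
    split_ifs with h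
    · rw [h.2.2]
    · rw [smul_zero]
  exact LinearMap.congr_fun this u

theorem opY_apply_succ (u : MonoModule M) (c i j : ℕ) :
    opY k M u (c, i, j + 1) = u (c, i, j) := by
  have : (Finsupp.lapply (c, i, j + 1)) ∘ₗ opY k M =
      (Finsupp.lapply (c, i, j) : MonoModule M →ₗ[k] M) := by
    refine monoModule_ext fun c' i' j' m => ?_
    simp [opY_single, Finsupp.single_apply]
  exact LinearMap.congr_fun this u

theorem opZ_apply_succ (a b : k) (u : MonoModule M) (c : ℕ) :
    opZ M a b u (c + 1, 0, 0) = u (c, 0, 0) := by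
  have : (Finsupp.lapply (c + 1, 0, 0)) ∘ₗ opZ M a b =
      (Finsupp.lapply (c, 0, 0) : MonoModule M →ₗ[k] M) := by
    refine monoModule_ext fun c' i' j' m => ?_
    simp only [LinearMap.comp_apply, opZ_single, Finsupp.lapply_apply, Finsupp.sub_apply]
    have h1 : (if Odd i' then (Finsupp.single (c', i' - 1, j' + 2) (((-1 : k) ^ j' * b) • m) :
        MonoModule M) else 0) (c + 1, 0, 0) = 0 := by
      split_ifs <;> simp
    have h2 : (if Odd j' then (Finsupp.single (c', i' + 2, j' - 1) (a • m) :
        MonoModule M) else 0) (c + 1, 0, 0) = 0 := by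
      split_ifs <;> simp
    rw [h1, h2]
    simp only [Finsupp.single_apply, Prod.mk.injEq, add_left_inj, sub_zero]
    split_ifs with h
    · simp [h.2.1, h.2.2]
    · rfl
  exact LinearMap.congr_fun this u

theorem coeffOp_apply (n : Module.End k M) (u : MonoModule M) (p : ℕ × ℕ × ℕ) :
    coeffOp n u p = n (u p) := by
  simp [coeffOp]

/-- Compare the coefficients of highest degree in `x`. -/
theorem opX_sub_injective (n : Module.End k M) (u : MonoModule M)
    (hu : (opX k M - coeffOp n) u = 0) : u = 0 := by
  obtain ⟨d, hd⟩ := exists_bound u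
  ext ⟨c, i, j⟩
  refine eq_zero_of_descending (v := fun i => u (c, i, j)) ⟨d, fun i hi => hd _ _ _ (by tauto)⟩
    (fun i hi => ?_) i
  have := DFunLike.congr_fun hu (c, i + 1, j)
  rw [LinearMap.sub_apply, Finsupp.sub_apply, opX_apply_succ, coeffOp_apply, hi, map_zero,
    sub_zero, Finsupp.zero_apply] at this
  exact (smul_eq_zero.1 this).resolve_left (pow_ne_zero _ (neg_ne_zero.2 one_ne_zero))

theorem opY_sub_injective (n : Module.End k M) (u : MonoModule M)
    (hu : (opY k M - coeffOp n) u = 0) : u = 0 := by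
  obtain ⟨d, hd⟩ := exists_bound u
  ext ⟨c, i, j⟩
  refine eq_zero_of_descending (v := fun j => u (c, i, j)) ⟨d, fun i hi => hd _ _ _ (by tauto)⟩
    (fun j hj => ?_) j
  have := DFunLike.congr_fun hu (c, i, j + 1)
  rwa [LinearMap.sub_apply, Finsupp.sub_apply, opY_apply_succ, coeffOp_apply, hj, map_zero,
    sub_zero, Finsupp.zero_apply] at this

theorem opZ_sub_injective (a b : k) (n : Module.End k M) (u : MonoModule M)
    (hu : (opZ M a b - coeffOp n) u = 0) (c : ℕ) : u (c, 0, 0) = 0 := by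
  obtain ⟨d, hd⟩ := exists_bound u
  refine eq_zero_of_descending (v := fun c => u (c, 0, 0)) ⟨d, fun i hi => hd _ _ _ (by tauto)⟩
    (fun c hc => ?_) c
  have := DFunLike.congr_fun hu (c + 1, 0, 0)
  rwa [LinearMap.sub_apply, Finsupp.sub_apply, opZ_apply_succ, coeffOp_apply, hc, map_zero,
    sub_zero, Finsupp.zero_apply] at this

/-- The projection onto the monomials `z^c y^j` along the image of `x - n`. -/
noncomputable def reduceX (n : Module.End k M) : Module.End k (MonoModule M) :=
  Finsupp.lsum k fun p => Finsupp.lsingle (p.1, 0, p.2.2) ∘ₗ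
    ((-1 : k) ^ (p.2.1 * p.2.2) • (n ^ p.2.1))

/-- The projection onto the monomials `z^c` along the images of `x - nx` and `y - ny`. -/
noncomputable def reduceXY (nx ny : Module.End k M) : Module.End k (MonoModule M) :=
  Finsupp.lsum k fun p => Finsupp.lsingle (p.1, 0, 0) ∘ₗ (nx ^ p.2.1 * ny ^ p.2.2)

/-- The map that sends `z^c x^i y^j ⊗ m` to `z^c x^i y^j m`. -/
noncomputable def actMap (nx ny nz : Module.End k M) : MonoModule M →ₗ[k] M :=
  Finsupp.lsum k fun p => nz ^ p.1 * (nx ^ p.2.1 * ny ^ p.2.2)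

theorem reduceX_single (n : Module.End k M) (c i j : ℕ) (m : M) :
    reduceX n (Finsupp.single (c, i, j) m) =
      Finsupp.single (c, 0, j) ((-1 : k) ^ (i * j) • (n ^ i) m) := by
  simp [reduceX]

theorem reduceXY_single (nx ny : Module.End k M) (c i j : ℕ) (m : M) :
    reduceXY nx ny (Finsupp.single (c, i, j) m) =
      Finsupp.single (c, 0, 0) ((nx ^ i) ((ny ^ j) m)) := by
  simp [reduceXY]

theorem actMap_single (nx ny nz : Module.End k M) (c i j : ℕ) (m : M) :
    actMap nx ny nz (Finsupp.single (c, i, j) m) = (nz ^ c) ((nx ^ i) ((ny ^ j) m)) := by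
  simp [actMap]

section Triple

variable {R : Type*} [Ring R] [Algebra k R] {a b : k} {x y z : R}

theorem pow_mul_of_anticomm (h : x * y + y * x = 0) (j : ℕ) :
    y ^ j * x = (-1 : k) ^ j • (x * y ^ j) := by
  induction j with
  | zero => simp
  | succ j ih =>
    rw [pow_succ, mul_assoc, eq_neg_of_add_eq_zero_right h, mul_neg, ← mul_assoc, ih,
      smul_mul_assoc, mul_assoc, pow_succ, mul_neg_one, neg_smul]

omit [Algebra k R] in
theorem commute_sq_of_anticomm (h : x * y + y * x = 0) : Commute (x * x) y := by
  have h' : x * y = -(y * x) := eq_neg_of_add_eq_zero_left h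
  show x * x * y = y * (x * x)
  rw [mul_assoc, h', mul_neg, ← mul_assoc, h', neg_mul, neg_neg, mul_assoc]

theorem commute_sq_of_add_smul {c : k} {s : R} (h : x * z + z * x + c • s = 0)
    (hs : Commute s x) : Commute (x * x) z := by
  have h' : x * z = -(z * x) - c • s := by
    rw [eq_sub_iff_add_eq, eq_neg_iff_add_eq_zero, ← h]; abel
  show x * x * z = z * (x * x)
  rw [mul_assoc, h', mul_sub, mul_neg, ← mul_assoc, h', mul_smul_comm, ← hs.eq, sub_mul, neg_mul,
    smul_mul_assoc, mul_assoc]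
  abel

theorem pow_mul_of_add_smul {c : k} {s : R} (h : x * z + z * x + c • s = 0)
    (hs : Commute s x) (i : ℕ) :
    x ^ i * z = (-1 : k) ^ i • (z * x ^ i) - if Odd i then c • (x ^ (i - 1) * s) else 0 := by
  have hc : ∀ n, x ^ (2 * n) * z = z * x ^ (2 * n) := fun n => by
    rw [pow_mul, pow_two]; exact ((commute_sq_of_add_smul h hs).pow_left n).eq
  have h' : x * z = -(z * x) - c • s := by
    rw [eq_sub_iff_add_eq, eq_neg_iff_add_eq_zero, ← h]; abel
  rcases Nat.even_or_odd' i with ⟨i, rfl | rfl⟩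
  · rw [if_neg (by simp)]
    simp [hc]
  · rw [pow_succ, mul_assoc, h', mul_sub, mul_neg, ← mul_assoc, hc]
    simp [pow_succ, mul_assoc]

namespace IsCliffordTriple

variable (h : IsCliffordTriple a b x y z)
include h

theorem commute_xx_y : Commute (x * x) y := commute_sq_of_anticomm h.xy

theorem commute_yy_x : Commute (y * y) x :=
  commute_sq_of_anticomm ((add_comm _ _).trans h.xy)

theorem commute_xx_z : Commute (x * x) z := commute_sq_of_add_smul h.xz h.commute_yy_x

theorem commute_yy_z : Commute (y * y) z := commute_sq_of_add_smul h.yz h.commute_xx_y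

theorem commute_zz_x : Commute (z * z) x :=
  commute_sq_of_add_smul (by rw [add_comm (z * x)]; exact h.xz) h.commute_yy_z

theorem commute_zz_y : Commute (z * z) y :=
  commute_sq_of_add_smul (by rw [add_comm (z * y)]; exact h.yz) h.commute_xx_z

/-- The commutation rule behind the definition of `opZ`. -/
theorem pow_mul_pow_mul (i j : ℕ) :
    x ^ i * y ^ j * z = (-1 : k) ^ (i + j) • (z * (x ^ i * y ^ j)) -
      (if Odd i then ((-1 : k) ^ j * b) • (x ^ (i - 1) * y ^ (j + 2)) else 0) -
      (if Odd j then a • (x ^ (i + 2) * y ^ (j - 1)) else 0) := by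
  have hy : y ^ (j - 1) * (x * x) = x * x * y ^ (j - 1) := (h.commute_xx_y.pow_right _).eq.symm
  rw [mul_assoc, pow_mul_of_add_smul h.yz h.commute_xx_y, mul_sub, mul_smul_comm, ← mul_assoc,
    pow_mul_of_add_smul h.xz h.commute_yy_x, sub_mul, smul_mul_assoc, smul_sub, smul_smul,
    ← pow_add, add_comm j i, mul_assoc z, hy]
  congr 2
  · split_ifs
    · rw [smul_mul_assoc, smul_smul, mul_assoc, ← pow_two, ← pow_add, add_comm 2]
    · simp
  · split_ifs
    · rw [mul_smul_comm, ← mul_assoc, ← pow_two, ← pow_add]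
    · simp

end IsCliffordTriple

end Triple

section Clifford

variable {a b : k} {x y z : Module.End k M} (h : IsCliffordTriple a b x y z)

theorem reduceX_mul_sub (n : Module.End k M) : reduceX n * (opX k M - coeffOp n) = 0 := by
  refine monoModule_ext fun c i j m => ?_
  have e : (-1 : k) ^ ((i + 1) * j) * (-1) ^ j = (-1) ^ (i * j) := by
    rw [← pow_add, show (i + 1) * j + j = i * j + (j + j) by ring, pow_add _ (i * j),
      Even.neg_one_pow ⟨j, rfl⟩, mul_one]
  simp only [Module.End.mul_apply, LinearMap.sub_apply, opX_single, coeffOp_single, map_sub,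
    reduceX_single, map_smul, smul_smul, e, LinearMap.zero_apply, pow_succ (n := i) n, sub_self]

theorem reduceX_mul_mul (n n' l : Module.End k M) :
    reduceX n * (opY k M - coeffOp l) * reduceX n' = (opY k M - coeffOp l) * reduceX n' := by
  refine monoModule_ext fun c i j m => ?_
  simp [Module.End.mul_apply, opY_single, coeffOp_single, reduceX_single]

theorem sub_reduceX_mem (n : Module.End k M) (u : MonoModule M) :
    u - reduceX n u ∈ LinearMap.range (opX k M - coeffOp n) := by
  induction u using Finsupp.induction_linear with
  | zero => simp
  | add u v hu hv => rw [map_add, add_sub_add_comm]; exact add_mem hu hv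
  | single p m =>
    obtain ⟨c, i, j⟩ := p
    induction i generalizing m with
    | zero => simp [reduceX_single]
    | succ i ih =>
      have h1 := ih ((-1 : k) ^ j • n m)
      have h2 := LinearMap.mem_range_self (opX k M - coeffOp n)
        (Finsupp.single (c, i, j) ((-1 : k) ^ j • m))
      have h3 := add_mem h1 h2
      have e : ((-1 : k) ^ j) * (-1) ^ j = 1 := by rw [← pow_add, Even.neg_one_pow ⟨j, rfl⟩]
      convert h3 using 1
      simp only [LinearMap.sub_apply, opX_single, coeffOp_single, reduceX_single, smul_smul, e,
        one_smul, map_smul, add_mul, one_mul, pow_add, pow_one, Module.End.mul_apply]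
      abel

theorem reduceXY_mul_subX (hxy : x * y + y * x = 0) :
    reduceXY x y * (opX k M - coeffOp x) = 0 := by
  refine monoModule_ext fun c i j m => ?_
  have e := LinearMap.congr_fun (pow_mul_of_anticomm (k := k) hxy j) m
  simp only [Module.End.mul_apply, LinearMap.smul_apply] at e
  simp only [Module.End.mul_apply, LinearMap.sub_apply, opX_single, coeffOp_single, map_sub,
    reduceXY_single, map_smul, LinearMap.zero_apply, pow_succ (n := i) x, e, sub_self]

theorem reduceXY_mul_subY : reduceXY x y * (opY k M - coeffOp y) = 0 := by
  refine monoModule_ext fun c i j m => ?_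
  simp only [Module.End.mul_apply, LinearMap.sub_apply, opY_single, coeffOp_single, map_sub,
    reduceXY_single, LinearMap.zero_apply, pow_succ (n := j) y, sub_self]

theorem reduceXY_mul_mul (x' y' n : Module.End k M) :
    reduceXY x y * (opZ M a b - coeffOp n) * reduceXY x' y' =
      (opZ M a b - coeffOp n) * reduceXY x' y' := by
  refine monoModule_ext fun c i j m => ?_
  simp [Module.End.mul_apply, opZ_single, coeffOp_single, reduceXY_single]

theorem sub_reduceXY_mem (u : MonoModule M) :
    u - reduceXY x y u ∈ LinearMap.range (opX k M - coeffOp x) ⊔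
      LinearMap.range (opY k M - coeffOp y) := by
  induction u using Finsupp.induction_linear with
  | zero => simp
  | add u v hu hv => rw [map_add, add_sub_add_comm]; exact add_mem hu hv
  | single p m =>
    obtain ⟨c, i, j⟩ := p
    induction j generalizing m with
    | zero =>
      apply Submodule.mem_sup_left
      have := sub_reduceX_mem x (Finsupp.single (c, i, 0) m)
      simpa [reduceX_single, reduceXY_single] using this
    | succ j ih =>
      have h3 := add_mem (ih (y m)) (Submodule.mem_sup_right (LinearMap.mem_range_self
        (opY k M - coeffOp y) (Finsupp.single (c, i, j) m)))
      convert h3 using 1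
      simp only [LinearMap.sub_apply, opY_single, coeffOp_single, reduceXY_single, pow_succ,
        Module.End.mul_apply]
      abel

theorem reduceXY_apply_of_ne (u : MonoModule M) (c i j : ℕ) (hij : (i, j) ≠ (0, 0)) :
    reduceXY x y u (c, i, j) = 0 := by
  have : (Finsupp.lapply (c, i, j)) ∘ₗ reduceXY x y = (0 : MonoModule M →ₗ[k] M) := by
    refine monoModule_ext fun c' i' j' m => ?_
    simp only [LinearMap.comp_apply, reduceXY_single, Finsupp.lapply_apply, LinearMap.zero_apply]
    rw [Finsupp.single_apply, if_neg]
    rintro h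
    simp only [Prod.mk.injEq] at h
    exact hij (by rw [← h.2.1, ← h.2.2])
  exact LinearMap.congr_fun this u

/-- Exactness of the Koszul complex at `N`: its cokernel is `M`. -/
theorem mem_range_of_actMap_eq_zero (u : MonoModule M) (hu : actMap x y z u = 0) :
    u ∈ LinearMap.range (opX k M - coeffOp x) ⊔ LinearMap.range (opY k M - coeffOp y) ⊔
      LinearMap.range (opZ M a b - coeffOp z) := by
  have key : ∀ u : MonoModule M, u - Finsupp.single (0, 0, 0) (actMap x y z u) ∈
      LinearMap.range (opX k M - coeffOp x) ⊔ LinearMap.range (opY k M - coeffOp y) ⊔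
      LinearMap.range (opZ M a b - coeffOp z) := by
    intro u
    induction u using Finsupp.induction_linear with
    | zero => simp
    | add u v hu hv => rw [map_add, Finsupp.single_add, add_sub_add_comm]; exact add_mem hu hv
    | single p m =>
      obtain ⟨c, i, j⟩ := p
      have h1 : ∀ c m, Finsupp.single (c, 0, 0) m - Finsupp.single (0, 0, 0) ((z ^ c) m) ∈
          LinearMap.range (opX k M - coeffOp x) ⊔ LinearMap.range (opY k M - coeffOp y) ⊔
          LinearMap.range (opZ M a b - coeffOp z) := by
        intro c
        induction c with
        | zero => simp
        | succ c ih =>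
          intro m
          convert add_mem (ih (z m)) (Submodule.mem_sup_right (LinearMap.mem_range_self
            (opZ M a b - coeffOp z) (Finsupp.single (c, 0, 0) m))) using 1
          simp only [LinearMap.sub_apply, opZ_single, coeffOp_single, pow_succ,
            Module.End.mul_apply]
          simp
      convert add_mem (Submodule.mem_sup_left (sub_reduceXY_mem (x := x) (y := y)
        (Finsupp.single (c, i, j) m))) (h1 c ((x ^ i) ((y ^ j) m))) using 1
      rw [reduceXY_single, actMap_single]
      abel
  simpa [hu] using key u

end Clifford

/-- Exactness of the Koszul complex `0 → N → N³ → N³ → N` with the differentials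
`w ↦ (dx w, dy w, dz w)`,
`(v₁, v₂, v₃) ↦ (a ex v₁ + ez v₂ + ey v₃, ez v₁ + b ey v₂ + ex v₃, ey v₁ + ex v₂)` and
`(u₁, u₂, u₃) ↦ dx u₁ + dy u₂ + dz u₃`. -/
structure IsKoszulExact {N : Type*} [AddCommGroup N] [Module k N] (a b : k)
    (dx dy dz ex ey ez : Module.End k N) : Prop where
  pair : IsKoszulPair a b dx dy dz ex ey ez
  pair' : IsKoszulPair a b ex ey ez dx dy dz
  inj : ∀ w, dx w = 0 → w = 0
  exact_two : ∀ v₁ v₂ v₃, a • ex v₁ + ez v₂ + ey v₃ = 0 → ez v₁ + b • ey v₂ + ex v₃ = 0 →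
    ey v₁ + ex v₂ = 0 → ∃ w, v₁ = dx w ∧ v₂ = dy w ∧ v₃ = dz w
  exact_one : ∀ u₁ u₂ u₃, dx u₁ + dy u₂ + dz u₃ = 0 →
    ∃ v₁ v₂ v₃, u₁ = a • ex v₁ + ez v₂ + ey v₃ ∧ u₂ = ez v₁ + b • ey v₂ + ex v₃ ∧
      u₃ = ey v₁ + ex v₂

theorem opX_add (n : Module.End k M) : opX k M + coeffOp n = opX k M - coeffOp (-n) := by
  rw [coeffOp_neg, sub_neg_eq_add]

theorem opY_add (n : Module.End k M) : opY k M + coeffOp n = opY k M - coeffOp (-n) := by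
  rw [coeffOp_neg, sub_neg_eq_add]

section Exactness

variable {a b : k} {nx ny nz : Module.End k M}

/-- The Koszul complex of the pair `x, y` is exact in the middle. -/
theorem exists_of_add_eq_zero (h : nx * ny + ny * nx = 0) (u w : MonoModule M)
    (huw : (opX k M - coeffOp nx) u + (opY k M - coeffOp ny) w = 0) :
    ∃ v, u = (opY k M + coeffOp ny) v ∧ w = (opX k M + coeffOp nx) v := by
  obtain ⟨v, hv⟩ := sub_reduceX_mem (-nx) w
  rw [← opX_add] at hv
  have hw : w = reduceX (-nx) w + (opX k M + coeffOp nx) v := by rw [hv]; abel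
  have hK : (opX k M - coeffOp nx) * (opY k M + coeffOp ny) +
      (opY k M - coeffOp ny) * (opX k M + coeffOp nx) = 0 := by
    have e : (opX k M - coeffOp nx) * (opY k M + coeffOp ny) +
        (opY k M - coeffOp ny) * (opX k M + coeffOp nx) =
        (opX k M * opY k M + opY k M * opX k M) - coeffOp (nx * ny + ny * nx) := by
      simp only [sub_mul, mul_add, coeffOp_mul_opX, coeffOp_mul_opY, coeffOp_add, coeffOp_mul]
      abel
    rw [e, opX_mul_opY, h, coeffOp_zero, sub_zero]
  have hxy := LinearMap.congr_fun hK v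
  rw [LinearMap.add_apply, Module.End.mul_apply, Module.End.mul_apply, LinearMap.zero_apply] at hxy
  have h1 : (opX k M - coeffOp nx) (u - (opY k M + coeffOp ny) v) +
      (opY k M - coeffOp ny) (reduceX (-nx) w) = 0 := by
    have hw' := congrArg (opY k M - coeffOp ny) hw
    rw [map_add] at hw'
    rw [map_sub]
    linear_combination (norm := module) huw - hxy - hw'
  have h2 : (opY k M - coeffOp ny) (reduceX (-nx) w) = 0 := by
    have e1 := LinearMap.congr_fun (reduceX_mul_mul nx (-nx) ny) w
    have e2 := LinearMap.congr_fun (reduceX_mul_sub nx) (u - (opY k M + coeffOp ny) v)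
    simp only [Module.End.mul_apply, LinearMap.zero_apply] at e1 e2
    have e3 := congrArg (reduceX nx) h1
    rwa [map_add, e2, zero_add, map_zero, e1] at e3
  have h3 := opY_sub_injective _ _ h2
  rw [h2, add_zero] at h1
  rw [h3, zero_add] at hw
  exact ⟨v, sub_eq_zero.1 (opX_sub_injective _ _ h1), hw⟩

variable (h : IsCliffordTriple a b nx ny nz)
include h

/-- Modulo the images of `x - nx` and `y - ny` only the powers of `z` remain, and there `z - nz` is
injective. -/
theorem IsCliffordTriple.exists_of_mem_sup (u : MonoModule M)
    (hu : (opZ M a b - NCConic.coeffOp nz) u ∈ LinearMap.range (opX k M - NCConic.coeffOp nx) ⊔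
      LinearMap.range (opY k M - NCConic.coeffOp ny)) :
    u ∈ LinearMap.range (opX k M + NCConic.coeffOp nx) ⊔
      LinearMap.range (opY k M + NCConic.coeffOp ny) := by
  have hK := h.isKoszulPair_coeffOp
  have h0 := sub_reduceXY_mem (x := -nx) (y := -ny) u
  rw [← opX_add, ← opY_add] at h0
  obtain ⟨_, ⟨v, rfl⟩, _, ⟨w, rfl⟩, hvw⟩ := Submodule.mem_sup.1 h0
  have hxz := LinearMap.congr_fun hK.xz v
  have hyz := LinearMap.congr_fun hK.yz w
  set Dx := opX k M - NCConic.coeffOp nx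
  set Dy := opY k M - NCConic.coeffOp ny
  set Dz := opZ M a b - NCConic.coeffOp nz
  set Ex := opX k M + NCConic.coeffOp nx
  set Ey := opY k M + NCConic.coeffOp ny
  simp only [LinearMap.add_apply, Module.End.mul_apply, LinearMap.zero_apply,
    LinearMap.smul_apply] at hxz hyz
  have h1 : Dz (reduceXY (-nx) (-ny) u) ∈ LinearMap.range Dx ⊔ LinearMap.range Dy := by
    have e : reduceXY (-nx) (-ny) u = u - (Ex v + Ey w) := by rw [hvw]; abel
    rw [e, map_sub, map_add]
    refine sub_mem hu (add_mem ?_ ?_)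
    · rw [eq_neg_of_add_eq_zero_right ((add_right_comm _ _ _).trans hxz)]
      exact neg_mem (add_mem (Submodule.mem_sup_left ⟨_, rfl⟩)
        (Submodule.smul_mem _ _ (Submodule.mem_sup_right ⟨_, rfl⟩)))
    · rw [eq_neg_of_add_eq_zero_right ((add_right_comm _ _ _).trans hyz)]
      exact neg_mem (add_mem (Submodule.mem_sup_right ⟨_, rfl⟩)
        (Submodule.smul_mem _ _ (Submodule.mem_sup_left ⟨_, rfl⟩)))
  obtain ⟨_, ⟨p, rfl⟩, _, ⟨q, rfl⟩, hpq⟩ := Submodule.mem_sup.1 h1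
  have h2 : Dz (reduceXY (-nx) (-ny) u) = 0 := by
    have e1 := LinearMap.congr_fun (reduceXY_mul_mul (a := a) (b := b) (x := nx) (y := ny)
      (-nx) (-ny) nz) u
    have e2 := LinearMap.congr_fun (reduceXY_mul_subX h.xy) p
    have e3 := LinearMap.congr_fun (reduceXY_mul_subY (x := nx) (y := ny)) q
    simp only [Module.End.mul_apply, LinearMap.zero_apply] at e1 e2 e3
    rw [← e1, ← hpq, map_add, e2, e3, add_zero]
  have h3 : reduceXY (-nx) (-ny) u = 0 := by
    ext ⟨c, i, j⟩
    by_cases hij : (i, j) = (0, 0)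
    · rw [Prod.mk.injEq] at hij
      rw [hij.1, hij.2]
      exact opZ_sub_injective _ _ _ _ h2 c
    · exact reduceXY_apply_of_ne _ _ _ _ hij
  rwa [h3, sub_zero] at h0

/-- The Koszul complex with coefficients is exact. -/
theorem IsCliffordTriple.isKoszulExact :
    IsKoszulExact a b (opX k M - NCConic.coeffOp nx) (opY k M - NCConic.coeffOp ny)
      (opZ M a b - NCConic.coeffOp nz) (opX k M + NCConic.coeffOp nx)
      (opY k M + NCConic.coeffOp ny) (opZ M a b + NCConic.coeffOp nz) := by
  have hK := h.isKoszulPair_coeffOp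
  have hK' : IsKoszulPair a b (opX k M + NCConic.coeffOp nx) (opY k M + NCConic.coeffOp ny)
      (opZ M a b + NCConic.coeffOp nz) (opX k M - NCConic.coeffOp nx)
      (opY k M - NCConic.coeffOp ny) (opZ M a b - NCConic.coeffOp nz) := by
    have := h.neg.isKoszulPair_coeffOp
    simpa only [coeffOp_neg, sub_neg_eq_add, ← sub_eq_add_neg] using this
  have hneg : (-nx) * (-ny) + (-ny) * (-nx) = 0 := by rw [neg_mul_neg, neg_mul_neg, h.xy]
  have hE : ∀ u w, (opX k M + NCConic.coeffOp nx) u + (opY k M + NCConic.coeffOp ny) w = 0 →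
      ∃ v, u = (opY k M - NCConic.coeffOp ny) v ∧ w = (opX k M - NCConic.coeffOp nx) v := by
    intro u w huw
    rw [opX_add, opY_add] at huw
    have := exists_of_add_eq_zero hneg u w huw
    simpa only [coeffOp_neg, ← sub_eq_add_neg] using this
  have hD := exists_of_add_eq_zero h.xy
  have hγ := h.exists_of_mem_sup
  have hy : ∀ u, (opY k M + NCConic.coeffOp ny) u = 0 → u = 0 := fun u hu => by
    rw [opY_add] at hu; exact opY_sub_injective _ _ hu
  have hinj := opX_sub_injective (M := M) nx
  refine ⟨hK, hK', hinj, ?_, ?_⟩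
  · intro v₁ v₂ v₃ e1 e2 e3
    rw [add_comm] at e3
    obtain ⟨w, rfl, rfl⟩ := hE _ _ e3
    have hyz := LinearMap.congr_fun hK'.yz w
    rw [LinearMap.add_apply, LinearMap.add_apply, LinearMap.smul_apply, Module.End.mul_apply,
      Module.End.mul_apply, Module.End.mul_apply, LinearMap.zero_apply] at hyz
    refine ⟨w, rfl, rfl, sub_eq_zero.1 (hy _ ?_)⟩
    rw [map_sub]
    linear_combination (norm := module) e1 - hyz
  · intro u₁ u₂ u₃ e
    have hu : (opZ M a b - NCConic.coeffOp nz) u₃ ∈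
        LinearMap.range (opX k M - NCConic.coeffOp nx) ⊔
          LinearMap.range (opY k M - NCConic.coeffOp ny) := by
      rw [eq_neg_of_add_eq_zero_right e]
      exact neg_mem (add_mem (Submodule.mem_sup_left ⟨_, rfl⟩) (Submodule.mem_sup_right ⟨_, rfl⟩))
    obtain ⟨_, ⟨v₂, rfl⟩, _, ⟨v₁, rfl⟩, rfl⟩ := Submodule.mem_sup.1 (hγ _ hu)
    have hyz := LinearMap.congr_fun hK.yz v₁
    have hxz := LinearMap.congr_fun hK.xz v₂
    rw [LinearMap.add_apply, LinearMap.add_apply, LinearMap.smul_apply, Module.End.mul_apply,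
      Module.End.mul_apply, Module.End.mul_apply, LinearMap.zero_apply] at hyz hxz
    set Dx := opX k M - NCConic.coeffOp nx
    set Dy := opY k M - NCConic.coeffOp ny
    set Dz := opZ M a b - NCConic.coeffOp nz
    set Ex := opX k M + NCConic.coeffOp nx
    set Ey := opY k M + NCConic.coeffOp ny
    set Ez := opZ M a b + NCConic.coeffOp nz
    obtain ⟨v₃, h1, h2⟩ := hD (u₁ - a • Ex v₁ - Ez v₂) (u₂ - Ez v₁ - b • Ey v₂) (by
      rw [map_add] at e
      simp only [map_sub, map_smul]
      linear_combination (norm := module) e - hyz - hxz)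
    refine ⟨v₁, v₂, v₃, ?_, ?_, by abel⟩
    · linear_combination (norm := module) h1
    · linear_combination (norm := module) h2

end Exactness

end Operators

end NCConic

namespace NCConic

/-! ### The algebras with relations `y z + z y + a x²`, `x z + z x + b y²`, `x y + y x` -/

section CliffordAlgebra

variable {k : Type u} [Field k]

/-- The potential whose derivatives are `a x² + y z + z y`, `b y² + x z + z x` and `x y + y x`. -/
def cliffordPotential (a b : k) : Potential k :=
  ![![![a, 0, 0], ![0, 0, 1], ![0, 1, 0]], ![![0, 0, 1], ![0, b, 0], ![1, 0, 0]],
    ![![0, 1, 0], ![1, 0, 0], ![0, 0, 0]]]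

theorem isSymmetric_of_swap {k : Type u} {ω : Potential k} (h1 : ∀ i j l, ω i j l = ω j i l)
    (h2 : ∀ i j l, ω i j l = ω i l j) : IsSymmetric ω := by
  intro σ v
  have hne : σ 0 ≠ σ 1 ∧ σ 0 ≠ σ 2 ∧ σ 1 ≠ σ 2 := by
    simp [σ.injective.eq_iff]
  generalize σ 0 = p, σ 1 = q, σ 2 = r at hne
  fin_cases p <;> fin_cases q <;> fin_cases r <;> simp at hne ⊢ <;> grind

theorem isSymmetric_cliffordPotential (a b : k) : IsSymmetric (cliffordPotential a b) := by
  refine isSymmetric_of_swap (fun i j l => ?_) fun i j l => ?_ <;>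
    fin_cases i <;> fin_cases j <;> fin_cases l <;> rfl

theorem isSuperpotential_cliffordPotential (a b : k) :
    IsSuperpotential (cliffordPotential a b) := by
  intro i j l
  fin_cases i <;> fin_cases j <;> fin_cases l <;> rfl

/-- An algebra map from `S` is a triple of elements that satisfy the three relations. -/
theorem derSpan_cliffordPotential_iff {A : Type u} [Ring A] [Algebra k A] (a b : k)
    (y : Fin 3 → A) : (∀ w ∈ derSpan (cliffordPotential a b), quadEval k y w = 0) ↔
      IsCliffordTriple a b (y 0) (y 1) (y 2) := by
  change _ ≤ LinearMap.ker (quadEval k y) ↔ _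
  rw [derSpan, Submodule.span_le, Set.range_subset_iff, Fin.forall_fin_succ, Fin.forall_fin_two]
  have e0 : quadEval k y (cliffordPotential a b 0) =
      y 1 * y 2 + y 2 * y 1 + a • (y 0 * y 0) := by
    simp [quadEval_apply, Fin.sum_univ_three, cliffordPotential]; abel
  have e1 : quadEval k y (cliffordPotential a b 1) =
      y 0 * y 2 + y 2 * y 0 + b • (y 1 * y 1) := by
    simp [quadEval_apply, Fin.sum_univ_three, cliffordPotential]; abel
  have e2 : quadEval k y (cliffordPotential a b 2) = y 0 * y 1 + y 1 * y 0 := by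
    simp [quadEval_apply, Fin.sum_univ_three, cliffordPotential]
  change quadEval k y (cliffordPotential a b 0) = 0 ∧ quadEval k y (cliffordPotential a b 1) = 0 ∧
    quadEval k y (cliffordPotential a b 2) = 0 ↔ _
  rw [e0, e1, e2]
  exact ⟨fun h => ⟨h.1, h.2.1, h.2.2⟩, fun h => ⟨h.yz, h.xz, h.xy⟩⟩

/-- The algebra with generators `x, y, z` and relations `y z + z y + a x²`, `x z + z x + b y²`,
`x y + y x`. -/
abbrev CliffordQuot (a b : k) : Type u := DerQuot (cliffordPotential a b)

variable (a b : k)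

/-- The generators `x, y, z`. -/
abbrev cliffordGen : Fin 3 → CliffordQuot a b := derGen (cliffordPotential a b)

theorem adjoin_cliffordGen : Algebra.adjoin k (Set.range (cliffordGen a b)) = ⊤ :=
  (derQuot_presentation _).adjoin_eq

theorem isCliffordTriple_gen :
    IsCliffordTriple a b (cliffordGen a b 0) (cliffordGen a b 1) (cliffordGen a b 2) :=
  (derSpan_cliffordPotential_iff a b _).1 (derQuot_presentation _).rel

theorem exists_cliffordLift {A : Type u} [Ring A] [Algebra k A] {y : Fin 3 → A}
    (h : IsCliffordTriple a b (y 0) (y 1) (y 2)) :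
    ∃ φ : CliffordQuot a b →ₐ[k] A, ∀ i, φ (cliffordGen a b i) = y i :=
  (derQuot_presentation _).lift A y ((derSpan_cliffordPotential_iff a b _).2 h)

/-- The operators of right multiplication by the generators in the basis `z^c x^i y^j`. -/
noncomputable def rightOp : Fin 3 → Module.End k (MonoModule k) :=
  ![opX k k, opY k k, opZ k a b]

/-- The representation of `S` by right multiplication on the basis `z^c x^i y^j`. -/
noncomputable def cliffordRep : CliffordQuot a b →ₐ[k] (Module.End k (MonoModule k))ᵐᵒᵖ :=
  (exists_cliffordLift a b (y := fun i => MulOpposite.op (rightOp a b i))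
    (isCliffordTriple_op k k a b).opposite).choose

theorem cliffordRep_gen (i : Fin 3) :
    cliffordRep a b (cliffordGen a b i) = MulOpposite.op (rightOp a b i) :=
  (exists_cliffordLift a b (y := fun i => MulOpposite.op (rightOp a b i))
    (isCliffordTriple_op k k a b).opposite).choose_spec i

/-- The coordinates of an element of `S` in the basis `z^c x^i y^j`. -/
noncomputable def coord : CliffordQuot a b →ₗ[k] MonoModule k where
  toFun s := (cliffordRep a b s).unop (Finsupp.single (0, 0, 0) 1)
  map_add' s t := by simp
  map_smul' r s := by simp

/-- The element `∑ u(c,i,j) z^c x^i y^j`. -/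
noncomputable def ofCoord : MonoModule k →ₗ[k] CliffordQuot a b :=
  Finsupp.lsum k fun p => LinearMap.toSpanSingleton k _
    (cliffordGen a b 2 ^ p.1 * (cliffordGen a b 0 ^ p.2.1 * cliffordGen a b 1 ^ p.2.2))

theorem ofCoord_single (c i j : ℕ) (r : k) : ofCoord a b (Finsupp.single (c, i, j) r) =
    r • (cliffordGen a b 2 ^ c * (cliffordGen a b 0 ^ i * cliffordGen a b 1 ^ j)) := by
  simp [ofCoord]

theorem coord_mul (s t : CliffordQuot a b) :
    coord a b (s * t) = (cliffordRep a b t).unop (coord a b s) := by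
  simp [coord]

theorem coord_mul_gen (s : CliffordQuot a b) (i : Fin 3) :
    coord a b (s * cliffordGen a b i) = rightOp a b i (coord a b s) := by
  rw [coord_mul, cliffordRep_gen, MulOpposite.unop_op]

theorem coord_one : coord a b 1 = Finsupp.single (0, 0, 0) 1 := by simp [coord]

theorem ofCoord_rightOp (i : Fin 3) (u : MonoModule k) :
    ofCoord a b (rightOp a b i u) = ofCoord a b u * cliffordGen a b i := by
  have h := isCliffordTriple_gen a b
  suffices ofCoord a b ∘ₗ rightOp a b i = LinearMap.mulRight k (cliffordGen a b i) ∘ₗ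
    ofCoord a b from LinearMap.congr_fun this u
  refine monoModule_ext fun c p q r => ?_
  simp only [LinearMap.comp_apply, LinearMap.mulRight_apply, ofCoord_single]
  fin_cases i
  · have e := pow_mul_of_anticomm (k := k) h.xy q
    simp only [rightOp, Fin.zero_eta, Matrix.cons_val_zero, opX_single, ofCoord_single,
      smul_mul_assoc, mul_assoc, e, mul_smul_comm, smul_smul, pow_succ, smul_eq_mul, mul_comm]
  · simp only [rightOp, Fin.mk_one, Matrix.cons_val_one, opY_single, ofCoord_single,
      smul_mul_assoc, mul_assoc, pow_succ, Matrix.cons_val_zero]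
  · have e := h.pow_mul_pow_mul p q
    rw [smul_mul_assoc, mul_assoc (_ ^ c)]
    change ofCoord a b (opZ k a b _) = r • (cliffordGen a b 2 ^ c *
      (cliffordGen a b 0 ^ p * cliffordGen a b 1 ^ q * cliffordGen a b 2))
    rw [e, opZ_single]
    split_ifs <;> simp only [map_sub, ofCoord_single, smul_eq_mul, mul_sub, smul_sub,
      mul_smul_comm, smul_smul, mul_comm r, pow_succ (cliffordGen a b 2) c, mul_assoc,
      sub_zero]

theorem ofCoord_cliffordRep (t : CliffordQuot a b) (u : MonoModule k) :
    ofCoord a b ((cliffordRep a b t).unop u) = ofCoord a b u * t := by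
  have ht : t ∈ Algebra.adjoin k (Set.range (cliffordGen a b)) := by
    rw [adjoin_cliffordGen]; trivial
  induction ht using Algebra.adjoin_induction generalizing u with
  | mem t ht =>
    obtain ⟨i, rfl⟩ := ht
    rw [cliffordRep_gen, MulOpposite.unop_op, ofCoord_rightOp]
  | algebraMap r => simp [Algebra.algebraMap_eq_smul_one]
  | add s t _ _ hs ht => simp [hs, ht, mul_add]
  | mul s t _ _ hs ht => simp [hs, ht, mul_assoc]

/-- The monomials `z^c x^i y^j` form a basis of `S`. -/
noncomputable def coordEquiv : CliffordQuot a b ≃ₗ[k] MonoModule k where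
  __ := coord a b
  invFun := ofCoord a b
  left_inv t := by
    have := ofCoord_cliffordRep a b t (Finsupp.single (0, 0, 0) 1)
    rw [ofCoord_single, pow_zero, pow_zero, pow_zero, one_mul, one_mul, one_smul, one_mul] at this
    exact this
  right_inv u := by
    suffices coord a b ∘ₗ ofCoord a b = LinearMap.id from LinearMap.congr_fun this u
    have hpow : ∀ (n : ℕ) (i : Fin 3) (s : CliffordQuot a b),
        coord a b (s * cliffordGen a b i ^ n) = (rightOp a b i ^ n) (coord a b s) := by
      intro n i s
      rw [coord_mul, map_pow, cliffordRep_gen, MulOpposite.unop_pow, MulOpposite.unop_op]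
    have hz : ∀ c, (opZ k a b ^ c) (Finsupp.single (0, 0, 0) (1 : k)) =
        Finsupp.single (c, 0, 0) 1 := by
      intro c
      induction c with
      | zero => rfl
      | succ c ih => rw [pow_succ', Module.End.mul_apply, ih, opZ_single]; simp
    have hx : ∀ c i, (opX k k ^ i) (Finsupp.single (c, 0, 0) (1 : k)) =
        Finsupp.single (c, i, 0) 1 := by
      intro c i
      induction i with
      | zero => rfl
      | succ i ih => rw [pow_succ', Module.End.mul_apply, ih, opX_single]; simp
    have hy : ∀ c i j, (opY k k ^ j) (Finsupp.single (c, i, 0) (1 : k)) =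
        Finsupp.single (c, i, j) 1 := by
      intro c i j
      induction j with
      | zero => rfl
      | succ j ih => rw [pow_succ', Module.End.mul_apply, ih, opY_single]
    refine monoModule_ext fun c i j r => ?_
    rw [LinearMap.comp_apply, ofCoord_single, map_smul, ← mul_assoc, hpow, hpow,
      ← one_mul (_ ^ c), hpow, coord_one]
    change r • (opY k k ^ j) ((opX k k ^ i) ((opZ k a b ^ c) _)) = _
    rw [hz, hx, hy, Finsupp.smul_single, smul_eq_mul, mul_one, LinearMap.id_apply]

theorem coordEquiv_symm_apply (u : MonoModule k) :
    (coordEquiv a b).symm u = ofCoord a b u := rfl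

/-- The antiautomorphism of `S` that fixes the generators. -/
noncomputable def reversal : CliffordQuot a b →ₐ[k] (CliffordQuot a b)ᵐᵒᵖ :=
  (exists_cliffordLift a b (y := fun i => MulOpposite.op (cliffordGen a b i))
    (isCliffordTriple_gen a b).opposite).choose

theorem reversal_gen (i : Fin 3) :
    reversal a b (cliffordGen a b i) = MulOpposite.op (cliffordGen a b i) :=
  (exists_cliffordLift a b (y := fun i => MulOpposite.op (cliffordGen a b i))
    (isCliffordTriple_gen a b).opposite).choose_spec i

theorem reversal_reversal (s : CliffordQuot a b) :
    (reversal a b (reversal a b s).unop).unop = s := by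
  have hs : s ∈ Algebra.adjoin k (Set.range (cliffordGen a b)) := by
    rw [adjoin_cliffordGen]; trivial
  induction hs using Algebra.adjoin_induction with
  | mem t ht =>
    obtain ⟨i, rfl⟩ := ht
    rw [reversal_gen, MulOpposite.unop_op, reversal_gen, MulOpposite.unop_op]
  | algebraMap r => simp
  | add s t _ _ hs ht => simp [hs, ht]
  | mul s t _ _ hs ht => simp [hs, ht]

/-- The antiautomorphism of `S` that fixes the generators, as an isomorphism with `Sᵐᵒᵖ`. -/
noncomputable def reversalEquiv : CliffordQuot a b ≃ₐ[k] (CliffordQuot a b)ᵐᵒᵖ :=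
  AlgEquiv.ofBijective (reversal a b) ⟨fun s t h => by
    rw [← reversal_reversal a b s, h, reversal_reversal],
    fun s => ⟨(reversal a b s.unop).unop,
      MulOpposite.unop_injective (reversal_reversal a b s.unop)⟩⟩

theorem opX_sq_mul_eq_zero {c : ℕ} {u : MonoModule k} (hu : ∀ i j, u (c, i, j) = 0) (i j : ℕ) :
    opX k k u (c, i, j) = 0 := by
  cases i with
  | zero =>
    have : (Finsupp.lapply (c, 0, j)) ∘ₗ opX k k = 0 := by
      refine monoModule_ext fun c' i' j' m => ?_
      simp [opX_single]
    exact LinearMap.congr_fun this u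
  | succ i => rw [opX_apply_succ, hu, smul_zero]

theorem opY_sq_mul_eq_zero {c : ℕ} {u : MonoModule k} (hu : ∀ i j, u (c, i, j) = 0) (i j : ℕ) :
    opY k k u (c, i, j) = 0 := by
  cases j with
  | zero =>
    have : (Finsupp.lapply (c, i, 0)) ∘ₗ opY k k = 0 := by
      refine monoModule_ext fun c' i' j' m => ?_
      simp [opY_single]
    exact LinearMap.congr_fun this u
  | succ j => rw [opY_apply_succ, hu]

theorem opZ_opZ_apply (u : MonoModule k) (c i j : ℕ) :
    opZ k a b (opZ k a b u) (c + 2, i, j) = u (c, i, j) := by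
  have h1 : ∀ n, ¬ Odd (2 * n) := fun n => by simp
  have h2 : ∀ n, Odd (2 * n + 1) := fun n => by simp
  have h3 : ∀ n, ¬ Odd (2 * n + 1 + 1) := fun n => by simp [parity_simps]
  have h4 : ∀ n, Odd (2 * n + 2 + 1) := fun n => by simp [parity_simps]
  have key : ∀ c i j (m : k), opZ k a b (opZ k a b (Finsupp.single (c, i, j) m)) =
      Finsupp.single (c + 2, i, j) m := by
    intro c i j m
    rw [opZ_single, map_sub, map_sub]
    rcases Nat.even_or_odd' i with ⟨i, rfl | rfl⟩ <;>
      rcases Nat.even_or_odd' j with ⟨j, rfl | rfl⟩ <;>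
      simp only [h1, h2, h3, h4, if_true, if_false, opZ_single, map_zero,
        Nat.add_sub_cancel] <;>
      simp [pow_succ, pow_add, add_assoc]
    rw [mul_left_comm]
    abel
  have : (Finsupp.lapply (c + 2, i, j)) ∘ₗ opZ k a b ∘ₗ opZ k a b =
      (Finsupp.lapply (c, i, j) : MonoModule k →ₗ[k] k) := by
    refine monoModule_ext fun c' i' j' m => ?_
    simp only [LinearMap.comp_apply, key, Finsupp.lapply_apply, Finsupp.single_apply,
      Prod.mk.injEq, add_left_inj]
  exact LinearMap.congr_fun this u

/-- The tensor `α x ⊗ x + β y ⊗ y + z ⊗ z`. -/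
def diagTensor (α β : k) : Fin 3 → Fin 3 → k :=
  ![![α, 0, 0], ![0, β, 0], ![0, 0, 1]]

theorem quadEval_diagTensor {A : Type u} [Ring A] [Algebra k A] (α β : k) (y : Fin 3 → A) :
    quadEval k y (diagTensor α β) = α • (y 0 * y 0) + β • (y 1 * y 1) + y 2 * y 2 := by
  simp [quadEval_apply, Fin.sum_univ_three, diagTensor]

/-- The element `α x² + β y² + z²` is central, and it is regular because in the basis `z^c x^i y^j` the
term `z²` shifts the coefficients of highest degree in `z`. -/
theorem isConicElement_diagTensor (α β : k) :
    IsConicElement (cliffordPotential a b)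
      (quadEval k (cliffordGen a b) (diagTensor α β)) := by
  have h := isCliffordTriple_gen a b
  set f := quadEval k (cliffordGen a b) (diagTensor α β) with hf
  have hf' := quadEval_diagTensor α β (cliffordGen a b)
  have hcomm : ∀ s, Commute s f := by
    have hgen : Set.range (cliffordGen a b) ⊆ Subalgebra.centralizer k {f} := by
      rintro _ ⟨i, rfl⟩
      rw [SetLike.mem_coe, Subalgebra.mem_centralizer_iff]
      rintro _ rfl
      rw [hf, hf']
      refine ((Commute.smul_left ?_ α).add_left (Commute.smul_left ?_ β)).add_left ?_ <;>
        fin_cases i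
      exacts [(Commute.refl _).mul_left (Commute.refl _), h.commute_xx_y, h.commute_xx_z,
        h.commute_yy_x, (Commute.refl _).mul_left (Commute.refl _), h.commute_yy_z,
        h.commute_zz_x, h.commute_zz_y, (Commute.refl _).mul_left (Commute.refl _)]
    intro s
    have := Algebra.adjoin_le hgen (adjoin_cliffordGen a b ▸ Algebra.mem_top : s ∈ _)
    rw [Subalgebra.mem_centralizer_iff] at this
    exact (this f rfl).symm
  have hinj : ∀ s, s * f = 0 → s = 0 := by
    intro s hs
    by_contra hne
    have hu : coord a b s ≠ 0 := fun h0 => hne ((coordEquiv a b).map_eq_zero_iff.1 h0)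
    obtain ⟨⟨c, i, j⟩, hp, hmax⟩ := Finset.exists_max_image (coord a b s).support (fun p => p.1)
      (Finsupp.support_nonempty_iff.2 hu)
    -- the coefficients of largest degree in `z` are shifted by `z²` and not changed by `x²`, `y²`
    have hz : ∀ p q, coord a b s (c + 2, p, q) = 0 := by
      intro p q
      by_contra h0
      have := hmax _ (Finsupp.mem_support_iff.2 h0)
      simp at this
    have h0 := congrArg (coord a b) hs
    rw [hf, hf', mul_add, mul_add, mul_smul_comm, mul_smul_comm, map_add, map_add, map_smul,
      map_smul, ← mul_assoc, ← mul_assoc, ← mul_assoc, coord_mul_gen, coord_mul_gen, coord_mul_gen,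
      coord_mul_gen, coord_mul_gen, coord_mul_gen, map_zero] at h0
    have h1 := DFunLike.congr_fun h0 (c + 2, i, j)
    have e1 : rightOp a b 0 (rightOp a b 0 (coord a b s)) (c + 2, i, j) = 0 :=
      opX_sq_mul_eq_zero (opX_sq_mul_eq_zero hz) i j
    have e2 : rightOp a b 1 (rightOp a b 1 (coord a b s)) (c + 2, i, j) = 0 :=
      opY_sq_mul_eq_zero (opY_sq_mul_eq_zero hz) i j
    have e3 : rightOp a b 2 (rightOp a b 2 (coord a b s)) (c + 2, i, j) = coord a b s (c, i, j) :=
      opZ_opZ_apply a b _ c i j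
    rw [Finsupp.add_apply, Finsupp.add_apply, Finsupp.smul_apply, Finsupp.smul_apply, e1, e2, e3,
      smul_zero, smul_zero, add_zero, zero_add] at h1
    exact Finsupp.mem_support_iff.1 hp h1
  refine ⟨?_, Subring.mem_center_iff.2 fun s => (hcomm s).eq, ?_⟩
  · rw [← range_quadEval]; exact ⟨_, rfl⟩
  · have hr : IsRightRegular f := fun s t (hst : s * f = t * f) =>
      sub_eq_zero.1 (hinj _ (by rw [sub_mul, hst, sub_self]))
    exact ⟨fun s t (hst : f * s = f * t) => hr (by
      show s * f = t * f
      rw [(hcomm s).eq, (hcomm t).eq, hst]), hr⟩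

/-! ### The grading -/

/-- The coordinate vectors of degree `m`. -/
def degSupport (m : ℕ) : Set (ℕ × ℕ × ℕ) := {p | p.1 + p.2.1 + p.2.2 = m}

theorem rightOp_mem_supported (i : Fin 3) {m : ℕ} {u : MonoModule k}
    (hu : u ∈ Finsupp.supported k k (degSupport m)) :
    rightOp a b i u ∈ Finsupp.supported k k (degSupport (m + 1)) := by
  suffices Finsupp.supported k k (degSupport m) ≤
    (Finsupp.supported k k (degSupport (m + 1))).comap (rightOp a b i) from this hu
  rw [Finsupp.supported_eq_span_single, Submodule.span_le]
  rintro _ ⟨⟨c, p, q⟩, h, rfl⟩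
  simp only [degSupport, Set.mem_ofPred_eq] at h
  rw [SetLike.mem_coe, Submodule.mem_comap]
  fin_cases i
  · change opX k k (Finsupp.single (c, p, q) 1) ∈ _
    rw [opX_single]
    exact Finsupp.single_mem_supported _ _ (by simp only [degSupport, Set.mem_ofPred_eq]; omega)
  · change opY k k (Finsupp.single (c, p, q) 1) ∈ _
    rw [opY_single]
    exact Finsupp.single_mem_supported _ _ (by simp only [degSupport, Set.mem_ofPred_eq]; omega)
  · change opZ k a b (Finsupp.single (c, p, q) 1) ∈ _
    rw [opZ_single]
    refine sub_mem (sub_mem (Finsupp.single_mem_supported _ _ ?_) ?_) ?_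
    · simp only [degSupport, Set.mem_ofPred_eq]; omega
    · split_ifs with ho
      · obtain ⟨p, rfl⟩ := ho
        exact Finsupp.single_mem_supported _ _ (by simp only [degSupport, Set.mem_ofPred_eq]; omega)
      · exact zero_mem _
    · split_ifs with ho
      · obtain ⟨q, rfl⟩ := ho
        exact Finsupp.single_mem_supported _ _ (by simp only [degSupport, Set.mem_ofPred_eq]; omega)
      · exact zero_mem _

/-- The degree `m` piece of `S` has the monomials of degree `m` as a basis. -/
theorem degPart_cliffordGen (m : ℕ) : degPart k (cliffordGen a b) m =
    (Finsupp.supported k k (degSupport m)).map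
      (coordEquiv a b).symm.toLinearMap := by
  apply le_antisymm
  · induction m with
    | zero =>
      rw [degPart, pow_zero, Submodule.one_le]
      refine ⟨Finsupp.single (0, 0, 0) 1, Finsupp.single_mem_supported _ _ rfl, ?_⟩
      rw [← coord_one a b]
      exact (coordEquiv a b).symm_apply_apply 1
    | succ m ih =>
      rw [degPart, pow_succ, Submodule.mul_le]
      intro s hs t ht
      obtain ⟨u, hu, rfl⟩ := ih hs
      induction ht using Submodule.span_induction with
      | mem t ht =>
        obtain ⟨i, rfl⟩ := ht
        exact ⟨_, rightOp_mem_supported a b i hu, ofCoord_rightOp a b i u⟩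
      | zero => rw [mul_zero]; exact zero_mem _
      | add s t _ _ hs ht => rw [mul_add]; exact add_mem hs ht
      | smul r s _ hs => rw [mul_smul_comm]; exact Submodule.smul_mem _ _ hs
  · rw [Submodule.map_le_iff_le_comap, Finsupp.supported_eq_span_single, Submodule.span_le]
    rintro _ ⟨⟨c, p, q⟩, h, rfl⟩
    simp only [degSupport, Set.mem_ofPred_eq] at h
    rw [SetLike.mem_coe, Submodule.mem_comap]
    change ofCoord a b (Finsupp.single (c, p, q) 1) ∈ _
    have hg : ∀ i n, cliffordGen a b i ^ n ∈ degPart k (cliffordGen a b) n := fun i n =>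
      Submodule.pow_mem_pow _ (Submodule.subset_span (Set.mem_range_self i)) n
    rw [ofCoord_single, one_smul, ← h, add_assoc, degPart, pow_add, pow_add]
    exact Submodule.mul_mem_mul (hg _ _) (Submodule.mul_mem_mul (hg _ _) (hg _ _))

/-- The exponents of the monomials of degree `m`. -/
def degFinset (m : ℕ) : Finset (ℕ × ℕ × ℕ) :=
  (Finset.range (m + 1)).biUnion fun l =>
    (Finset.range (l + 1)).image fun i => (m - l, i, l - i)

theorem coe_degFinset (m : ℕ) : (degFinset m : Set (ℕ × ℕ × ℕ)) = degSupport m := by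
  ext ⟨c, i, j⟩
  simp only [degFinset, Finset.mem_coe, Finset.mem_biUnion, Finset.mem_range, Finset.mem_image,
    degSupport, Set.mem_ofPred_eq, Prod.mk.injEq]
  constructor
  · rintro ⟨l, hl, i, hi, h1, rfl, h2⟩
    omega
  · intro h
    exact ⟨i + j, by omega, i, by omega, by omega, rfl, by omega⟩

theorem card_degFinset (m : ℕ) : (degFinset m).card = (2 + m).choose 2 := by
  rw [degFinset, Finset.card_biUnion]
  · have h : ∀ l, ((Finset.range (l + 1)).image fun i => (m - l, i, l - i)).card = l + 1 := by
      intro l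
      rw [Finset.card_image_of_injective _ fun i i' h => (Prod.mk.inj (Prod.mk.inj h).2).1,
        Finset.card_range]
    simp only [h]
    clear h
    induction m with
    | zero => rfl
    | succ m ih =>
      rw [Finset.sum_range_succ, ih, ← add_assoc 2 m 1, Nat.choose_succ_succ (2 + m) 1]
      simp
      omega
  · intro l hl l' hl' hne
    rw [Function.onFun, Finset.disjoint_left]
    simp only [Finset.mem_image, Finset.coe_range, Set.mem_Iio, Finset.mem_range] at hl hl' ⊢
    rintro _ ⟨i, h1, rfl⟩ ⟨i', h2, h3⟩
    simp only [Prod.mk.injEq] at h3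
    omega

theorem finrank_degPart_cliffordGen (m : ℕ) :
    Module.finrank k (degPart k (cliffordGen a b) m) = (2 + m).choose 2 ∧
      Module.Finite k (degPart k (cliffordGen a b) m) := by
  rw [degPart_cliffordGen, ← coe_degFinset]
  have e := (Finsupp.supportedEquivFinsupp (M := k) (R := k)
    (degFinset m : Set (ℕ × ℕ × ℕ))).symm.trans
    ((coordEquiv a b).symm.submoduleMap (Finsupp.supported k k (degFinset m : Set (ℕ × ℕ × ℕ))))
  refine ⟨?_, Module.Finite.equiv e⟩
  rw [← e.finrank_eq, Module.finrank_finsupp_self, ← card_degFinset]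
  simp

theorem isInternal_degPart_cliffordGen :
    DirectSum.IsInternal (degPart k (cliffordGen a b)) := by
  have hsup : ∀ s : Set ℕ, (⨆ m ∈ s, Finsupp.supported k k (degSupport m)) =
      Finsupp.supported k k (⋃ m ∈ s, degSupport m) := by
    intro s
    rw [Set.biUnion_eq_iUnion, Finsupp.supported_iUnion, iSup_subtype']
  refine DirectSum.isInternal_submodule_of_iSupIndep_of_iSup_eq_top ?_ ?_
  · have h : iSupIndep fun m => Finsupp.supported k k (degSupport m) := by
      intro m
      rw [show (⨆ j, ⨆ (_ : j ≠ m), Finsupp.supported k k (degSupport j)) = _ from hsup {j | j ≠ m}]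
      refine Finsupp.disjoint_supported_supported ?_
      rw [Set.disjoint_left]
      intro p hp hp'
      simp only [Set.mem_iUnion, degSupport, Set.mem_ofPred_eq] at hp hp'
      obtain ⟨j, hj, h⟩ := hp'
      exact hj (h.symm.trans hp)
    have := (iSupIndep_map_orderIso_iff
      (Submodule.orderIsoMapComap (coordEquiv a b).symm)).2 h
    convert this using 1
    ext1 m
    exact degPart_cliffordGen a b m
  · have h : (⨆ m, Finsupp.supported k k (degSupport m)) = ⊤ := by
      rw [← Finsupp.supported_iUnion, show (⋃ m, degSupport m) = Set.univ from
        Set.eq_univ_of_forall fun p => Set.mem_iUnion.2 ⟨_, rfl⟩, Finsupp.supported_univ]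
    rw [show degPart k (cliffordGen a b) = fun m => _ from funext (degPart_cliffordGen a b),
      ← Submodule.map_iSup, h, Submodule.map_top, LinearEquiv.range]

theorem hilbert_cliffordGen :
    PowerSeries.mk (fun m => (Module.finrank k (degPart k (cliffordGen a b) m) : ℤ)) *
      (1 - (PowerSeries.X : PowerSeries ℤ)) ^ 3 = 1 := by
  simp only [fun m => (finrank_degPart_cliffordGen a b m).1]
  exact PowerSeries.mk_add_choose_mul_one_sub_pow_eq_one ℤ 2

/-! ### The algebra is noetherian -/

/-- The polynomial algebra on the central elements `x²`, `y²`, `z²`. -/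
noncomputable def centralPoly :
    MvPolynomial (Fin 3) k →ₐ[k] Subalgebra.center k (CliffordQuot a b) :=
  MvPolynomial.aeval fun i => ⟨cliffordGen a b i * cliffordGen a b i, by
    have h := isCliffordTriple_gen a b
    have hgen : Set.range (cliffordGen a b) ⊆
        Subalgebra.centralizer k {cliffordGen a b i * cliffordGen a b i} := by
      rintro _ ⟨j, rfl⟩
      rw [SetLike.mem_coe, Subalgebra.mem_centralizer_iff]
      rintro _ rfl
      suffices Commute (cliffordGen a b i * cliffordGen a b i) (cliffordGen a b j) from this
      fin_cases i <;> fin_cases j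
      exacts [(Commute.refl _).mul_left (Commute.refl _), h.commute_xx_y, h.commute_xx_z,
        h.commute_yy_x, (Commute.refl _).mul_left (Commute.refl _), h.commute_yy_z,
        h.commute_zz_x, h.commute_zz_y, (Commute.refl _).mul_left (Commute.refl _)]
    rw [Subalgebra.mem_center_iff]
    intro s
    have := Algebra.adjoin_le hgen (adjoin_cliffordGen a b ▸ Algebra.mem_top : s ∈ _)
    rw [Subalgebra.mem_centralizer_iff] at this
    exact (this _ rfl).symm⟩

/-- The algebra is a finite module over `k[x², y², z²]`, which is mapped to its center. -/
theorem isNoetherianRing_cliffordQuot : IsNoetherianRing (CliffordQuot a b) := by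
  let _ : Algebra (MvPolynomial (Fin 3) k) (CliffordQuot a b) :=
    RingHom.toAlgebra' ((Subalgebra.center k (CliffordQuot a b)).val.comp
      (centralPoly a b) : MvPolynomial (Fin 3) k →+* CliffordQuot a b)
      fun p s => (Subalgebra.mem_center_iff.1 (centralPoly a b p).2 s).symm
  have hsmul : ∀ (p : MvPolynomial (Fin 3) k) (s : CliffordQuot a b),
      p • s = (centralPoly a b p : CliffordQuot a b) * s := fun p s => rfl
  have hX : ∀ i n, (centralPoly a b (MvPolynomial.X i ^ n) : CliffordQuot a b) =
      cliffordGen a b i ^ (2 * n) := by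
    intro i n
    rw [map_pow, centralPoly, MvPolynomial.aeval_X, pow_mul, pow_two]
    rfl
  have hcen : ∀ p s, Commute (centralPoly a b p : CliffordQuot a b) s := fun p s =>
    (Subalgebra.mem_center_iff.1 (centralPoly a b p).2 s).symm
  set G : Fin 2 × Fin 2 × Fin 2 → CliffordQuot a b := fun e =>
    cliffordGen a b 2 ^ (e.1 : ℕ) * (cliffordGen a b 0 ^ (e.2.1 : ℕ) *
      cliffordGen a b 1 ^ (e.2.2 : ℕ))
  have hspan : Submodule.span (MvPolynomial (Fin 3) k) (Set.range G) = ⊤ := by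
    rw [eq_top_iff]
    intro s _
    obtain ⟨u, rfl⟩ := (coordEquiv a b).symm.surjective s
    rw [coordEquiv_symm_apply]
    induction u using Finsupp.induction_linear with
    | zero => rw [map_zero]; exact zero_mem _
    | add u v hu hv => rw [map_add]; exact add_mem (hu trivial) (hv trivial)
    | single p r =>
      obtain ⟨c, i, j⟩ := p
      have hmem := Submodule.smul_mem (Submodule.span (MvPolynomial (Fin 3) k) (Set.range G))
        (MvPolynomial.C r * (MvPolynomial.X 2 ^ (c / 2) * (MvPolynomial.X 0 ^ (i / 2) *
          MvPolynomial.X 1 ^ (j / 2))))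
        (Submodule.subset_span (Set.mem_range_self ((⟨c % 2, Nat.mod_lt _ two_pos⟩,
          ⟨i % 2, Nat.mod_lt _ two_pos⟩, ⟨j % 2, Nat.mod_lt _ two_pos⟩) :
            Fin 2 × Fin 2 × Fin 2)))
      convert hmem using 1
      have hC : (centralPoly a b (MvPolynomial.C r) : CliffordQuot a b) = algebraMap k _ r := by
        rw [← MvPolynomial.algebraMap_eq, AlgHom.commutes]; rfl
      have split : ∀ (i : Fin 3) n, cliffordGen a b i ^ n =
          centralPoly a b (MvPolynomial.X i ^ (n / 2)) * cliffordGen a b i ^ (n % 2) := by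
        intro i n
        rw [hX, ← pow_add, Nat.div_add_mod]
      have h0 := (hcen (MvPolynomial.X 0 ^ (i / 2)) (cliffordGen a b 2 ^ (c % 2))).eq
      have h1 := (hcen (MvPolynomial.X 1 ^ (j / 2)) (cliffordGen a b 0 ^ (i % 2))).eq
      have h2 := (hcen (MvPolynomial.X 1 ^ (j / 2)) (cliffordGen a b 2 ^ (c % 2))).eq
      rw [ofCoord_single, hsmul, map_mul, map_mul, map_mul, split 2 c, split 0 i, split 1 j]
      simp only [MulMemClass.coe_mul, hC, G, Algebra.smul_def, mul_assoc]
      rw [← mul_assoc _ _ (cliffordGen a b 1 ^ (j % 2)), ← h1, mul_assoc,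
        ← mul_assoc (cliffordGen a b 2 ^ (c % 2)), ← h0, mul_assoc,
        ← mul_assoc (cliffordGen a b 2 ^ (c % 2)), ← h2, mul_assoc]
  have : Module.Finite (MvPolynomial (Fin 3) k) (CliffordQuot a b) :=
    ⟨⟨(Set.finite_range G).toFinset, by rw [Set.Finite.coe_toFinset, hspan]⟩⟩
  have hN : IsNoetherian (MvPolynomial (Fin 3) k) (CliffordQuot a b) :=
    isNoetherian_of_isNoetherianRing_of_finite _ _
  exact isNoetherian_of_tower (MvPolynomial (Fin 3) k) hN

theorem isNoetherianRing_op_cliffordQuot : IsNoetherianRing (CliffordQuot a b)ᵐᵒᵖ :=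
  have := isNoetherianRing_cliffordQuot a b
  isNoetherianRing_of_ringEquiv (CliffordQuot a b) (reversalEquiv a b).toRingEquiv

end CliffordAlgebra

end NCConic

namespace NCConic

/-! ### Dimension shifting -/

section DimensionShift

open CategoryTheory Abelian

variable {S : Type u} [Ring S]

theorem ofHom_comp_eq_zero {K P Q : Type u} [AddCommGroup K] [Module S K] [AddCommGroup P]
    [Module S P] [AddCommGroup Q] [Module S Q] {f : K →ₗ[S] P} {g : P →ₗ[S] Q}
    (hfg : Function.Exact f g) : ModuleCat.ofHom f ≫ ModuleCat.ofHom g = 0 :=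
  ModuleCat.hom_ext (LinearMap.ext hfg.apply_apply_eq_zero)

theorem shortExact_ofHom {K P Q : Type u} [AddCommGroup K] [Module S K] [AddCommGroup P]
    [Module S P] [AddCommGroup Q] [Module S Q] (f : K →ₗ[S] P) (g : P →ₗ[S] Q)
    (hf : Function.Injective f) (hg : Function.Surjective g) (hfg : Function.Exact f g) :
    (ShortComplex.mk (ModuleCat.ofHom f) (ModuleCat.ofHom g)
      (ofHom_comp_eq_zero hfg)).ShortExact :=
  ModuleCat.shortComplex_shortExact _ hfg hf hg

variable {X : ShortComplex (ModuleCat.{u} S)} (hX : X.ShortExact) [Projective X.X₂]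
  {Y : ModuleCat.{u} S}

theorem exists_extClass_comp_eq {n m : ℕ} (h : 1 + n = m) (y : Ext X.X₃ Y m) :
    ∃ x : Ext X.X₁ Y n, hX.extClass.comp x h = y := by
  refine Ext.contravariant_sequence_exact₃ hX Y y ?_ h
  exact Ext.eq_zero_of_hasProjectiveDimensionLT _ 1 (by omega)

theorem eq_zero_of_extClass_comp_eq_zero {n m : ℕ} (h : 1 + (n + 1) = m) (x : Ext X.X₁ Y (n + 1))
    (hx : hX.extClass.comp x h = 0) : x = 0 := by
  obtain ⟨x', rfl⟩ := Ext.contravariant_sequence_exact₁ hX Y x h hx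
  rw [Ext.eq_zero_of_hasProjectiveDimensionLT x' 1 (by omega), Ext.comp_zero]

omit [Projective X.X₂] in
theorem extClass_comp_mk₀_eq_zero_iff (φ : X.X₁ ⟶ Y) :
    hX.extClass.comp (Ext.mk₀ φ) (rfl : 1 + 0 = 1) = 0 ↔ ∃ ψ : X.X₂ ⟶ Y, X.f ≫ ψ = φ := by
  constructor
  · intro h
    obtain ⟨x', hx'⟩ := Ext.contravariant_sequence_exact₁ hX Y (Ext.mk₀ φ) rfl h
    obtain ⟨ψ, rfl⟩ := (Ext.mk₀_bijective _ _).2 x'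
    rw [Ext.mk₀_comp_mk₀] at hx'
    exact ⟨ψ, (Ext.mk₀_bijective _ _).1 hx'⟩
  · rintro ⟨ψ, rfl⟩
    rw [← Ext.mk₀_comp_mk₀]
    exact hX.extClass_comp_assoc _

end DimensionShift

/-! ### Koszul complexes of modules -/

section KoszulModule

variable {k : Type u} [Field k] {S : Type u} [Ring S] [Algebra k S]
  {N : Type u} [AddCommGroup N] [Module k N] [Module S N] [IsScalarTower k S N]

/-- The differential `w ↦ (dx w, dy w, dz w)`. -/
def koszulThree (dx dy dz : N →ₗ[S] N) : N →ₗ[S] N × N × N := dx.prod (dy.prod dz)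

/-- The differential
`(v₁, v₂, v₃) ↦ (a ex v₁ + ez v₂ + ey v₃, ez v₁ + b ey v₂ + ex v₃, ey v₁ + ex v₂)`. -/
def koszulTwo (a b : k) (ex ey ez : N →ₗ[S] N) : N × N × N →ₗ[S] N × N × N where
  toFun v := (a • ex v.1 + ez v.2.1 + ey v.2.2, ez v.1 + b • ey v.2.1 + ex v.2.2,
    ey v.1 + ex v.2.1)
  map_add' v w := by
    ext <;> simp <;> abel
  map_smul' s v := by
    have e : ∀ (c : k) (n : N), c • s • n = s • c • n := fun c n => smul_comm c s n
    ext <;> simp [e]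

/-- The differential `(u₁, u₂, u₃) ↦ dx u₁ + dy u₂ + dz u₃`. -/
def koszulOne (dx dy dz : N →ₗ[S] N) : N × N × N →ₗ[S] N := dx.coprod (dy.coprod dz)

variable {a b : k} {dx dy dz ex ey ez : N →ₗ[S] N}

theorem koszulOne_apply (u : N × N × N) :
    koszulOne dx dy dz u = dx u.1 + dy u.2.1 + dz u.2.2 := by
  simp [koszulOne, add_assoc]

variable (h : IsKoszulExact a b (dx.restrictScalars k) (dy.restrictScalars k)
    (dz.restrictScalars k) (ex.restrictScalars k) (ey.restrictScalars k) (ez.restrictScalars k))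
include h

theorem IsKoszulExact.koszulThree_injective : Function.Injective (koszulThree dx dy dz) :=
  (injective_iff_map_eq_zero _).2 fun w hw => h.inj w (congrArg Prod.fst hw)

theorem IsKoszulExact.exists_koszulThree (v : N × N × N) (hv : koszulTwo a b ex ey ez v = 0) :
    ∃ w, koszulThree dx dy dz w = v := by
  obtain ⟨w, h1, h2, h3⟩ := h.exact_two v.1 v.2.1 v.2.2 (congrArg Prod.fst hv)
    (congrArg (fun p => p.2.1) hv) (congrArg (fun p => p.2.2) hv)
  exact ⟨w, Prod.ext h1.symm (Prod.ext h2.symm h3.symm)⟩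

theorem IsKoszulExact.exists_koszulTwo (u : N × N × N) (hu : koszulOne dx dy dz u = 0) :
    ∃ v, koszulTwo a b ex ey ez v = u := by
  rw [koszulOne_apply] at hu
  obtain ⟨v₁, v₂, v₃, h1, h2, h3⟩ := h.exact_one u.1 u.2.1 u.2.2 hu
  exact ⟨(v₁, v₂, v₃), Prod.ext h1.symm (Prod.ext h2.symm h3.symm)⟩

theorem IsKoszulExact.koszulTwo_koszulThree (w : N) :
    koszulTwo a b ex ey ez (koszulThree dx dy dz w) = 0 := by
  have h1 := LinearMap.congr_fun h.pair'.yz w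
  have h2 := LinearMap.congr_fun h.pair'.xz w
  have h3 := LinearMap.congr_fun h.pair'.xy w
  simp only [LinearMap.add_apply, LinearMap.smul_apply, Module.End.mul_apply,
    LinearMap.restrictScalars_apply, LinearMap.zero_apply] at h1 h2 h3
  refine Prod.ext ?_ (Prod.ext ?_ ?_)
  · change a • ex (dx w) + ez (dy w) + ey (dz w) = 0
    rw [← h1]; abel
  · change ez (dx w) + b • ey (dy w) + ex (dz w) = 0
    rw [← h2]; abel
  · change ey (dx w) + ex (dy w) = 0
    rw [← h3]; abel

theorem IsKoszulExact.koszulOne_koszulTwo (v : N × N × N) :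
    koszulOne dx dy dz (koszulTwo a b ex ey ez v) = 0 := by
  have h1 := LinearMap.congr_fun h.pair.yz v.1
  have h2 := LinearMap.congr_fun h.pair.xz v.2.1
  have h3 := LinearMap.congr_fun h.pair.xy v.2.2
  simp only [LinearMap.add_apply, LinearMap.smul_apply, Module.End.mul_apply,
    LinearMap.restrictScalars_apply, LinearMap.zero_apply] at h1 h2 h3
  rw [koszulOne_apply]
  change dx (a • ex v.1 + ez v.2.1 + ey v.2.2) + dy (ez v.1 + b • ey v.2.1 + ex v.2.2) +
    dz (ey v.1 + ex v.2.1) = 0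
  have ex' : dx (a • ex v.1) = a • dx (ex v.1) := (dx.restrictScalars k).map_smul a _
  have ey' : dy (b • ey v.2.1) = b • dy (ey v.2.1) := (dy.restrictScalars k).map_smul b _
  simp only [map_add, ex', ey']
  linear_combination (norm := module) h1 + h2 + h3

section Resolution

open CategoryTheory Abelian

variable {Q : Type u} [AddCommGroup Q] [Module S Q] {ε : N →ₗ[S] Q}
  (hε : Function.Exact (koszulOne dx dy dz) ε)
include hε

omit h in
theorem exact_koszulOne_codRestrict :
    Function.Surjective ((koszulOne dx dy dz).codRestrict (LinearMap.ker ε)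
      fun u => hε.apply_apply_eq_zero u) := by
  rintro ⟨n, hn⟩
  obtain ⟨u, hu⟩ := (hε n).1 hn
  exact ⟨u, Subtype.ext hu⟩

omit h hε in
theorem exact_ker_subtype {P P' : Type u} [AddCommGroup P] [Module S P] [AddCommGroup P']
    [Module S P'] (f : P →ₗ[S] P') : Function.Exact (LinearMap.ker f).subtype f :=
  LinearMap.exact_subtype_ker_map f

omit hε in
theorem IsKoszulExact.koszulTwo_codRestrict_surjective :
    Function.Surjective ((koszulTwo a b ex ey ez).codRestrict
      (LinearMap.ker (koszulOne dx dy dz)) h.koszulOne_koszulTwo) := by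
  rintro ⟨u, hu⟩
  obtain ⟨v, hv⟩ := h.exists_koszulTwo u hu
  exact ⟨v, Subtype.ext hv⟩

omit hε in
theorem IsKoszulExact.exact_koszulThree :
    Function.Exact (koszulThree dx dy dz) ((koszulTwo a b ex ey ez).codRestrict
      (LinearMap.ker (koszulOne dx dy dz)) h.koszulOne_koszulTwo) := by
  intro v
  constructor
  · intro hv
    exact h.exists_koszulThree v (congrArg Subtype.val hv)
  · rintro ⟨w, rfl⟩
    exact Subtype.ext (h.koszulTwo_koszulThree w)

omit h in
theorem exact_ker_koszulOne :
    Function.Exact (LinearMap.ker (koszulOne dx dy dz)).subtype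
      ((koszulOne dx dy dz).codRestrict (LinearMap.ker ε)
        fun u => hε.apply_apply_eq_zero u) := by
  intro u
  constructor
  · intro hu
    exact ⟨⟨u, congrArg Subtype.val hu⟩, rfl⟩
  · rintro ⟨w, rfl⟩
    exact Subtype.ext w.2

/-- The Koszul complex is a projective resolution of length three of the cokernel `Q`. -/
theorem IsKoszulExact.hasProjectiveDimensionLE_three [Module.Projective S N]
    (hsurj : Function.Surjective ε) :
    HasProjectiveDimensionLE (ModuleCat.of S Q) 3 := by
  have hP : Projective (ModuleCat.of S N) := (IsProjective.iff_projective _).1 inferInstance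
  have hP3 : Projective (ModuleCat.of S (N × N × N)) :=
    (IsProjective.iff_projective _).1 inferInstance
  have h2 := shortExact_ofHom _ _ h.koszulThree_injective h.koszulTwo_codRestrict_surjective
    h.exact_koszulThree
  have h1 := shortExact_ofHom _ _ (Submodule.subtype_injective _) (exact_koszulOne_codRestrict hε)
    (exact_ker_koszulOne hε)
  have h0 := shortExact_ofHom _ _ (Submodule.subtype_injective _) hsurj (exact_ker_subtype ε)
  have d2 := h2.hasProjectiveDimensionLT_X₃ 1 (inferInstanceAs (HasProjectiveDimensionLT
    (ModuleCat.of S N) 1)) (inferInstanceAs (HasProjectiveDimensionLT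
    (ModuleCat.of S (N × N × N)) (1 + 1)))
  have d1 := h1.hasProjectiveDimensionLT_X₃ 2 d2 (inferInstanceAs (HasProjectiveDimensionLT
    (ModuleCat.of S (N × N × N)) (1 + 2)))
  exact h0.hasProjectiveDimensionLT_X₃ 3 d1 (inferInstanceAs (HasProjectiveDimensionLT
    (ModuleCat.of S N) (1 + 3)))

end Resolution

end KoszulModule

section Transport

variable {k : Type u} [Field k] {N N' : Type*} [AddCommGroup N] [Module k N] [AddCommGroup N']
  [Module k N']

theorem IsKoszulPair.of_equiv (e : N ≃ₗ[k] N') {a b : k} {dx dy dz ex ey ez : Module.End k N}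
    {dx' dy' dz' ex' ey' ez' : Module.End k N'} (h : IsKoszulPair a b dx' dy' dz' ex' ey' ez')
    (hdx : ∀ u, e (dx u) = dx' (e u)) (hdy : ∀ u, e (dy u) = dy' (e u))
    (hdz : ∀ u, e (dz u) = dz' (e u)) (hex : ∀ u, e (ex u) = ex' (e u))
    (hey : ∀ u, e (ey u) = ey' (e u)) (hez : ∀ u, e (ez u) = ez' (e u)) :
    IsKoszulPair a b dx dy dz ex ey ez := by
  constructor <;> ext u <;> apply e.injective
  · simpa [hdx, hdy, hdz, hex, hey, hez] using LinearMap.congr_fun h.yz (e u)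
  · simpa [hdx, hdy, hdz, hex, hey, hez] using LinearMap.congr_fun h.xz (e u)
  · simpa [hdx, hdy, hdz, hex, hey, hez] using LinearMap.congr_fun h.xy (e u)

theorem IsKoszulExact.of_equiv (e : N ≃ₗ[k] N') {a b : k} {dx dy dz ex ey ez : Module.End k N}
    {dx' dy' dz' ex' ey' ez' : Module.End k N'} (h : IsKoszulExact a b dx' dy' dz' ex' ey' ez')
    (hdx : ∀ u, e (dx u) = dx' (e u)) (hdy : ∀ u, e (dy u) = dy' (e u))
    (hdz : ∀ u, e (dz u) = dz' (e u)) (hex : ∀ u, e (ex u) = ex' (e u))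
    (hey : ∀ u, e (ey u) = ey' (e u)) (hez : ∀ u, e (ez u) = ez' (e u)) :
    IsKoszulExact a b dx dy dz ex ey ez where
  pair := h.pair.of_equiv e hdx hdy hdz hex hey hez
  pair' := h.pair'.of_equiv e hex hey hez hdx hdy hdz
  inj w hw := e.map_eq_zero_iff.1 (h.inj (e w) (by rw [← hdx, hw, map_zero]))
  exact_two v₁ v₂ v₃ h1 h2 h3 := by
    obtain ⟨w, e1, e2, e3⟩ := h.exact_two (e v₁) (e v₂) (e v₃)
      (by rw [← hex, ← hez, ← hey, ← map_smul, ← map_add, ← map_add, h1, map_zero])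
      (by rw [← hex, ← hez, ← hey, ← map_smul, ← map_add, ← map_add, h2, map_zero])
      (by rw [← hex, ← hey, ← map_add, h3, map_zero])
    obtain ⟨w, rfl⟩ := e.surjective w
    exact ⟨w, e.injective (by rw [e1, hdx]), e.injective (by rw [e2, hdy]),
      e.injective (by rw [e3, hdz])⟩
  exact_one u₁ u₂ u₃ hu := by
    obtain ⟨v₁, v₂, v₃, e1, e2, e3⟩ := h.exact_one (e u₁) (e u₂) (e u₃)
      (by rw [← hdx, ← hdy, ← hdz, ← map_add, ← map_add, hu, map_zero])
    obtain ⟨v₁, rfl⟩ := e.surjective v₁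
    obtain ⟨v₂, rfl⟩ := e.surjective v₂
    obtain ⟨v₃, rfl⟩ := e.surjective v₃
    refine ⟨v₁, v₂, v₃, e.injective ?_, e.injective ?_, e.injective ?_⟩
    · rw [e1, map_add, map_add, map_smul, hex, hez, hey]
    · rw [e2, map_add, map_add, map_smul, hex, hez, hey]
    · rw [e3, map_add, hey, hex]

end Transport

section CliffordModule

variable {k : Type u} [Field k] (a b : k)

/-- Right multiplication on `S`. -/
noncomputable abbrev mulRightGen (i : Fin 3) :
    CliffordQuot a b →ₗ[CliffordQuot a b] CliffordQuot a b :=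
  LinearMap.toSpanSingleton (CliffordQuot a b) (CliffordQuot a b) (cliffordGen a b i)

/-- The Koszul complex of `S` itself, given by right multiplication. With trivial coefficients the two
families of operators agree. -/
theorem isKoszulExact_mulRight : IsKoszulExact a b
    (LinearMap.mulRight k (cliffordGen a b 0)) (LinearMap.mulRight k (cliffordGen a b 1))
    (LinearMap.mulRight k (cliffordGen a b 2)) (LinearMap.mulRight k (cliffordGen a b 0))
    (LinearMap.mulRight k (cliffordGen a b 1)) (LinearMap.mulRight k (cliffordGen a b 2)) := by
  have h0 : IsCliffordTriple a b (0 : Module.End k k) 0 0 := ⟨by simp, by simp, by simp⟩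
  have h := h0.isKoszulExact
  simp only [coeffOp_zero, sub_zero, add_zero] at h
  exact h.of_equiv (coordEquiv a b) (fun u => coord_mul_gen a b u 0)
    (fun u => coord_mul_gen a b u 1)
    (fun u => coord_mul_gen a b u 2) (fun u => coord_mul_gen a b u 0)
    (fun u => coord_mul_gen a b u 1) (fun u => coord_mul_gen a b u 2)

/-- The antiautomorphism of `S` that fixes the generators, as a linear map. -/
noncomputable def reversalLinear : CliffordQuot a b ≃ₗ[k] CliffordQuot a b :=
  (reversalEquiv a b).toLinearEquiv.trans (MulOpposite.opLinearEquiv k).symm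

theorem reversalLinear_mul_gen (s : CliffordQuot a b) (i : Fin 3) :
    reversalLinear a b (s * cliffordGen a b i) = cliffordGen a b i * reversalLinear a b s := by
  change (reversal a b (s * cliffordGen a b i)).unop =
    cliffordGen a b i * (reversal a b s).unop
  rw [map_mul, reversal_gen]
  rfl

theorem reversalLinear_gen_mul (s : CliffordQuot a b) (i : Fin 3) :
    reversalLinear a b (cliffordGen a b i * s) = reversalLinear a b s * cliffordGen a b i := by
  change (reversal a b (cliffordGen a b i * s)).unop =
    (reversal a b s).unop * cliffordGen a b i
  rw [map_mul, reversal_gen]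
  rfl

theorem isKoszulExact_mulLeft : IsKoszulExact a b
    (LinearMap.mulLeft k (cliffordGen a b 0)) (LinearMap.mulLeft k (cliffordGen a b 1))
    (LinearMap.mulLeft k (cliffordGen a b 2)) (LinearMap.mulLeft k (cliffordGen a b 0))
    (LinearMap.mulLeft k (cliffordGen a b 1)) (LinearMap.mulLeft k (cliffordGen a b 2)) :=
  (isKoszulExact_mulRight a b).of_equiv (reversalLinear a b)
    (fun u => reversalLinear_gen_mul a b u 0) (fun u => reversalLinear_gen_mul a b u 1)
    (fun u => reversalLinear_gen_mul a b u 2) (fun u => reversalLinear_gen_mul a b u 0)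
    (fun u => reversalLinear_gen_mul a b u 1) (fun u => reversalLinear_gen_mul a b u 2)

end CliffordModule

/-! ### The global dimension is at most three -/

section TensorResolution

open TensorProduct

variable {k : Type u} [Field k] (a b : k) {M : Type u} [AddCommGroup M] [Module k M]

/-- The isomorphism of `S ⊗ M` with the module of polynomials with coefficients in `M`. -/
noncomputable def tensorCoord : CliffordQuot a b ⊗[k] M ≃ₗ[k] MonoModule M :=
  (TensorProduct.congr (coordEquiv a b) (LinearEquiv.refl k M)).trans
    (TensorProduct.finsuppScalarLeft k M (ℕ × ℕ × ℕ))

theorem tensorCoord_symm_single (p : ℕ × ℕ × ℕ) (m : M) :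
    (tensorCoord a b).symm (Finsupp.single p m) = ofCoord a b (Finsupp.single p 1) ⊗ₜ m := by
  rw [tensorCoord, LinearEquiv.trans_symm, LinearEquiv.trans_apply,
    TensorProduct.finsuppScalarLeft_symm_apply_single]
  rfl

theorem tensorCoord_symm_mapRange (u : MonoModule k) (m : M) :
    (tensorCoord a b).symm (Finsupp.mapRange.linearMap (LinearMap.toSpanSingleton k M m) u) =
      ofCoord a b u ⊗ₜ m := by
  suffices (tensorCoord a b).symm.toLinearMap ∘ₗ
      Finsupp.mapRange.linearMap (LinearMap.toSpanSingleton k M m) =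
      (TensorProduct.mk k (CliffordQuot a b) M).flip m ∘ₗ ofCoord a b from
    LinearMap.congr_fun this u
  refine monoModule_ext fun c i j r => ?_
  simp only [LinearMap.comp_apply, Finsupp.mapRange.linearMap_apply, Finsupp.mapRange_single,
    LinearEquiv.coe_coe, tensorCoord_symm_single, LinearMap.toSpanSingleton_apply,
    LinearMap.flip_apply, TensorProduct.mk_apply]
  rw [TensorProduct.tmul_smul, TensorProduct.smul_tmul', ← map_smul, Finsupp.smul_single,
    smul_eq_mul, mul_one]

variable (M) in
/-- The operators of right multiplication with coefficients in `M`. -/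
noncomputable def rightOpCoeff : Fin 3 → Module.End k (MonoModule M) :=
  ![opX k M, opY k M, opZ M a b]

theorem rightOpCoeff_mapRange (i : Fin 3) (u : MonoModule k) (m : M) :
    rightOpCoeff a b M i (Finsupp.mapRange.linearMap (LinearMap.toSpanSingleton k M m) u) =
      Finsupp.mapRange.linearMap (LinearMap.toSpanSingleton k M m) (rightOp a b i u) := by
  suffices rightOpCoeff a b M i ∘ₗ
      Finsupp.mapRange.linearMap (LinearMap.toSpanSingleton k M m) =
      Finsupp.mapRange.linearMap (LinearMap.toSpanSingleton k M m) ∘ₗ rightOp a b i from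
    LinearMap.congr_fun this u
  refine monoModule_ext fun c p q r => ?_
  simp only [LinearMap.comp_apply, Finsupp.mapRange.linearMap_apply, Finsupp.mapRange_single]
  fin_cases i
  · change opX k M _ = Finsupp.mapRange _ _ (opX k k _)
    rw [opX_single, opX_single, Finsupp.mapRange_single]
    simp [smul_smul]
  · change opY k M _ = Finsupp.mapRange _ _ (opY k k _)
    simp [opY_single]
  · change opZ M a b _ = Finsupp.mapRange.linearMap (LinearMap.toSpanSingleton k M m) (opZ k a b _)
    rw [opZ_single, opZ_single, map_sub, map_sub]
    split_ifs <;> simp [smul_smul, -Finsupp.single_mul]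

/-- Right multiplication by a generator on the first factor of `S ⊗ M`. -/
noncomputable def tensorRightGen (i : Fin 3) :
    CliffordQuot a b ⊗[k] M →ₗ[CliffordQuot a b] CliffordQuot a b ⊗[k] M :=
  TensorProduct.AlgebraTensorModule.map (mulRightGen a b i) LinearMap.id

/-- An endomorphism of `M`, acting on the second factor of `S ⊗ M`. -/
noncomputable def tensorCoeff (n : Module.End k M) :
    CliffordQuot a b ⊗[k] M →ₗ[CliffordQuot a b] CliffordQuot a b ⊗[k] M :=
  TensorProduct.AlgebraTensorModule.map LinearMap.id n

theorem tensorCoord_rightGen (i : Fin 3) (t : CliffordQuot a b ⊗[k] M) :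
    tensorCoord a b (tensorRightGen a b i t) = rightOpCoeff a b M i (tensorCoord a b t) := by
  induction t using TensorProduct.induction_on with
  | zero => simp
  | add s t hs ht => simp [hs, ht]
  | tmul s m =>
    obtain ⟨u, rfl⟩ := (coordEquiv a b).symm.surjective s
    rw [coordEquiv_symm_apply, ← tensorCoord_symm_mapRange, LinearEquiv.apply_symm_apply,
      rightOpCoeff_mapRange, ← LinearEquiv.eq_symm_apply, tensorCoord_symm_mapRange,
      tensorCoord_symm_mapRange, ofCoord_rightOp]
    rfl

theorem tensorCoord_coeff (n : Module.End k M) (t : CliffordQuot a b ⊗[k] M) :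
    tensorCoord a b (tensorCoeff a b n t) = coeffOp n (tensorCoord a b t) := by
  induction t using TensorProduct.induction_on with
  | zero => simp
  | add s t hs ht => simp [hs, ht]
  | tmul s m =>
    obtain ⟨u, rfl⟩ := (coordEquiv a b).symm.surjective s
    have e : coeffOp n (Finsupp.mapRange.linearMap (LinearMap.toSpanSingleton k M m) u) =
        Finsupp.mapRange.linearMap (LinearMap.toSpanSingleton k M (n m)) u := by
      ext p
      simp [coeffOp]
    rw [coordEquiv_symm_apply, ← tensorCoord_symm_mapRange, LinearEquiv.apply_symm_apply, e,
      ← LinearEquiv.eq_symm_apply, tensorCoord_symm_mapRange, tensorCoord_symm_mapRange]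
    rfl

variable [Module (CliffordQuot a b) M] [IsScalarTower k (CliffordQuot a b) M]

variable (M) in
/-- The action of a generator on a module. -/
noncomputable def actGen (i : Fin 3) : Module.End k M :=
  Algebra.lsmul k k M (cliffordGen a b i)

theorem isCliffordTriple_actGen :
    IsCliffordTriple a b (actGen a b M 0) (actGen a b M 1) (actGen a b M 2) := by
  have h := isCliffordTriple_gen a b
  constructor <;> simp only [actGen, ← map_mul, ← map_add, ← map_smul]
  exacts [by rw [h.yz, map_zero], by rw [h.xz, map_zero], by rw [h.xy, map_zero]]

/-- The action map `S ⊗ M → M`. -/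
noncomputable def tensorAct : CliffordQuot a b ⊗[k] M →ₗ[CliffordQuot a b] M :=
  TensorProduct.AlgebraTensorModule.lift
    { toFun := fun s => Algebra.lsmul k k M s
      map_add' := fun s t => by simp
      map_smul' := fun s t => by ext m; simp }

theorem tensorAct_tmul (s : CliffordQuot a b) (m : M) : tensorAct a b (s ⊗ₜ[k] m) = s • m := rfl

variable (M) in
/-- The differentials `s ⊗ m ↦ s x ⊗ m - s ⊗ x m`. -/
noncomputable def tensorSub (i : Fin 3) :
    CliffordQuot a b ⊗[k] M →ₗ[CliffordQuot a b] CliffordQuot a b ⊗[k] M :=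
  tensorRightGen a b i - tensorCoeff a b (actGen a b M i)

variable (M) in
/-- The differentials `s ⊗ m ↦ s x ⊗ m + s ⊗ x m`. -/
noncomputable def tensorAdd (i : Fin 3) :
    CliffordQuot a b ⊗[k] M →ₗ[CliffordQuot a b] CliffordQuot a b ⊗[k] M :=
  tensorRightGen a b i + tensorCoeff a b (actGen a b M i)

theorem tensorCoord_tensorSub (i : Fin 3) (t : CliffordQuot a b ⊗[k] M) :
    tensorCoord a b (tensorSub a b M i t) =
      (rightOpCoeff a b M i - coeffOp (actGen a b M i)) (tensorCoord a b t) := by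
  rw [tensorSub, LinearMap.sub_apply, map_sub, tensorCoord_rightGen, tensorCoord_coeff]
  rfl

theorem tensorCoord_tensorAdd (i : Fin 3) (t : CliffordQuot a b ⊗[k] M) :
    tensorCoord a b (tensorAdd a b M i t) =
      (rightOpCoeff a b M i + coeffOp (actGen a b M i)) (tensorCoord a b t) := by
  rw [tensorAdd, LinearMap.add_apply, map_add, tensorCoord_rightGen, tensorCoord_coeff]
  rfl

theorem isKoszulExact_tensor : IsKoszulExact a b
    ((tensorSub a b M 0).restrictScalars k) ((tensorSub a b M 1).restrictScalars k)
    ((tensorSub a b M 2).restrictScalars k) ((tensorAdd a b M 0).restrictScalars k)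
    ((tensorAdd a b M 1).restrictScalars k) ((tensorAdd a b M 2).restrictScalars k) :=
  (isCliffordTriple_actGen a b (M := M)).isKoszulExact.of_equiv (tensorCoord a b)
    (tensorCoord_tensorSub a b 0) (tensorCoord_tensorSub a b 1) (tensorCoord_tensorSub a b 2)
    (tensorCoord_tensorAdd a b 0) (tensorCoord_tensorAdd a b 1) (tensorCoord_tensorAdd a b 2)

theorem tensorAct_tensorSub (i : Fin 3) (t : CliffordQuot a b ⊗[k] M) :
    tensorAct a b (tensorSub a b M i t) = 0 := by
  induction t using TensorProduct.induction_on with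
  | zero => simp
  | add s t hs ht => simp [hs, ht]
  | tmul s m =>
    change tensorAct a b ((s * cliffordGen a b i) ⊗ₜ m - s ⊗ₜ (cliffordGen a b i • m)) = 0
    rw [map_sub, tensorAct_tmul, tensorAct_tmul, mul_smul, sub_self]

theorem tensorAct_eq_actMap (t : CliffordQuot a b ⊗[k] M) : tensorAct a b t =
    actMap (actGen a b M 0) (actGen a b M 1) (actGen a b M 2) (tensorCoord a b t) := by
  obtain ⟨u, rfl⟩ := (tensorCoord a b).symm.surjective t
  rw [LinearEquiv.apply_symm_apply]
  suffices (tensorAct a b).restrictScalars k ∘ₗ (tensorCoord a b).symm.toLinearMap =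
    actMap (actGen a b M 0) (actGen a b M 1) (actGen a b M 2) from LinearMap.congr_fun this u
  refine monoModule_ext fun c i j m => ?_
  rw [actMap_single, actGen, actGen, actGen, ← map_pow, ← map_pow, ← map_pow]
  change tensorAct a b ((tensorCoord a b).symm _) = cliffordGen a b 2 ^ c • cliffordGen a b 0 ^ i •
    cliffordGen a b 1 ^ j • m
  rw [tensorCoord_symm_single, tensorAct_tmul, ofCoord_single, one_smul, mul_smul, mul_smul]

/-- The Koszul complex on `S ⊗ M` resolves `M`. -/
theorem exists_koszulOne_tensor (t : CliffordQuot a b ⊗[k] M) (ht : tensorAct a b t = 0) :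
    ∃ u, koszulOne (tensorSub a b M 0) (tensorSub a b M 1) (tensorSub a b M 2) u = t := by
  rw [tensorAct_eq_actMap] at ht
  have h := mem_range_of_actMap_eq_zero (a := a) (b := b) _ ht
  obtain ⟨_, h', _, ⟨u₃, rfl⟩, h3⟩ := Submodule.mem_sup.1 h
  obtain ⟨_, ⟨u₁, rfl⟩, _, ⟨u₂, rfl⟩, rfl⟩ := Submodule.mem_sup.1 h'
  refine ⟨((tensorCoord a b).symm u₁, (tensorCoord a b).symm u₂, (tensorCoord a b).symm u₃),
    (tensorCoord a b).injective ?_⟩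
  rw [koszulOne_apply, map_add, map_add, tensorCoord_tensorSub, tensorCoord_tensorSub,
    tensorCoord_tensorSub, ← h3]
  simp only [LinearEquiv.apply_symm_apply]
  rfl

variable (M) in
theorem exact_koszulOne_tensor :
    Function.Exact (koszulOne (tensorSub a b M 0) (tensorSub a b M 1) (tensorSub a b M 2))
      (tensorAct a b) := by
  intro t
  constructor
  · exact exists_koszulOne_tensor a b t
  · rintro ⟨u, rfl⟩
    rw [koszulOne_apply, map_add, map_add, tensorAct_tensorSub, tensorAct_tensorSub,
      tensorAct_tensorSub, add_zero, add_zero]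

end TensorResolution

open CategoryTheory in
theorem globalDimension_cliffordQuot_le {k : Type u} [Field k] (a b : k) :
    globalDimension (CliffordQuot a b) ≤ 3 := by
  refine iSup_le fun M => (projectiveDimension_le_iff M 3).2 ?_
  let _ : Module k M := Module.restrictScalars k (CliffordQuot a b) M
  have _ : IsScalarTower k (CliffordQuot a b) M := IsScalarTower.restrictScalars k _ M
  exact (isKoszulExact_tensor a b (M := M)).hasProjectiveDimensionLE_three
    (exact_koszulOne_tensor a b M) fun m => ⟨1 ⊗ₜ m, by rw [tensorAct_tmul, one_smul]⟩

end NCConic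

namespace NCConic

/-! ### The Gorenstein condition -/

section Resolution

open CategoryTheory Abelian

variable {S : Type u} [Ring S] {K₀ K₁ P₀ P₁ P₂ P₃ T Y : ModuleCat.{u} S}
  {i₀ : K₀ ⟶ P₀} {p₀ : P₀ ⟶ T} {w₀ : i₀ ≫ p₀ = 0} (h₀ : (ShortComplex.mk i₀ p₀ w₀).ShortExact)
  {i₁ : K₁ ⟶ P₁} {p₁ : P₁ ⟶ K₀} {w₁ : i₁ ≫ p₁ = 0} (h₁ : (ShortComplex.mk i₁ p₁ w₁).ShortExact)
  {i₂ : P₃ ⟶ P₂} {p₂ : P₂ ⟶ K₁} {w₂ : i₂ ≫ p₂ = 0} (h₂ : (ShortComplex.mk i₂ p₂ w₂).ShortExact)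
  [hP₀ : Projective P₀] [hP₁ : Projective P₁] [hP₂ : Projective P₂]

include h₀ hP₀ in
theorem ext_one_eq_zero (hext : ∀ φ : K₀ ⟶ Y, ∃ ψ, i₀ ≫ ψ = φ) (y : Ext T Y 1) : y = 0 := by
  have : Projective (ShortComplex.mk i₀ p₀ w₀).X₂ := hP₀
  obtain ⟨x, rfl⟩ := exists_extClass_comp_eq h₀ (n := 0) rfl y
  obtain ⟨φ, rfl⟩ := (Ext.mk₀_bijective _ _).2 x
  exact (extClass_comp_mk₀_eq_zero_iff h₀ φ).2 (hext φ)

include h₀ h₁ hP₀ hP₁ in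
theorem ext_two_eq_zero (hext : ∀ φ : K₁ ⟶ Y, ∃ ψ, i₁ ≫ ψ = φ) (y : Ext T Y 2) : y = 0 := by
  have : Projective (ShortComplex.mk i₀ p₀ w₀).X₂ := hP₀
  obtain ⟨x, rfl⟩ := exists_extClass_comp_eq h₀ (n := 1) rfl y
  rw [ext_one_eq_zero h₁ hext x, Ext.comp_zero]

omit hP₀ hP₁ hP₂ in
/-- The iterated connecting map `Hom(P₃, Y) → Ext³(T, Y)` of a resolution
`0 → P₃ → P₂ → P₁ → P₀ → T → 0`. -/
noncomputable def extThreeMap (k : Type u) [Field k] [Algebra k S] (Y : ModuleCat.{u} S) :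
    (P₃ ⟶ Y) →ₗ[k] Ext T Y 3 where
  toFun φ := h₀.extClass.comp (h₁.extClass.comp (h₂.extClass.comp (Ext.mk₀ φ)
    (rfl : 1 + 0 = 1)) (rfl : 1 + 1 = 2)) (rfl : 1 + 2 = 3)
  map_add' φ ψ := by rw [Ext.mk₀_add, Ext.comp_add, Ext.comp_add, Ext.comp_add]
  map_smul' c φ := by
    rw [Ext.mk₀_smul, Ext.comp_smul, Ext.comp_smul, Ext.comp_smul, RingHom.id_apply]

include hP₀ hP₁ hP₂ in
theorem extThreeMap_surjective (k : Type u) [Field k] [Algebra k S] :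
    Function.Surjective (extThreeMap h₀ h₁ h₂ k Y) := by
  have : Projective (ShortComplex.mk i₀ p₀ w₀).X₂ := hP₀
  have : Projective (ShortComplex.mk i₁ p₁ w₁).X₂ := hP₁
  have : Projective (ShortComplex.mk i₂ p₂ w₂).X₂ := hP₂
  intro y
  obtain ⟨x, rfl⟩ := exists_extClass_comp_eq h₀ (n := 2) rfl y
  obtain ⟨z, rfl⟩ := exists_extClass_comp_eq h₁ (n := 1) rfl x
  obtain ⟨w, rfl⟩ := exists_extClass_comp_eq h₂ (n := 0) rfl z
  obtain ⟨φ, rfl⟩ := (Ext.mk₀_bijective _ _).2 w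
  exact ⟨φ, rfl⟩

omit hP₂ in
include hP₀ hP₁ in
/-- `Ext³(T, Y)` is the cokernel of `Hom(P₂, Y) → Hom(P₃, Y)`. -/
theorem extThreeMap_eq_zero_iff (k : Type u) [Field k] [Algebra k S] (φ : P₃ ⟶ Y) :
    extThreeMap h₀ h₁ h₂ k Y φ = 0 ↔ ∃ ψ, i₂ ≫ ψ = φ := by
  have : Projective (ShortComplex.mk i₀ p₀ w₀).X₂ := hP₀
  have : Projective (ShortComplex.mk i₁ p₁ w₁).X₂ := hP₁
  have h := extClass_comp_mk₀_eq_zero_iff h₂ φ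
  constructor
  · intro h0
    exact h.1 (eq_zero_of_extClass_comp_eq_zero h₁ (n := 0) rfl _
      (eq_zero_of_extClass_comp_eq_zero h₀ (n := 1) rfl _ h0))
  · intro h0
    rw [extThreeMap, LinearMap.coe_mk, AddHom.coe_mk]
    have := h.2 h0
    exact (congrArg (fun x => h₀.extClass.comp (h₁.extClass.comp x (rfl : 1 + 1 = 2))
      (rfl : 1 + 2 = 3)) this).trans (by
        change h₀.extClass.comp (h₁.extClass.comp 0 _) _ = 0
        rw [Ext.comp_zero, Ext.comp_zero])

end Resolution

section Gorenstein

open CategoryTheory Abelian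

variable {k : Type u} [Field k] (a b : k)

theorem isKoszulExact_mulRightGen : IsKoszulExact a b
    ((mulRightGen a b 0).restrictScalars k) ((mulRightGen a b 1).restrictScalars k)
    ((mulRightGen a b 2).restrictScalars k) ((mulRightGen a b 0).restrictScalars k)
    ((mulRightGen a b 1).restrictScalars k) ((mulRightGen a b 2).restrictScalars k) :=
  (isKoszulExact_mulRight a b).of_equiv (LinearEquiv.refl k _) (fun _ => rfl) (fun _ => rfl)
    (fun _ => rfl) (fun _ => rfl) (fun _ => rfl) fun _ => rfl

/-- The map `(u₁, u₂, u₃) ↦ u₁ x + u₂ y + u₃ z`. -/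
noncomputable abbrev genOne :
    CliffordQuot a b × CliffordQuot a b × CliffordQuot a b →ₗ[CliffordQuot a b]
    CliffordQuot a b :=
  koszulOne (mulRightGen a b 0) (mulRightGen a b 1) (mulRightGen a b 2)

/-- The second differential of the resolution of the trivial module. -/
noncomputable abbrev genTwo :
    CliffordQuot a b × CliffordQuot a b × CliffordQuot a b →ₗ[CliffordQuot a b]
    CliffordQuot a b × CliffordQuot a b × CliffordQuot a b :=
  koszulTwo a b (mulRightGen a b 0) (mulRightGen a b 1) (mulRightGen a b 2)

/-- The map `w ↦ (w x, w y, w z)`. -/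
noncomputable abbrev genThree : CliffordQuot a b →ₗ[CliffordQuot a b]
    CliffordQuot a b × CliffordQuot a b × CliffordQuot a b :=
  koszulThree (mulRightGen a b 0) (mulRightGen a b 1) (mulRightGen a b 2)

theorem genOne_apply (u : CliffordQuot a b × CliffordQuot a b × CliffordQuot a b) :
    genOne a b u = u.1 * cliffordGen a b 0 + u.2.1 * cliffordGen a b 1 +
      u.2.2 * cliffordGen a b 2 :=
  koszulOne_apply u

theorem genTwo_apply (v : CliffordQuot a b × CliffordQuot a b × CliffordQuot a b) :
    genTwo a b v =
      (a • (v.1 * cliffordGen a b 0) + v.2.1 * cliffordGen a b 2 + v.2.2 * cliffordGen a b 1,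
        v.1 * cliffordGen a b 2 + b • (v.2.1 * cliffordGen a b 1) + v.2.2 * cliffordGen a b 0,
        v.1 * cliffordGen a b 1 + v.2.1 * cliffordGen a b 0) :=
  rfl

theorem genThree_apply (w : CliffordQuot a b) :
    genThree a b w = (w * cliffordGen a b 0, w * cliffordGen a b 1, w * cliffordGen a b 2) :=
  rfl

theorem mul_gen_mem_range (s : CliffordQuot a b) (i : Fin 3) :
    s * cliffordGen a b i ∈ LinearMap.range (genOne a b) := by
  fin_cases i
  exacts [⟨(s, 0, 0), by simp [genOne_apply]⟩, ⟨(0, s, 0), by simp [genOne_apply]⟩,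
    ⟨(0, 0, s), by simp [genOne_apply]⟩]

/-- The left ideal generated by the elements of positive degree. -/
abbrev augIdeal : Ideal (CliffordQuot a b) :=
  Ideal.span {s : CliffordQuot a b | ∃ m, 1 ≤ m ∧ s ∈ degPart k (cliffordGen a b) m}

theorem augIdeal_eq_range : augIdeal a b = LinearMap.range (genOne a b) := by
  apply le_antisymm
  · rw [augIdeal, Ideal.span, Submodule.span_le]
    rintro s ⟨m, hm, hs⟩
    obtain ⟨m, rfl⟩ := Nat.exists_eq_add_of_le' hm
    rw [degPart, pow_succ] at hs
    suffices degPart k (cliffordGen a b) m * Submodule.span k (Set.range (cliffordGen a b)) ≤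
      (LinearMap.range (genOne a b)).restrictScalars k from this hs
    rw [Submodule.mul_le]
    intro s _ t ht
    induction ht using Submodule.span_induction with
    | mem t ht => obtain ⟨i, rfl⟩ := ht; exact mul_gen_mem_range a b s i
    | zero => rw [mul_zero]; exact zero_mem _
    | add t t' _ _ h h' => rw [mul_add]; exact add_mem h h'
    | smul c t _ h => rw [mul_smul_comm]; exact Submodule.smul_mem _ c h
  · rintro _ ⟨u, rfl⟩
    have hg : ∀ i, cliffordGen a b i ∈ augIdeal a b := fun i => Ideal.subset_span
      ⟨1, le_rfl, by rw [degPart, pow_one]; exact Submodule.subset_span ⟨i, rfl⟩⟩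
    rw [genOne_apply]
    exact add_mem (add_mem (Ideal.mul_mem_left _ _ (hg 0)) (Ideal.mul_mem_left _ _ (hg 1)))
      (Ideal.mul_mem_left _ _ (hg 2))

theorem exact_genOne : Function.Exact (genOne a b) (augIdeal a b).mkQ := by
  intro s
  rw [← LinearMap.mem_ker, Submodule.ker_mkQ, augIdeal_eq_range]
  rfl

/-- The constant coefficient. -/
noncomputable def augMap : CliffordQuot a b →ₗ[k] k := Finsupp.lapply (0, 0, 0) ∘ₗ coord a b

theorem augMap_one : augMap a b 1 = 1 := by simp [augMap, coord_one]

theorem augMap_mul_gen (s : CliffordQuot a b) (i : Fin 3) :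
    augMap a b (s * cliffordGen a b i) = 0 := by
  rw [augMap, LinearMap.comp_apply, coord_mul_gen, Finsupp.lapply_apply]
  suffices (Finsupp.lapply (0, 0, 0)) ∘ₗ rightOp a b i = 0 from LinearMap.congr_fun this _
  refine monoModule_ext fun c p q r => ?_
  fin_cases i
  · change opX k k _ _ = 0
    simp [opX_single]
  · change opY k k _ _ = 0
    simp [opY_single]
  · change opZ k a b _ _ = 0
    rw [opZ_single]
    split_ifs <;> simp

/-- The kernel of the augmentation is the left ideal generated by `x, y, z`. -/
theorem augMap_eq_zero_iff (s : CliffordQuot a b) :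
    augMap a b s = 0 ↔ s ∈ LinearMap.range (genOne a b) := by
  constructor
  · intro hs
    have key : ∀ u : MonoModule k, ofCoord a b u - u (0, 0, 0) • 1 ∈
        LinearMap.range (genOne a b) := by
      intro u
      induction u using Finsupp.induction_linear with
      | zero => simp
      | add u v hu hv =>
        rw [map_add, Finsupp.add_apply, add_smul, add_sub_add_comm]
        exact add_mem hu hv
      | single p r =>
        obtain ⟨c, i, j⟩ := p
        rw [ofCoord_single]
        have hsm : ∀ t, t ∈ LinearMap.range (genOne a b) → r • t ∈ LinearMap.range (genOne a b) :=
          fun t ht => ((LinearMap.range (genOne a b)).restrictScalars k).smul_mem r ht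
        rcases j with _ | j
        · rcases i with _ | i
          · rcases c with _ | c
            · simp
            · rw [Finsupp.single_eq_of_ne (by simp), zero_smul, sub_zero, pow_zero, pow_zero,
                mul_one, mul_one, pow_succ]
              exact hsm _ (mul_gen_mem_range a b _ 2)
          · rw [Finsupp.single_eq_of_ne (by simp), zero_smul, sub_zero, pow_zero,
              mul_one, pow_succ, ← mul_assoc]
            exact hsm _ (mul_gen_mem_range a b _ 0)
        · rw [Finsupp.single_eq_of_ne (by simp), zero_smul, sub_zero, pow_succ, ← mul_assoc,
            ← mul_assoc]
          exact hsm _ (mul_gen_mem_range a b _ 1)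
    have h := key (coord a b s)
    have e1 : ofCoord a b (coord a b s) = s := (coordEquiv a b).symm_apply_apply s
    have e2 : coord a b s (0, 0, 0) = 0 := hs
    rwa [e1, e2, zero_smul, sub_zero] at h
  · rintro ⟨u, rfl⟩
    rw [genOne_apply, map_add, map_add, augMap_mul_gen, augMap_mul_gen, augMap_mul_gen, add_zero,
      add_zero]

section Extension

variable {a b}

theorem linearMap_prod_apply {R : Type*} [Ring R] (φ : R × R × R →ₗ[R] R) (u : R × R × R) :
    φ u = u.1 * φ (1, 0, 0) + u.2.1 * φ (0, 1, 0) + u.2.2 * φ (0, 0, 1) := by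
  have e : u = u.1 • (1, 0, 0) + u.2.1 • (0, 1, 0) + u.2.2 • (0, 0, 1) := by
    ext <;> simp
  conv_lhs => rw [e, map_add, map_add, map_smul, map_smul, map_smul]
  rfl

/-- Exactness of the dual complex at the first place. -/
theorem exists_extension_ker_mkQ
    (φ : LinearMap.ker (augIdeal a b).mkQ →ₗ[CliffordQuot a b] CliffordQuot a b) :
    ∃ ψ : CliffordQuot a b →ₗ[CliffordQuot a b] CliffordQuot a b,
      ψ ∘ₗ (LinearMap.ker (augIdeal a b).mkQ).subtype = φ := by
  set q := (genOne a b).codRestrict (LinearMap.ker (augIdeal a b).mkQ)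
    fun u => (exact_genOne a b).apply_apply_eq_zero u with hq
  have hqs : Function.Surjective q := exact_koszulOne_codRestrict (exact_genOne a b)
  have h0 : ∀ v, (φ ∘ₗ q) (genTwo a b v) = 0 := fun v => by
    have : q (genTwo a b v) = 0 :=
      Subtype.ext ((isKoszulExact_mulRightGen a b).koszulOne_koszulTwo v)
    rw [LinearMap.comp_apply, this, map_zero]
  have e1 := h0 (1, 0, 0)
  have e2 := h0 (0, 1, 0)
  have e3 := h0 (0, 0, 1)
  rw [linearMap_prod_apply] at e1 e2 e3
  simp only [genTwo_apply, one_mul, zero_mul, smul_zero, add_zero, zero_add] at e1 e2 e3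
  obtain ⟨t, h1, h2, h3⟩ := (isKoszulExact_mulLeft a b).exact_two _ _ _
    (by simpa only [LinearMap.mulLeft_apply, smul_mul_assoc] using e1)
    (by simpa only [LinearMap.mulLeft_apply, smul_mul_assoc] using e2)
    (by simpa only [LinearMap.mulLeft_apply, smul_mul_assoc] using e3)
  rw [LinearMap.mulLeft_apply] at h1 h2 h3
  refine ⟨LinearMap.toSpanSingleton _ _ t, LinearMap.ext fun w => ?_⟩
  obtain ⟨u, rfl⟩ := hqs w
  change (genOne a b u) * t = (φ ∘ₗ q) u
  rw [linearMap_prod_apply (φ ∘ₗ q), h1, h2, h3, genOne_apply]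
  simp only [add_mul, mul_assoc]

/-- Exactness of the dual complex at the second place. -/
theorem exists_extension_ker_genOne
    (φ : LinearMap.ker (genOne a b) →ₗ[CliffordQuot a b] CliffordQuot a b) :
    ∃ ψ : CliffordQuot a b × CliffordQuot a b × CliffordQuot a b →ₗ[CliffordQuot a b]
      CliffordQuot a b, ψ ∘ₗ (LinearMap.ker (genOne a b)).subtype = φ := by
  have hK := isKoszulExact_mulRightGen a b
  set q := (genTwo a b).codRestrict (LinearMap.ker (genOne a b)) hK.koszulOne_koszulTwo with hq
  have hqs : Function.Surjective q := hK.koszulTwo_codRestrict_surjective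
  have h0 : (φ ∘ₗ q) (genThree a b 1) = 0 := by
    have : q (genThree a b 1) = 0 := Subtype.ext (hK.koszulTwo_koszulThree 1)
    rw [LinearMap.comp_apply, this, map_zero]
  rw [linearMap_prod_apply] at h0
  simp only [genThree_apply, one_mul] at h0
  obtain ⟨t₁, t₂, t₃, h1, h2, h3⟩ := (isKoszulExact_mulLeft a b).exact_one _ _ _ h0
  simp only [LinearMap.mulLeft_apply] at h1 h2 h3
  refine ⟨koszulOne (LinearMap.toSpanSingleton _ _ t₁) (LinearMap.toSpanSingleton _ _ t₂)
    (LinearMap.toSpanSingleton _ _ t₃), LinearMap.ext fun w => ?_⟩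
  obtain ⟨v, rfl⟩ := hqs w
  change koszulOne (LinearMap.toSpanSingleton (CliffordQuot a b) (CliffordQuot a b) t₁)
    (LinearMap.toSpanSingleton _ _ t₂) (LinearMap.toSpanSingleton _ _ t₃) (genTwo a b v) =
    (φ ∘ₗ q) v
  rw [linearMap_prod_apply (φ ∘ₗ q), h1, h2, h3, koszulOne_apply, genTwo_apply]
  simp only [LinearMap.toSpanSingleton_apply, smul_eq_mul, add_mul, mul_add, mul_assoc,
    smul_mul_assoc, mul_smul_comm]
  abel

/-- The cokernel at the last place of the dual complex. -/
theorem exists_comp_genThree_iff (s : CliffordQuot a b) :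
    (∃ ψ : CliffordQuot a b × CliffordQuot a b × CliffordQuot a b →ₗ[CliffordQuot a b]
      CliffordQuot a b, ψ ∘ₗ genThree a b = LinearMap.toSpanSingleton _ _ s) ↔
      augMap a b (reversalLinear a b s) = 0 := by
  have hrev : ∀ s, reversalLinear a b (reversalLinear a b s) = s := reversal_reversal a b
  rw [augMap_eq_zero_iff]
  constructor
  · rintro ⟨ψ, hψ⟩
    have h := LinearMap.congr_fun hψ 1
    rw [LinearMap.comp_apply, linearMap_prod_apply, genThree_apply,
      LinearMap.toSpanSingleton_apply, one_smul] at h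
    simp only [one_mul] at h
    rw [← h, map_add, map_add, reversalLinear_gen_mul, reversalLinear_gen_mul,
      reversalLinear_gen_mul]
    exact add_mem (add_mem (mul_gen_mem_range a b _ 0) (mul_gen_mem_range a b _ 1))
      (mul_gen_mem_range a b _ 2)
  · rintro ⟨u, hu⟩
    refine ⟨koszulOne (LinearMap.toSpanSingleton _ _ (reversalLinear a b u.1))
      (LinearMap.toSpanSingleton _ _ (reversalLinear a b u.2.1))
      (LinearMap.toSpanSingleton _ _ (reversalLinear a b u.2.2)), LinearMap.ext fun w => ?_⟩
    have hs : s = reversalLinear a b (genOne a b u) := by rw [hu, hrev]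
    rw [hs, genOne_apply, map_add, map_add, reversalLinear_mul_gen, reversalLinear_mul_gen,
      reversalLinear_mul_gen, LinearMap.comp_apply, koszulOne_apply, genThree_apply]
    simp only [LinearMap.toSpanSingleton_apply, smul_eq_mul, mul_add, mul_assoc]

end Extension

theorem shortExact_augIdeal : (ShortComplex.mk _ _
    (ofHom_comp_eq_zero (exact_ker_subtype (augIdeal a b).mkQ))).ShortExact :=
  shortExact_ofHom (LinearMap.ker (augIdeal a b).mkQ).subtype (augIdeal a b).mkQ
    (Submodule.subtype_injective _) (Submodule.mkQ_surjective _) (exact_ker_subtype _)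

theorem shortExact_genOne : (ShortComplex.mk _ _
    (ofHom_comp_eq_zero (exact_ker_koszulOne (exact_genOne a b)))).ShortExact :=
  shortExact_ofHom (LinearMap.ker (genOne a b)).subtype
    ((genOne a b).codRestrict (LinearMap.ker (augIdeal a b).mkQ)
      fun u => (exact_genOne a b).apply_apply_eq_zero u)
    (Submodule.subtype_injective _) (exact_koszulOne_codRestrict (exact_genOne a b))
    (exact_ker_koszulOne (exact_genOne a b))

theorem shortExact_genThree : (ShortComplex.mk _ _
    (ofHom_comp_eq_zero (isKoszulExact_mulRightGen a b).exact_koszulThree)).ShortExact :=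
  shortExact_ofHom (genThree a b) ((genTwo a b).codRestrict (LinearMap.ker (genOne a b))
      (isKoszulExact_mulRightGen a b).koszulOne_koszulTwo)
    (isKoszulExact_mulRightGen a b).koszulThree_injective
    (isKoszulExact_mulRightGen a b).koszulTwo_codRestrict_surjective
    (isKoszulExact_mulRightGen a b).exact_koszulThree

instance projective_cliffordQuot :
    Projective (ModuleCat.of (CliffordQuot a b) (CliffordQuot a b)) :=
  (IsProjective.iff_projective _).1 inferInstance

instance projective_cliffordQuot_cube : Projective (ModuleCat.of (CliffordQuot a b)
    (CliffordQuot a b × CliffordQuot a b × CliffordQuot a b)) :=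
  (IsProjective.iff_projective _).1 inferInstance

theorem ext_zero_eq_zero
    (y : Ext (ModuleCat.of (CliffordQuot a b) (CliffordQuot a b ⧸ augIdeal a b))
    (ModuleCat.of (CliffordQuot a b) (CliffordQuot a b)) 0) : y = 0 := by
  obtain ⟨φ, rfl⟩ := (Ext.mk₀_bijective _ _).2 y
  rw [Ext.mk₀_eq_zero_iff]
  have h1 : φ.hom ((augIdeal a b).mkQ 1) = 0 := by
    refine (isKoszulExact_mulLeft a b).inj _ ?_
    rw [LinearMap.mulLeft_apply, ← smul_eq_mul, ← map_smul, ← map_smul, smul_eq_mul, mul_one]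
    have : (augIdeal a b).mkQ (cliffordGen a b 0) = 0 :=
      (exact_genOne a b _).2 (by simpa using mul_gen_mem_range a b 1 0)
    rw [this, map_zero]
  refine ModuleCat.hom_ext (LinearMap.ext fun s => ?_)
  obtain ⟨s, rfl⟩ := Submodule.mkQ_surjective _ s
  change φ.hom _ = 0
  rw [← mul_one s, ← smul_eq_mul, map_smul, map_smul, h1, smul_zero]

/-- The isomorphism `Hom(S, S) ≅ S`. -/
noncomputable def endEquiv :
    CliffordQuot a b ≃ₗ[k] (ModuleCat.of (CliffordQuot a b) (CliffordQuot a b) ⟶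
    ModuleCat.of (CliffordQuot a b) (CliffordQuot a b)) where
  toFun s := ModuleCat.ofHom (LinearMap.toSpanSingleton _ _ s)
  invFun φ := φ.hom (1 : CliffordQuot a b)
  map_add' s t := ModuleCat.hom_ext (LinearMap.toSpanSingleton_add s t)
  map_smul' c s := by
    refine ModuleCat.hom_ext (LinearMap.ext fun t => ?_)
    change t * c • s = algebraMap k (CliffordQuot a b) c * (t * s)
    rw [mul_smul_comm, Algebra.smul_def]
  left_inv s := one_mul s
  right_inv φ := by
    refine ModuleCat.hom_ext (LinearMap.ext fun t => ?_)
    change t • φ.hom (1 : CliffordQuot a b) = φ.hom t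
    rw [← map_smul, smul_eq_mul, mul_one]

/-- The isomorphism `Ext³(k, S) ≅ k`. -/
noncomputable def extThreeEquiv :
    Ext (ModuleCat.of (CliffordQuot a b) (CliffordQuot a b ⧸ augIdeal a b))
      (ModuleCat.of (CliffordQuot a b) (CliffordQuot a b)) 3 ≃ₗ[k] k := by
  let F := extThreeMap (shortExact_augIdeal a b) (shortExact_genOne a b)
    (shortExact_genThree a b) k (ModuleCat.of (CliffordQuot a b) (CliffordQuot a b)) ∘ₗ
      (endEquiv a b).toLinearMap
  have hF : Function.Surjective F := (extThreeMap_surjective (shortExact_augIdeal a b)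
    (shortExact_genOne a b) (shortExact_genThree a b) k).comp (endEquiv a b).surjective
  have hker : LinearMap.ker F =
      LinearMap.ker (augMap a b ∘ₗ (reversalLinear a b).toLinearMap) := by
    ext s
    rw [LinearMap.mem_ker, LinearMap.mem_ker]
    change _ ↔ augMap a b (reversalLinear a b s) = 0
    rw [← exists_comp_genThree_iff]
    refine (extThreeMap_eq_zero_iff (shortExact_augIdeal a b)
      (shortExact_genOne a b) (shortExact_genThree a b) k (endEquiv a b s)).trans ?_
    constructor
    · rintro ⟨ψ, hψ⟩
      exact ⟨ψ.hom, congrArg ModuleCat.Hom.hom hψ⟩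
    · rintro ⟨ψ, hψ⟩
      exact ⟨ModuleCat.ofHom ψ, ModuleCat.hom_ext hψ⟩
  exact (F.quotKerEquivOfSurjective hF).symm.trans
    ((Submodule.quotEquivOfEq _ _ hker).trans
      ((augMap a b ∘ₗ (reversalLinear a b).toLinearMap).quotKerEquivOfSurjective fun c =>
        ⟨(reversalLinear a b).symm (c • 1), by
          change augMap a b (reversalLinear a b _) = c
          rw [LinearEquiv.apply_symm_apply, map_smul, augMap_one, smul_eq_mul, mul_one]⟩))

theorem isSymmetricRegularSuperpotential_cliffordPotential :
    IsSymmetricRegularSuperpotential (cliffordPotential a b) where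
  symmetric := isSymmetric_cliffordPotential a b
  superpotential := isSuperpotential_cliffordPotential a b
  regular := by
    have hext := extThreeEquiv a b
    have hnt : Nontrivial (CliffordQuot a b) := ⟨⟨1, 0, fun h => by
      have := augMap_one a b
      rw [h, map_zero] at this
      exact zero_ne_one this⟩⟩
    have hpd : HasProjectiveDimensionLE
        (ModuleCat.of (CliffordQuot a b) (CliffordQuot a b ⧸ augIdeal a b)) 3 :=
      (projectiveDimension_le_iff _ 3).1 ((le_iSup _ _).trans (globalDimension_cliffordQuot_le a b))
    exact
    { nontrivial := hnt
      gradedMonoid := Submodule.nat_power_gradedMonoid _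
      isInternal := isInternal_degPart_cliffordGen a b
      connected := pow_zero _
      locallyFinite := fun m => (finrank_degPart_cliffordGen a b m).2
      noetherian_left := isNoetherianRing_cliffordQuot a b
      noetherian_right := isNoetherianRing_op_cliffordQuot a b
      globalDimension_eq := by
        refine le_antisymm (globalDimension_cliffordQuot_le a b) ?_
        refine le_trans ?_ (le_iSup _ (ModuleCat.of (CliffordQuot a b)
          (CliffordQuot a b ⧸ augIdeal a b)))
        refine (projectiveDimension_ge_iff _ 3).2 fun h => ?_
        have h0 := Ext.eq_zero_of_hasProjectiveDimensionLT (hext.symm 1) 3 le_rfl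
        exact one_ne_zero (hext.symm.map_eq_zero_iff.1 h0)
      gorenstein_top := ⟨hext⟩
      gorenstein_ne := by
        intro i hi
        refine subsingleton_of_forall_eq 0 fun y => ?_
        change Ext (ModuleCat.of (CliffordQuot a b) (CliffordQuot a b ⧸ augIdeal a b))
          (ModuleCat.of (CliffordQuot a b) (CliffordQuot a b)) i at y
        rcases i with _ | _ | _ | i
        · exact ext_zero_eq_zero a b y
        · refine ext_one_eq_zero (shortExact_augIdeal a b) (fun φ => ?_) y
          obtain ⟨ψ, hψ⟩ := exists_extension_ker_mkQ φ.hom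
          exact ⟨ModuleCat.ofHom ψ, ModuleCat.hom_ext hψ⟩
        · refine ext_two_eq_zero (shortExact_augIdeal a b) (shortExact_genOne a b) (fun φ => ?_) y
          obtain ⟨ψ, hψ⟩ := exists_extension_ker_genOne φ.hom
          exact ⟨ModuleCat.ofHom ψ, ModuleCat.hom_ext hψ⟩
        · exact Ext.eq_zero_of_hasProjectiveDimensionLT y 4 (by omega)
      hilbert := hilbert_cliffordGen a b }

end Gorenstein

end NCConic

namespace NCConic

/-! ### The algebras `k[u, v]/(u² - a v - α, v² - b u - β)` -/

section PairQuot

variable {k : Type u} [Field k]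

/-- The algebra `k[u, v]/(u² - a v - α, v² - b u - β)`. -/
abbrev PairQuot (a b α β : k) : Type u :=
  MvPolynomial (Fin 2) k ⧸ Ideal.span {MvPolynomial.X 0 ^ 2 -
    (MvPolynomial.C a * MvPolynomial.X 1 + MvPolynomial.C α : MvPolynomial (Fin 2) k),
    MvPolynomial.X 1 ^ 2 - (MvPolynomial.C b * MvPolynomial.X 0 + MvPolynomial.C β)}

/-- Two commuting elements with `u² = a v + α` and `v² = b u + β` for which `1, u, v, u v` span
the algebra. -/
structure IsConicPair {C : Type v} [Ring C] [Algebra k C] (a b α β : k) (u v : C) : Prop where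
  sq_left : u * u = a • v + α • 1
  sq_right : v * v = b • u + β • 1
  span_eq : Submodule.span k (Set.range ![1, u, v, u * v]) = ⊤

theorem mem_span_four {C : Type v} [Ring C] [Algebra k C] (u v : C) (c₀ c₁ c₂ c₃ : k) :
    c₀ • 1 + c₁ • u + c₂ • v + c₃ • (u * v) ∈ Submodule.span k (Set.range ![1, u, v, u * v]) := by
  rw [Submodule.mem_span_range_iff_exists_fun]
  exact ⟨![c₀, c₁, c₂, c₃], by simp [Fin.sum_univ_four]⟩

/-- If `u² = a v + α`, `v² = b u + β` and `u, v` generate the algebra, then `1, u, v, u v` span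
it. -/
theorem isConicPair_of_adjoin {C : Type v} [CommRing C] [Algebra k C] {a b α β : k} {u v : C}
    (h1 : u * u = a • v + α • 1) (h2 : v * v = b • u + β • 1)
    (h : Algebra.adjoin k {u, v} = ⊤) : IsConicPair a b α β u v := by
  refine ⟨h1, h2, ?_⟩
  set W := Submodule.span k (Set.range ![1, u, v, u * v]) with hW
  have hmem := mem_span_four (k := k) u v
  have hmul : ∀ t, (∀ i, ![1, u, v, u * v] i * t ∈ W) → ∀ w ∈ W, w * t ∈ W := by
    intro t ht
    suffices W ≤ W.comap (LinearMap.mulRight k t) from fun w hw => this hw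
    rw [hW, Submodule.span_le, Set.range_subset_iff]
    exact ht
  have hu : ∀ w ∈ W, w * u ∈ W := hmul u fun i => by
    fin_cases i
    · convert hmem 0 1 0 0 using 1; simp
    · convert hmem α 0 a 0 using 1; change u * u = _; rw [h1]; simp [add_comm]
    · convert hmem 0 0 0 1 using 1; simp [mul_comm]
    · convert hmem (a * β) (a * b) α 0 using 1
      change u * v * u = _
      rw [mul_right_comm, h1, add_mul, smul_mul_assoc, h2, smul_add, smul_smul, smul_smul,
        smul_mul_assoc, one_mul, zero_smul]
      abel
  have hv : ∀ w ∈ W, w * v ∈ W := hmul v fun i => by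
    fin_cases i
    · convert hmem 0 0 1 0 using 1; simp
    · convert hmem 0 0 0 1 using 1; simp
    · convert hmem β b 0 0 using 1; change v * v = _; rw [h2]; simp [add_comm]
    · convert hmem (b * α) β (b * a) 0 using 1
      change u * v * v = _
      rw [mul_assoc, h2, mul_add, mul_smul_comm, h1, smul_add, smul_smul, smul_smul,
        mul_smul_comm, mul_one, zero_smul]
      abel
  rw [eq_top_iff]
  rintro t -
  have ht : t ∈ Algebra.adjoin k {u, v} := h ▸ Algebra.mem_top
  suffices ∀ w ∈ W, w * t ∈ W by
    have h1 := this 1 (by convert hmem 1 0 0 0 using 1; simp)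
    rwa [one_mul] at h1
  induction ht using Algebra.adjoin_induction with
  | mem t ht =>
    rcases ht with rfl | rfl
    exacts [hu, hv]
  | algebraMap r =>
    intro w hw
    rw [mul_comm, ← Algebra.smul_def]
    exact W.smul_mem r hw
  | add s t _ _ hs ht =>
    intro w hw
    rw [mul_add]
    exact add_mem (hs w hw) (ht w hw)
  | mul s t _ _ hs ht =>
    intro w hw
    rw [← mul_assoc]
    exact ht _ (hs w hw)

variable (a b α β : k)

/-- The generators `u, v`. -/
noncomputable abbrev pairGen (i : Fin 2) : PairQuot a b α β :=
  Ideal.Quotient.mk _ (MvPolynomial.X i)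

theorem isConicPair_pairGen :
    IsConicPair a b α β (pairGen a b α β 0) (pairGen a b α β 1) := by
  have hC : ∀ r, (Ideal.Quotient.mk _ (MvPolynomial.C r) : PairQuot a b α β) = r • 1 := fun r => by
    rw [← Algebra.algebraMap_eq_smul_one]
    rfl
  refine isConicPair_of_adjoin ?_ ?_ ?_
  · rw [Algebra.smul_def a, Algebra.algebraMap_eq_smul_one, ← hC, ← hC, ← map_mul, ← map_mul,
      ← map_add, ← pow_two, Ideal.Quotient.eq]
    exact Ideal.subset_span (Set.mem_insert _ _)
  · rw [Algebra.smul_def b, Algebra.algebraMap_eq_smul_one, ← hC, ← hC, ← map_mul, ← map_mul,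
      ← map_add, ← pow_two, Ideal.Quotient.eq]
    exact Ideal.subset_span (Set.mem_insert_of_mem _ rfl)
  · have h := congrArg (Subalgebra.map (Ideal.Quotient.mkₐ k (Ideal.span {MvPolynomial.X 0 ^ 2 -
      (MvPolynomial.C a * MvPolynomial.X 1 + MvPolynomial.C α : MvPolynomial (Fin 2) k),
      MvPolynomial.X 1 ^ 2 - (MvPolynomial.C b * MvPolynomial.X 0 + MvPolynomial.C β)})))
      (MvPolynomial.adjoin_range_X (R := k) (σ := Fin 2))
    rw [AlgHom.map_adjoin, Algebra.map_top, (AlgHom.range_eq_top _).2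
      (Ideal.Quotient.mkₐ_surjective _ _), ← Set.range_comp] at h
    rw [← h]
    congr 1
    ext t
    simp only [Set.mem_insert_iff, Set.mem_singleton_iff, Set.mem_range, Fin.exists_fin_two]
    exact or_congr eq_comm eq_comm

theorem finrank_pairQuot_le : Module.finrank k (PairQuot a b α β) ≤ 4 := by
  have h := (isConicPair_pairGen a b α β).span_eq
  have h2 := finrank_range_le_card (R := k)
    ![1, pairGen a b α β 0, pairGen a b α β 1, pairGen a b α β 0 * pairGen a b α β 1]
  rw [Set.finrank, h, finrank_top] at h2
  simpa using h2

instance : Module.Finite k (PairQuot a b α β) := by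
  rw [Module.finite_def, ← (isConicPair_pairGen a b α β).span_eq]
  exact Submodule.fg_span (Set.finite_range _)

variable {a b α β}

/-- A four dimensional algebra spanned by `1, u, v, u v` is the quotient of `k[u, v]`. -/
theorem IsConicPair.exists_algEquiv {C : Type v} [CommRing C] [Algebra k C] {u v : C}
    (h : IsConicPair a b α β u v) (hC : Module.finrank k C = 4) :
    Nonempty (PairQuot a b α β ≃ₐ[k] C) := by
  set F : MvPolynomial (Fin 2) k →ₐ[k] C := MvPolynomial.aeval ![u, v] with hF
  have hker : ∀ p ∈ Ideal.span {MvPolynomial.X 0 ^ 2 -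
      (MvPolynomial.C a * MvPolynomial.X 1 + MvPolynomial.C α : MvPolynomial (Fin 2) k),
      MvPolynomial.X 1 ^ 2 - (MvPolynomial.C b * MvPolynomial.X 0 + MvPolynomial.C β)},
      F p = 0 := by
    suffices Ideal.span {MvPolynomial.X 0 ^ 2 -
      (MvPolynomial.C a * MvPolynomial.X 1 + MvPolynomial.C α : MvPolynomial (Fin 2) k),
      MvPolynomial.X 1 ^ 2 - (MvPolynomial.C b * MvPolynomial.X 0 + MvPolynomial.C β)} ≤
      RingHom.ker F from fun p hp => this hp
    rw [Ideal.span_le]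
    rintro p (rfl | rfl)
    · simp [hF, RingHom.mem_ker, pow_two, h.sq_left, Algebra.smul_def]
    · simp [hF, RingHom.mem_ker, pow_two, h.sq_right, Algebra.smul_def]
  set φ : PairQuot a b α β →ₐ[k] C := Ideal.Quotient.liftₐ _ F hker with hφ
  have hu : φ (pairGen a b α β 0) = u := by
    change F (MvPolynomial.X 0) = u
    simp [hF]
  have hv : φ (pairGen a b α β 1) = v := by
    change F (MvPolynomial.X 1) = v
    simp [hF]
  have hsurj : Function.Surjective φ := by
    rw [← AlgHom.coe_toLinearMap, ← LinearMap.range_eq_top, eq_top_iff, ← h.span_eq,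
      Submodule.span_le, Set.range_subset_iff]
    intro i
    fin_cases i
    exacts [⟨1, map_one φ⟩, ⟨pairGen a b α β 0, hu⟩, ⟨pairGen a b α β 1, hv⟩,
      ⟨pairGen a b α β 0 * pairGen a b α β 1, by
        change φ (pairGen a b α β 0 * pairGen a b α β 1) = u * v
        rw [map_mul, hu, hv]⟩]
  have hfin : Module.Finite k C := Module.finite_of_finrank_pos (by omega)
  have hle := LinearMap.finrank_le_finrank_of_surjective (f := φ.toLinearMap) hsurj
  have hinj : Function.Injective φ :=
    (LinearMap.injective_iff_surjective_of_finrank_eq_finrank (f := φ.toLinearMap)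
      (by have := finrank_pairQuot_le a b α β; omega)).2 hsurj
  exact ⟨AlgEquiv.ofBijective φ ⟨hinj, hsurj⟩⟩

end PairQuot

/-! ### The algebra `C(A)` of the conics `z² + α x² + β y²` -/

section DiagonalConic

variable {k : Type u} [Field k] (a b α β : k)

theorem entry_two_eq_zero {w : Fin 3 → Fin 3 → k} (hw : w ∈ derSpan (cliffordPotential a b)) :
    w 2 2 = 0 := by
  induction hw using Submodule.span_induction with
  | mem w hw => obtain ⟨i, rfl⟩ := hw; fin_cases i <;> rfl
  | zero => rfl
  | add w w' _ _ h h' => rw [Pi.add_apply, Pi.add_apply, h, h', add_zero]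
  | smul c w _ h => rw [Pi.smul_apply, Pi.smul_apply, h, smul_zero]

theorem isConicTensor_diagTensor [NeZero (2 : k)] :
    IsConicTensor (cliffordPotential a b) (diagTensor α β) where
  cubic := (isSymmetricRegularSuperpotential_cliffordPotential a b).isNondegenerateCubic
  symm i j := by fin_cases i <;> fin_cases j <;> rfl
  notMem h := one_ne_zero (α := k) (entry_two_eq_zero a b h)

/-- The equations of `(R + k r)^⊥`, where `R + k r` is spanned by `a x² + y z + z y`,
`b y² + x z + z x`, `x y + y x` and `α x² + β y² + z²`. -/
theorem mem_perp_conicSpan_iff (w : Fin 3 → Fin 3 → k) :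
    w ∈ perp (conicSpan (cliffordPotential a b) (diagTensor α β)) ↔
      w 0 0 * a + w 1 2 + w 2 1 = 0 ∧ w 1 1 * b + w 0 2 + w 2 0 = 0 ∧ w 0 1 + w 1 0 = 0 ∧
        w 0 0 * α + w 1 1 * β + w 2 2 = 0 := by
  have key : w ∈ perp (conicSpan (cliffordPotential a b) (diagTensor α β)) ↔
      (∀ i, ∑ p, ∑ q, w p q * cliffordPotential a b i p q = 0) ∧
        ∑ p, ∑ q, w p q * diagTensor α β p q = 0 := by
    constructor
    · intro h
      exact ⟨fun i => h _ (Submodule.mem_sup_left (Submodule.subset_span ⟨i, rfl⟩)),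
        h _ (Submodule.mem_sup_right (Submodule.mem_span_singleton_self _))⟩
    · rintro ⟨h1, h2⟩
      let L : (Fin 3 → Fin 3 → k) →ₗ[k] k :=
        { toFun := fun r => ∑ p, ∑ q, w p q * r p q
          map_add' := fun r s => by simp [mul_add, Finset.sum_add_distrib]
          map_smul' := fun c r => by simp [Finset.mul_sum, mul_left_comm] }
      have : conicSpan (cliffordPotential a b) (diagTensor α β) ≤ LinearMap.ker L := by
        rw [conicSpan, derSpan, sup_le_iff, Submodule.span_le, Set.range_subset_iff,
          Submodule.span_singleton_le_iff_mem]
        exact ⟨h1, h2⟩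
      exact fun r hr => this hr
  rw [key, Fin.forall_fin_succ, Fin.forall_fin_two]
  have e0 : ∑ p, ∑ q, w p q * cliffordPotential a b 0 p q = w 0 0 * a + w 1 2 + w 2 1 := by
    simp [Fin.sum_univ_three, cliffordPotential]
  have e1 : ∑ p, ∑ q, w p q * cliffordPotential a b 1 p q = w 1 1 * b + w 0 2 + w 2 0 := by
    simp [Fin.sum_univ_three, cliffordPotential]
    ring
  have e2 : ∑ p, ∑ q, w p q * cliffordPotential a b 2 p q = w 0 1 + w 1 0 := by
    simp [Fin.sum_univ_three, cliffordPotential]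
  have e3 : ∑ p, ∑ q, w p q * diagTensor α β p q = w 0 0 * α + w 1 1 * β + w 2 2 := by
    simp [Fin.sum_univ_three, diagTensor]
  change (∑ p, ∑ q, w p q * cliffordPotential a b 0 p q = 0 ∧
    ∑ p, ∑ q, w p q * cliffordPotential a b 1 p q = 0 ∧
    ∑ p, ∑ q, w p q * cliffordPotential a b 2 p q = 0) ∧ _ ↔ _
  rw [e0, e1, e2, e3, and_assoc, and_assoc]

/-- The tensor `z ⊗ z`. -/
def squareTensor : Fin 3 → Fin 3 → k := ![![0, 0, 0], ![0, 0, 0], ![0, 0, 1]]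

theorem squareTensor_mem_perp :
    (squareTensor : Fin 3 → Fin 3 → k) ∈ perp (derSpan (cliffordPotential a b)) := by
  intro w hw
  simp [squareTensor, Fin.sum_univ_three, entry_two_eq_zero a b hw]

theorem squareTensor_notMem_perp :
    (squareTensor : Fin 3 → Fin 3 → k) ∉
      perp (conicSpan (cliffordPotential a b) (diagTensor α β)) := by
  rw [mem_perp_conicSpan_iff]
  simp [squareTensor]

variable [NeZero (2 : k)]

omit [NeZero (2 : k)] in
variable {a b α β} in
/-- If the relations of `A^!` are `X² = a Y Z + α Z²` and `Y² = b X Z + β Z²`, and `f^! = Z²`, then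
`X Z / Z²` and `Y Z / Z²` generate `C(A)`. -/
theorem IsConicDualAlgebra.exists_isConicPair {ω : Potential k} {B : Type u} [Ring B] [Algebra k B]
    {x : Fin 3 → B} {g : Subring.center B} (h : IsConicDualAlgebra ω x g)
    (hg : (g : B) = x 2 * x 2) (h0 : x 0 * x 0 = a • (x 1 * x 2) + α • (x 2 * x 2))
    (h1 : x 1 * x 1 = b • (x 0 * x 2) + β • (x 2 * x 2)) :
    ∃ u v : degreeZeroLoc k x g h.mem, IsConicPair a b α β u v := by
  let q (i j : Fin 3) : degPart k x 2 :=
    ⟨x i * x j, degPart_mul_mem (gen_mem_degPart x i) (gen_mem_degPart x j)⟩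
  have hq (i j : Fin 3) : (q i j : B) = x i * x j := rfl
  have hc (i j : Fin 3) : q i j = q j i := Subtype.ext (h.mul_comm _ _)
  have h00 : q 0 0 = a • q 1 2 + α • q 2 2 := Subtype.ext h0
  have h11 : q 1 1 = b • q 0 2 + β • q 2 2 := Subtype.ext h1
  have h22 : h.divDual (q 2 2) = 1 := by
    rw [← h.divDual_self]
    congr 1
    exact Subtype.ext hg.symm
  have hmul (i j : Fin 3) : h.divDual (q i 2) * h.divDual (q j 2) = h.divDual (q i j) := by
    apply h.divDual_mul
    rw [hq, hq, hq, hg, mul_assoc, ← mul_assoc (x 2), h.mul_comm (x 2) (x j), mul_assoc (x j),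
      ← mul_assoc, h.mul_comm]
  refine ⟨h.divDual (q 0 2), h.divDual (q 1 2), ?_, ?_, ?_⟩
  · rw [hmul, h00, map_add, map_smul, map_smul, h22]
  · rw [hmul, h11, map_add, map_smul, map_smul, h22]
  · rw [hmul, eq_top_iff]
    intro c _
    obtain ⟨⟨d, hd⟩, rfl⟩ := h.divDual_surjective c
    have hd' := hd
    rw [← range_quadEval] at hd'
    obtain ⟨w, hw⟩ := hd'
    have e : (⟨d, hd⟩ : degPart k x 2) = ∑ i, ∑ j, w i j • q i j := by
      apply Subtype.ext
      simp only [Submodule.coe_sum, Submodule.coe_smul, hq]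
      rw [← hw, quadEval_apply]
    rw [e, map_sum]
    refine sum_mem fun i _ => ?_
    rw [map_sum]
    refine sum_mem fun j _ => ?_
    rw [map_smul]
    refine Submodule.smul_mem _ _ ?_
    have m (i : Fin 4) := Submodule.subset_span (R := k) (Set.mem_range_self (f :=
      ![1, h.divDual (q 0 2), h.divDual (q 1 2), h.divDual (q 0 1)]) i)
    fin_cases i <;> fin_cases j
    · change h.divDual (q 0 0) ∈ _
      rw [h00, map_add, map_smul, map_smul, h22]
      exact add_mem (Submodule.smul_mem _ _ (m 2)) (Submodule.smul_mem _ _ (m 0))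
    · exact m 3
    · exact m 1
    · change h.divDual (q 1 0) ∈ _
      rw [hc 1 0]; exact m 3
    · change h.divDual (q 1 1) ∈ _
      rw [h11, map_add, map_smul, map_smul, h22]
      exact add_mem (Submodule.smul_mem _ _ (m 1)) (Submodule.smul_mem _ _ (m 0))
    · exact m 2
    · change h.divDual (q 2 0) ∈ _
      rw [hc 2 0]; exact m 1
    · change h.divDual (q 2 1) ∈ _
      rw [hc 2 1]; exact m 2
    · change h.divDual (q 2 2) ∈ _
      rw [h22]; exact m 0

theorem exists_isConicPair_degreeZeroLoc :
    ∃ (g : Subring.center (ConicDual (cliffordPotential a b) (diagTensor α β)))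
      (hg : IsDualElement (quadEval k (cliffordGen a b) (diagTensor α β)) g)
      (u v : AlgebraC _ g hg), IsConicPair a b α β u v := by
  have hr := isConicTensor_diagTensor a b α β
  have hg := hr.isDualElement (squareTensor_mem_perp a b) (squareTensor_notMem_perp a b α β)
  have hrel := (conicDual_presentation (cliffordPotential a b) (diagTensor α β)).rel
  refine ⟨_, hg, (hr.isConicDualAlgebra hg).exists_isConicPair ?_ ?_ ?_⟩
  · change quadEval k (conicDualGen (cliffordPotential a b) (diagTensor α β)) squareTensor = _
    simp [quadEval_apply, Fin.sum_univ_three, squareTensor]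
  · have := hrel ![![1, 0, 0], ![0, 0, -a], ![0, 0, -α]]
      ((mem_perp_conicSpan_iff a b α β _).2 (by simp))
    simp [quadEval_apply, Fin.sum_univ_three] at this
    rw [← sub_eq_zero, ← this]
    abel
  · have := hrel ![![0, 0, -b], ![0, 1, 0], ![0, 0, -β]]
      ((mem_perp_conicSpan_iff a b α β _).2 (by simp))
    simp [quadEval_apply, Fin.sum_univ_three] at this
    rw [← sub_eq_zero, ← this]
    abel

/-- The algebras `k[u, v]/(u² - a v - α, v² - b u - β)` are algebras `C(A)`. -/
theorem exists_algEquiv_algebraC :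
    ∃ (g : Subring.center (ConicDual (cliffordPotential a b) (diagTensor α β)))
      (hg : IsDualElement (quadEval k (cliffordGen a b) (diagTensor α β)) g),
      Nonempty (PairQuot a b α β ≃ₐ[k] AlgebraC _ g hg) := by
  obtain ⟨g, hg, u, v, huv⟩ := exists_isConicPair_degreeZeroLoc a b α β
  refine ⟨g, hg, ?_⟩
  have h := (isConicTensor_diagTensor a b α β).isConicDualAlgebra hg
  let _ : CommRing (AlgebraC _ g hg) := commRingOfComm h.degreeZeroLoc_mul_comm
  exact huv.exists_algEquiv h.finrank_degreeZeroLoc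

/-- The dimension is four because the algebra is isomorphic to an algebra `C(A)`. -/
theorem finrank_pairQuot : Module.finrank k (PairQuot a b α β) = 4 := by
  obtain ⟨g, hg, ⟨e⟩⟩ := exists_algEquiv_algebraC a b α β
  rw [e.toLinearEquiv.finrank_eq]
  exact ((isConicTensor_diagTensor a b α β).isConicDualAlgebra hg).finrank_degreeZeroLoc

variable {a b α β} in
theorem isAlgebraCOfSymmetricConic_of_algEquiv {B : Type v} [Ring B] [Algebra k B]
    (e : B ≃ₐ[k] PairQuot a b α β) : IsAlgebraCOfSymmetricConic k B := by
  obtain ⟨g, hg, ⟨e'⟩⟩ := exists_algEquiv_algebraC a b α β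
  exact ⟨_, _, g, hg, isSymmetricRegularSuperpotential_cliffordPotential a b,
    isConicElement_diagTensor a b α β, ⟨e.trans e'⟩⟩

end DiagonalConic

end NCConic

namespace NCConic

/-! ### Truncated polynomial algebras -/

section TruncPoly

variable {k : Type u} [Field k]

/-- The class `ε` of `u` in `k[u]/(u^m)`. -/
noncomputable abbrev truncGen (k : Type u) [Field k] (m : ℕ) : TruncPoly k m :=
  Ideal.Quotient.mk _ Polynomial.X

theorem truncGen_pow (m : ℕ) : truncGen k m ^ m = 0 := by
  rw [← map_pow, Ideal.Quotient.eq_zero_iff_mem]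
  exact Ideal.mem_span_singleton_self _

theorem adjoin_truncGen (m : ℕ) : Algebra.adjoin k {truncGen k m} = ⊤ := by
  have h := congrArg (Subalgebra.map (Ideal.Quotient.mkₐ k
    (Ideal.span {(Polynomial.X : Polynomial k) ^ m}))) (Polynomial.adjoin_X (R := k))
  rw [AlgHom.map_adjoin, Algebra.map_top, (AlgHom.range_eq_top _).2
    (Ideal.Quotient.mkₐ_surjective _ _), Set.image_singleton] at h
  exact h

instance finite_truncPoly (m : ℕ) : Module.Finite k (TruncPoly k m) :=
  (AdjoinRoot.powerBasis' (Polynomial.monic_X_pow (R := k) m)).finite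

theorem finrank_truncPoly (m : ℕ) : Module.finrank k (TruncPoly k m) = m := by
  have := (AdjoinRoot.powerBasis' (Polynomial.monic_X_pow (R := k) m)).finrank
  rw [AdjoinRoot.powerBasis'_dim, Polynomial.natDegree_X_pow] at this
  exact this

theorem exists_eq_smul_add_truncGen_mul {m : ℕ} (a : TruncPoly k m) :
    ∃ (c : k) (b : TruncPoly k m), a = c • 1 + truncGen k m * b := by
  obtain ⟨p, rfl⟩ := Ideal.Quotient.mk_surjective a
  refine ⟨p.coeff 0, Ideal.Quotient.mk _ p.divX, ?_⟩
  rw [← Algebra.algebraMap_eq_smul_one, ← map_mul, add_comm]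
  conv_lhs => rw [← Polynomial.X_mul_divX_add p, map_add]
  rfl

end TruncPoly

/-! ### The listed algebras are algebras `C(A)` -/

section Listed

variable {k : Type u} [Field k]

/-- A subalgebra of `A × B` that contains the idempotent `(1, 0)` and the generators of both factors
is the whole algebra. -/
theorem eq_top_of_prod {A : Type*} {B : Type*} [Ring A] [Algebra k A] [Ring B] [Algebra k B]
    {s : Set A}
    {t : Set B} (hs : Algebra.adjoin k s = ⊤) (ht : Algebra.adjoin k t = ⊤)
    {S : Subalgebra k (A × B)} (h1 : ((1, 0) : A × B) ∈ S) (hsS : ∀ a ∈ s, ((a, 0) : A × B) ∈ S)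
    (htS : ∀ b ∈ t, ((0, b) : A × B) ∈ S) : S = ⊤ := by
  have h2 : ((0, 1) : A × B) ∈ S := by
    convert S.sub_mem S.one_mem h1 using 1
    simp [Prod.ext_iff]
  have hA (a : A) : ((a, 0) : A × B) ∈ S := by
    have ha : a ∈ Algebra.adjoin k s := hs ▸ Algebra.mem_top
    induction ha using Algebra.adjoin_induction with
    | mem a ha => exact hsS a ha
    | algebraMap r =>
      convert S.smul_mem h1 r using 1
      simp [Algebra.algebraMap_eq_smul_one]
    | add a b _ _ ha hb =>
      convert S.add_mem ha hb using 1
      simp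
    | mul a b _ _ ha hb =>
      convert S.mul_mem ha hb using 1
      simp
  have hB (b : B) : ((0, b) : A × B) ∈ S := by
    have hb : b ∈ Algebra.adjoin k t := ht ▸ Algebra.mem_top
    induction hb using Algebra.adjoin_induction with
    | mem b hb => exact htS b hb
    | algebraMap r =>
      convert S.smul_mem h2 r using 1
      simp [Algebra.algebraMap_eq_smul_one]
    | add a b _ _ ha hb =>
      convert S.add_mem ha hb using 1
      simp
    | mul a b _ _ ha hb =>
      convert S.mul_mem ha hb using 1
      simp
  rw [eq_top_iff]
  rintro ⟨a, b⟩ -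
  convert S.add_mem (hA a) (hB b) using 1
  simp

theorem eq_top_of_single {n : ℕ} {S : Subalgebra k (Fin n → k)}
    (h : ∀ i, (Pi.single i 1 : Fin n → k) ∈ S) : S = ⊤ := by
  rw [eq_top_iff]
  intro w _
  rw [pi_eq_sum_univ' w]
  exact S.sum_mem fun i _ => S.smul_mem (h i) _

/-- An algebra of dimension four generated by one element `w` with
`(w² - α)² = b w + β`. -/
theorem exists_algEquiv_pairQuot {C : Type v} [CommRing C] [Algebra k C] {b α β : k} {w : C}
    (hw : (w ^ 2 - α • 1) ^ 2 = b • w + β • 1)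
    (hgen : ∀ S : Subalgebra k C,
      (∀ c₀ c₁ c₂ c₃ : k, c₀ • 1 + c₁ • w + c₂ • w ^ 2 + c₃ • w ^ 3 ∈ S) → S = ⊤)
    (hC : Module.finrank k C = 4) : Nonempty (PairQuot 1 b α β ≃ₐ[k] C) := by
  refine (isConicPair_of_adjoin (u := w) (v := w ^ 2 - α • 1) ?_ ?_
    (hgen _ fun c₀ c₁ c₂ c₃ => ?_)).exists_algEquiv hC
  · rw [one_smul, sub_add_cancel, pow_two]
  · rw [← pow_two, hw]
  · have hm : w ∈ Algebra.adjoin k {w, w ^ 2 - α • 1} :=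
      Algebra.subset_adjoin (Set.mem_insert _ _)
    exact add_mem (add_mem (add_mem (Subalgebra.smul_mem _ (one_mem _) _)
      (Subalgebra.smul_mem _ hm _)) (Subalgebra.smul_mem _ (pow_mem hm 2) _))
      (Subalgebra.smul_mem _ (pow_mem hm 3) _)

variable [CharZero k]

/-- The element `(1, -1, 2, -2)` is a root of `(w² - 5/2)² = 9/4`. -/
theorem exists_algEquiv_piFour :
    Nonempty (PairQuot (1 : k) 0 (5 / 2) (9 / 4) ≃ₐ[k] (Fin 4 → k)) := by
  refine exists_algEquiv_pairQuot (w := ![1, -1, 2, -2]) ?_ (fun S hS => ?_) (by simp)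
  · ext i; fin_cases i <;> simp <;> norm_num
  · refine eq_top_of_single fun i => ?_
    fin_cases i
    · convert hS (4 / 6) (4 / 6) (-1 / 6) (-1 / 6) using 1
      ext i; fin_cases i <;> simp [Matrix.vecHead, Matrix.vecTail] <;> norm_num
    · convert hS (4 / 6) (-4 / 6) (-1 / 6) (1 / 6) using 1
      ext i; fin_cases i <;> simp [Matrix.vecHead, Matrix.vecTail] <;> norm_num
    · convert hS (-2 / 12) (-1 / 12) (2 / 12) (1 / 12) using 1
      ext i; fin_cases i <;> simp [Matrix.vecHead, Matrix.vecTail] <;> norm_num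
    · convert hS (-2 / 12) (1 / 12) (2 / 12) (-1 / 12) using 1
      ext i; fin_cases i <;> simp [Matrix.vecHead, Matrix.vecTail] <;> norm_num

/-- The element `(ε, 1, -1)` is a root of `(w² - 1/2)² = 1/4`, that is, of `w⁴ = w²`. -/
theorem exists_algEquiv_prod_pi {T : Type v} [CommRing T] [Algebra k T] [Module.Finite k T]
    {ε : T} (h2 : ε ^ 2 = 0)
    (hgen : Algebra.adjoin k {ε} = ⊤) (hT : Module.finrank k T = 2) :
    Nonempty (PairQuot (1 : k) 0 (1 / 2) (1 / 4) ≃ₐ[k] (T × (Fin 2 → k))) := by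
  have h3 : ε ^ 3 = 0 := by rw [pow_succ, h2, zero_mul]
  refine exists_algEquiv_pairQuot (w := (ε, ![1, -1])) ?_ (fun S hS => ?_)
    (by simp [hT])
  · refine Prod.ext ?_ (funext fun i => ?_)
    · simp only [Prod.fst_sub, Prod.pow_fst, Prod.smul_fst, Prod.fst_one, Prod.fst_add, h2]
      rw [zero_sub, neg_sq, smul_pow, one_pow, zero_smul, zero_add]
      norm_num
    · fin_cases i <;> simp <;> norm_num
  · refine eq_top_of_prod hgen 
      (t := Set.range fun i : Fin 2 => (Pi.single i 1 : Fin 2 → k))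
      (eq_top_of_single fun i => Algebra.subset_adjoin ⟨i, rfl⟩) ?_ ?_ ?_
    · convert hS 1 0 (-1) 0 using 1
      refine Prod.ext (by simp [h2]) (funext fun i => ?_)
      fin_cases i <;> simp
    · rintro _ rfl
      convert hS 0 1 0 (-1) using 1
      refine Prod.ext (by simp [h3]) (funext fun i => ?_)
      fin_cases i <;> simp [Matrix.vecHead, Matrix.vecTail] <;> norm_num
    · rintro _ ⟨i, rfl⟩
      fin_cases i
      · convert hS 0 0 (1 / 2) (1 / 2) using 1
        refine Prod.ext (by simp [h2, h3]) (funext fun i => ?_)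
        fin_cases i <;> simp <;> norm_num
      · convert hS 0 0 (1 / 2) (-1 / 2) using 1
        refine Prod.ext (by simp [h2, h3]) (funext fun i => ?_)
        fin_cases i <;> simp <;> norm_num

/-- The element `(1 + ε, -1 + ε)` is a root of `(w² - 1)² = 0`. -/
theorem exists_algEquiv_prod_self {T : Type v} [CommRing T] [Algebra k T] [Module.Finite k T]
    {ε : T} (h2 : ε ^ 2 = 0)
    (hgen : Algebra.adjoin k {ε} = ⊤) (hT : Module.finrank k T = 2) :
    Nonempty (PairQuot (1 : k) 0 1 0 ≃ₐ[k] (T × T)) := by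
  have e2 : (1 + ε) ^ 2 = 1 + (2 : k) • ε := by
    rw [Algebra.smul_def, map_ofNat]; linear_combination h2
  have e3 : (1 + ε) ^ 3 = 1 + (3 : k) • ε := by
    rw [Algebra.smul_def, map_ofNat]; linear_combination (3 + ε) * h2
  have f2 : (-1 + ε) ^ 2 = 1 - (2 : k) • ε := by
    rw [Algebra.smul_def, map_ofNat]; linear_combination h2
  have f3 : (-1 + ε) ^ 3 = -1 + (3 : k) • ε := by
    rw [Algebra.smul_def, map_ofNat]; linear_combination (-3 + ε) * h2
  refine exists_algEquiv_pairQuot (w := (1 + ε, -1 + ε)) ?_ (fun S hS => ?_)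
    (by simp [hT])
  · refine Prod.ext ?_ ?_ <;> simp [e2, f2, smul_pow, h2]
  · refine eq_top_of_prod hgen hgen ?_ ?_ ?_
    · convert hS (2 / 4) (3 / 4) 0 (-1 / 4) using 1
      refine Prod.ext ?_ ?_ <;> simp only [Prod.fst_add, Prod.snd_add, Prod.smul_fst,
        Prod.smul_snd, Prod.pow_fst, Prod.pow_snd, Prod.fst_one, Prod.snd_one, e2, e3, f2, f3] <;>
        module
    · rintro _ rfl
      convert hS (-1 / 4) (-1 / 4) (1 / 4) (1 / 4) using 1
      refine Prod.ext ?_ ?_ <;> simp only [Prod.fst_add, Prod.snd_add, Prod.smul_fst,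
        Prod.smul_snd, Prod.pow_fst, Prod.pow_snd, Prod.fst_one, Prod.snd_one, e2, e3, f2, f3] <;>
        module
    · rintro _ rfl
      convert hS (1 / 4) (-1 / 4) (-1 / 4) (1 / 4) using 1
      refine Prod.ext ?_ ?_ <;> simp only [Prod.fst_add, Prod.snd_add, Prod.smul_fst,
        Prod.smul_snd, Prod.pow_fst, Prod.pow_snd, Prod.fst_one, Prod.snd_one, e2, e3, f2, f3] <;>
        module

/-- The element `(1 + ε, -3)` is a root of `(w - 1)³ (w + 3)`, which has no cubic term and equals
`(w² - 3)² + 8 w - 12`. -/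
theorem exists_algEquiv_prod_field {T : Type u} [CommRing T] [Algebra k T] [Module.Finite k T]
    {ε : T} (h3 : ε ^ 3 = 0)
    (hgen : Algebra.adjoin k {ε} = ⊤) (hT : Module.finrank k T = 3) :
    Nonempty (PairQuot (1 : k) (-8) 3 12 ≃ₐ[k] (T × k)) := by
  have e2 : (1 + ε) ^ 2 = 1 + (2 : k) • ε + ε ^ 2 := by
    rw [Algebra.smul_def, map_ofNat]; ring
  have e3 : (1 + ε) ^ 3 = 1 + (3 : k) • ε + (3 : k) • ε ^ 2 := by
    simp only [Algebra.smul_def, map_ofNat]; linear_combination h3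
  have e4 : ((1 + ε) ^ 2 - (3 : k) • 1) ^ 2 = (-8 : k) • (1 + ε) + (12 : k) • 1 := by
    simp only [Algebra.smul_def, map_neg, map_ofNat]
    linear_combination (4 + ε) * h3
  refine exists_algEquiv_pairQuot (w := (1 + ε, -3)) ?_ (fun S hS => ?_)
    (by simp [hT])
  · refine Prod.ext e4 ?_
    simp
    norm_num
  · have key : ((0, 1) : T × k) ∈ S := by
      convert hS (1 / 64) (-3 / 64) (3 / 64) (-1 / 64) using 1
      refine Prod.ext ?_ ?_
      · simp only [Prod.fst_add, Prod.smul_fst, Prod.pow_fst, Prod.fst_one, e2, e3]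
        module
      · simp
        norm_num
    refine eq_top_of_prod hgen (t := ∅) ?_ ?_ ?_ (by simp)
    · rw [eq_top_iff]
      exact fun x _ => Subalgebra.algebraMap_mem _ x
    · convert S.sub_mem S.one_mem key using 1
      simp [Prod.ext_iff]
    · rintro _ rfl
      convert S.add_mem (hS (-1) 1 0 0) (S.smul_mem key 4) using 1
      refine Prod.ext ?_ ?_
      · simp
      · simp
        norm_num

omit [CharZero k] in
theorem exists_algEquiv_truncFour :
    Nonempty (PairQuot (1 : k) 0 0 0 ≃ₐ[k] TruncPoly k 4) := by
  refine exists_algEquiv_pairQuot (w := truncGen k 4) ?_ (fun S hS => ?_) (finrank_truncPoly 4)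
  · have := truncGen_pow (k := k) 4
    simp [← pow_mul, this]
  · rw [eq_top_iff, ← adjoin_truncGen, Algebra.adjoin_le_iff, Set.singleton_subset_iff]
    have := hS 0 1 0 0
    simpa using this

omit [CharZero k] in
theorem exists_algEquiv_truncPolyTwo :
    Nonempty (PairQuot (0 : k) 0 0 0 ≃ₐ[k] TruncPolyTwo k) := by
  refine ⟨Ideal.quotientEquivAlgOfEq k ?_⟩
  simp

/-- Each algebra of the list other than `k[u, v]/(u², v²)` is generated by one element, whose minimal
polynomial can be chosen without cubic term, hence of the form `(w² - α)² - b w - β`. -/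
theorem IsListed.isAlgebraCOfSymmetricConic {B : Type v} [Ring B] [Algebra k B] {i : Fin 6}
    (h : IsListed k B i) : IsAlgebraCOfSymmetricConic k B := by
  fin_cases i <;> obtain ⟨e⟩ := h
  · obtain ⟨e'⟩ := exists_algEquiv_piFour (k := k)
    exact isAlgebraCOfSymmetricConic_of_algEquiv (e.trans e'.symm)
  · obtain ⟨e'⟩ := exists_algEquiv_prod_pi (truncGen_pow (k := k) 2) (adjoin_truncGen 2)
      (finrank_truncPoly 2)
    exact isAlgebraCOfSymmetricConic_of_algEquiv (e.trans e'.symm)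
  · obtain ⟨e'⟩ := exists_algEquiv_prod_self (truncGen_pow (k := k) 2) (adjoin_truncGen 2)
      (finrank_truncPoly 2)
    exact isAlgebraCOfSymmetricConic_of_algEquiv (e.trans e'.symm)
  · obtain ⟨e'⟩ := exists_algEquiv_prod_field (truncGen_pow (k := k) 3) (adjoin_truncGen 3)
      (finrank_truncPoly 3)
    exact isAlgebraCOfSymmetricConic_of_algEquiv (e.trans e'.symm)
  · obtain ⟨e'⟩ := exists_algEquiv_truncFour (k := k)
    exact isAlgebraCOfSymmetricConic_of_algEquiv (e.trans e'.symm)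
  · obtain ⟨e'⟩ := exists_algEquiv_truncPolyTwo (k := k)
    exact isAlgebraCOfSymmetricConic_of_algEquiv (e.trans e'.symm)

end Listed

end NCConic

namespace NCConic

/-! ### Commutative Frobenius algebras and their factors -/

section Frobenius

variable {k : Type u} [Field k]

/-- `C` has a linear functional whose kernel contains no nonzero ideal. For a finite dimensional
commutative algebra this is the Frobenius property. -/
def HasNondegenerateFunctional (k : Type u) [Field k] (C : Type v) [CommRing C] [Algebra k C] :
    Prop :=
  ∃ ψ : C →ₗ[k] k, ∀ a, (∀ b, ψ (a * b) = 0) → a = 0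

theorem IsFrobeniusAlgebra.hasNondegenerateFunctional {C : Type v} [CommRing C] [Algebra k C]
    (h : IsFrobeniusAlgebra k C) : HasNondegenerateFunctional k C := by
  obtain ⟨-, β, hβ, hassoc⟩ := h
  refine ⟨β 1, fun a ha => hβ.1 a fun b => ?_⟩
  rw [← ha b, ← hassoc, one_mul]

theorem HasNondegenerateFunctional.fst {C C₁ C₂ : Type v} [CommRing C] [CommRing C₁] [CommRing C₂]
    [Algebra k C] [Algebra k C₁] [Algebra k C₂] (h : HasNondegenerateFunctional k C)
    (e : C ≃ₐ[k] C₁ × C₂) : HasNondegenerateFunctional k C₁ := by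
  obtain ⟨ψ, hψ⟩ := h
  refine ⟨ψ ∘ₗ e.symm.toLinearMap ∘ₗ LinearMap.inl k C₁ C₂, fun a ha => ?_⟩
  have := hψ (e.symm (a, 0)) fun b => by
    obtain ⟨⟨b₁, b₂⟩, rfl⟩ := e.symm.surjective b
    rw [← map_mul, Prod.mk_mul_mk, zero_mul]
    exact ha b₁
  rw [map_eq_zero_iff _ e.symm.injective] at this
  exact congrArg Prod.fst this

/-- The swap isomorphism of `k`-algebras. -/
def prodSwapEquiv (k : Type u) [Field k] (A B : Type*) [CommRing A] [CommRing B] [Algebra k A]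
    [Algebra k B] : (A × B) ≃ₐ[k] B × A :=
  AlgEquiv.ofRingEquiv (f := RingEquiv.prodComm) fun _ => rfl

/-- An idempotent different from `0` and `1` splits the algebra. -/
theorem exists_prod_of_isIdempotentElem {C : Type v} [CommRing C] [Algebra k C] {e : C}
    (he : IsIdempotentElem e) (h0 : e ≠ 0) (h1 : e ≠ 1) :
    ∃ (I J : Ideal C), Nontrivial (C ⧸ I) ∧ Nontrivial (C ⧸ J) ∧
      Nonempty (C ≃ₐ[k] (C ⧸ I) × (C ⧸ J)) := by
  refine ⟨Ideal.span {e}, Ideal.span {1 - e}, ?_, ?_,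
    ⟨AlgEquiv.prodQuotientOfIsIdempotentElem k he he.one_sub (by ring)
      (by rw [mul_sub, mul_one, he.eq, sub_self])⟩⟩
  · rw [Ideal.Quotient.nontrivial_iff, Ne, Ideal.span_singleton_eq_top]
    exact fun h => h1 ((IsIdempotentElem.iff_eq_one_of_isUnit h).1 he)
  · rw [Ideal.Quotient.nontrivial_iff, Ne, Ideal.span_singleton_eq_top]
    intro h
    apply h0
    have := (IsIdempotentElem.iff_eq_one_of_isUnit h).1 he.one_sub
    simpa using this

/-- Every element is nilpotent or a unit, or there is an idempotent different from `0` and `1`. -/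
theorem isNilpotent_or_isUnit_of_idempotents {C : Type v} [CommRing C] [Algebra k C]
    [Module.Finite k C] (h : ∀ e : C, IsIdempotentElem e → e = 0 ∨ e = 1) (x : C) :
    IsNilpotent x ∨ IsUnit x := by
  have : IsArtinianRing C := IsArtinianRing.of_finite k C
  obtain ⟨n, y, hy⟩ := IsArtinian.exists_pow_succ_smul_dvd x (1 : C)
  rw [smul_eq_mul, smul_eq_mul, mul_one, Nat.succ_eq_add_one, pow_succ] at hy
  have hm (m : ℕ) : x ^ n * (x * y) ^ m = x ^ n := by
    induction m with
    | zero => rw [pow_zero, mul_one]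
    | succ m ih => rw [pow_succ, ← mul_assoc, ih, ← mul_assoc, hy]
  have he : IsIdempotentElem ((x * y) ^ n) := by
    have := hm n
    change (x * y) ^ n * (x * y) ^ n = (x * y) ^ n
    conv_lhs => rw [mul_pow x y n, mul_right_comm, ← mul_pow x y n, this]
    rw [mul_pow]
  rcases h _ he with h | h
  · left
    exact ⟨n, by rw [← hm n, h, mul_zero]⟩
  · right
    rcases Nat.eq_zero_or_pos n with rfl | hn
    · rw [pow_zero, one_mul] at hy
      exact IsUnit.of_mul_eq_one _ hy
    · exact isUnit_of_mul_isUnit_left ((isUnit_pow_iff hn.ne').1 (h ▸ isUnit_one))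

end Frobenius

/-! ### Local commutative Frobenius algebras of dimension at most four -/

section Local

variable {k : Type u} [Field k] {C : Type v} [CommRing C] [Algebra k C]

/-- An element `w` with `w^n = 0 ≠ w^(n-1)` generates a copy of `k[u]/(u^n)`. -/
theorem exists_injective_truncPoly {w : C} {n : ℕ} (hn : w ^ (n + 1) = 0) (hn' : w ^ n ≠ 0) :
    ∃ φ : TruncPoly k (n + 1) →ₐ[k] C, Function.Injective φ := by
  let φ : TruncPoly k (n + 1) →ₐ[k] C := Ideal.Quotient.liftₐ _ (Polynomial.aeval w) (by
    intro p hp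
    obtain ⟨q, rfl⟩ := Ideal.mem_span_singleton.1 hp
    simp [hn])
  refine ⟨φ, ?_⟩
  have hdvd : (Polynomial.X : Polynomial k) ^ (n + 1) ∣ minpoly k w := by
    obtain ⟨i, hi, hassoc⟩ := (dvd_prime_pow Polynomial.prime_X (n + 1)).1
      (minpoly.dvd k w (p := Polynomial.X ^ (n + 1)) (by simp [hn]))
    have h0 : w ^ i = 0 := by
      obtain ⟨q, hq⟩ := hassoc.dvd
      have := congrArg (Polynomial.aeval w) hq
      simpa using this
    have : n + 1 ≤ i := by
      by_contra hlt
      exact hn' (pow_eq_zero_of_le (by omega) h0)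
    exact (pow_dvd_pow _ this).trans hassoc.symm.dvd
  rw [injective_iff_map_eq_zero]
  intro a ha
  obtain ⟨p, rfl⟩ := Ideal.Quotient.mk_surjective a
  rw [Ideal.Quotient.eq_zero_iff_mem, Ideal.mem_span_singleton]
  exact hdvd.trans (minpoly.dvd k w ha)

variable [Module.Finite k C]

theorem exists_algEquiv_truncPoly {w : C} {n : ℕ} (hn : w ^ (n + 1) = 0) (hn' : w ^ n ≠ 0)
    (hC : Module.finrank k C = n + 1) : Nonempty (C ≃ₐ[k] TruncPoly k (n + 1)) := by
  obtain ⟨φ, hφ⟩ := exists_injective_truncPoly (k := k) hn hn'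
  have hsurj : Function.Surjective φ :=
    (LinearMap.injective_iff_surjective_of_finrank_eq_finrank (f := φ.toLinearMap)
      (by rw [finrank_truncPoly, hC])).1 hφ
  exact ⟨(AlgEquiv.ofBijective φ ⟨hφ, hsurj⟩).symm⟩

theorem pow_finrank_eq_zero {w : C} (hw : IsNilpotent w) : w ^ Module.finrank k C = 0 := by
  by_contra h0
  have hex : ∃ n, w ^ n = 0 := hw
  classical
  have h1 := Nat.find_spec hex
  have h2 : Module.finrank k C < Nat.find hex := by
    by_contra hle
    exact h0 (pow_eq_zero_of_le (not_lt.1 hle) h1)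
  obtain ⟨m, hm⟩ : ∃ m, Nat.find hex = m + 1 := ⟨Nat.find hex - 1, by omega⟩
  have h3 := Nat.find_min hex (m := m) (by omega)
  rw [hm] at h1
  obtain ⟨φ, hφ⟩ := exists_injective_truncPoly (k := k) h1 h3
  have := LinearMap.finrank_le_finrank_of_injective (f := φ.toLinearMap) hφ
  rw [finrank_truncPoly] at this
  omega

/-- The nilpotent elements as a linear subspace. -/
def nilSubspace (k : Type u) [Field k] (C : Type v) [CommRing C] [Algebra k C] : Submodule k C :=
  (nilradical C).restrictScalars k

variable [IsAlgClosed k] [Nontrivial C]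

theorem exists_eq_smul_add_of_local (hloc : ∀ x : C, IsNilpotent x ∨ IsUnit x) (x : C) :
    ∃ (c : k) (y : C), y ∈ nilSubspace k C ∧ x = c • 1 + y := by
  obtain ⟨c, hc⟩ := spectrum.nonempty_of_isAlgClosed_of_finiteDimensional k x
  refine ⟨c, x - c • 1, ?_, by abel⟩
  have h := (hloc (algebraMap k C c - x)).resolve_right hc
  rw [Algebra.algebraMap_eq_smul_one] at h
  change x - c • 1 ∈ nilradical C
  rw [mem_nilradical, ← neg_sub]
  exact h.neg

theorem finrank_le_nilSubspace (hloc : ∀ x : C, IsNilpotent x ∨ IsUnit x) :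
    Module.finrank k C ≤ 1 + Module.finrank k (nilSubspace k C) := by
  have h : Submodule.span k {(1 : C)} ⊔ nilSubspace k C = ⊤ := by
    rw [eq_top_iff]
    intro x _
    obtain ⟨c, y, hy, rfl⟩ := exists_eq_smul_add_of_local (k := k) hloc x
    exact Submodule.add_mem_sup (Submodule.smul_mem _ _ (Submodule.mem_span_singleton_self _)) hy
  have h1 := Submodule.finrank_add_le_finrank_add_finrank (Submodule.span k {(1 : C)})
    (nilSubspace k C)
  have h2 := finrank_span_le_card (R := k) ({1} : Set C)
  simp only [Set.toFinset_singleton, Finset.card_singleton] at h2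
  rw [h, finrank_top] at h1
  omega

/-- The socle of a local Frobenius algebra: the functional is injective on it. -/
theorem eq_zero_of_mul_nilpotent (hloc : ∀ x : C, IsNilpotent x ∨ IsUnit x) {ψ : C →ₗ[k] k}
    (hψ : ∀ a, (∀ b, ψ (a * b) = 0) → a = 0) {s : C} (hs : ∀ y, IsNilpotent y → s * y = 0)
    (h0 : ψ s = 0) : s = 0 := by
  refine hψ s fun b => ?_
  obtain ⟨c, y, hy, rfl⟩ := exists_eq_smul_add_of_local (k := k) hloc b
  rw [mul_add, hs y hy, add_zero, mul_smul_comm, mul_one, map_smul, h0, smul_zero]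

/-- The socle of a local Frobenius algebra has dimension one. -/
theorem exists_eq_smul_of_mul_nilpotent (hloc : ∀ x : C, IsNilpotent x ∨ IsUnit x)
    (hF : HasNondegenerateFunctional k C) {s t : C} (hs : ∀ y, IsNilpotent y → s * y = 0)
    (ht : ∀ y, IsNilpotent y → t * y = 0) (h0 : s ≠ 0) : ∃ c : k, t = c • s := by
  obtain ⟨ψ, hψ⟩ := hF
  have h1 : ψ s ≠ 0 := fun h => h0 (eq_zero_of_mul_nilpotent hloc hψ hs h)
  refine ⟨ψ t / ψ s, sub_eq_zero.1 (eq_zero_of_mul_nilpotent hloc hψ (fun y hy => ?_) ?_)⟩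
  · rw [sub_mul, ht y hy, smul_mul_assoc, hs y hy, smul_zero, sub_zero]
  · rw [map_sub, map_smul, smul_eq_mul, div_mul_cancel₀ _ h1, sub_self]

/-- Otherwise the product of two nilpotent elements vanishes, and the maximal ideal lies in the
socle, which has dimension one. -/
theorem exists_sq_ne_zero [CharZero k] (hloc : ∀ x : C, IsNilpotent x ∨ IsUnit x)
    (hF : HasNondegenerateFunctional k C) (hC : 3 ≤ Module.finrank k C) :
    ∃ w : C, IsNilpotent w ∧ w ^ 2 ≠ 0 := by
  by_contra! hcon
  have hmul (x y : C) (hx : IsNilpotent x) (hy : IsNilpotent y) : x * y = 0 := by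
    have h1 := hcon _ ((Commute.all x y).isNilpotent_add hx hy)
    rw [add_sq, hcon x hx, hcon y hy, zero_add, add_zero, mul_assoc, two_mul, ← two_smul k] at h1
    exact (smul_eq_zero.1 h1).resolve_left two_ne_zero
  obtain ⟨ψ, hψ⟩ := hF
  have hinj : Function.Injective (ψ.domRestrict (nilSubspace k C)) := by
    rw [injective_iff_map_eq_zero]
    rintro ⟨s, hs⟩ h0
    exact Subtype.ext (eq_zero_of_mul_nilpotent hloc hψ (fun y hy => hmul s y hs hy) h0)
  have h1 := LinearMap.finrank_le_finrank_of_injective hinj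
  have h2 := finrank_le_nilSubspace (k := k) hloc
  rw [Module.finrank_self] at h1
  omega

omit [Module.Finite k C] [IsAlgClosed k] [Nontrivial C] in
/-- Polarization of `x³ = 0`. -/
theorem mul_mul_eq_zero_of_cube [CharZero k] (h : ∀ x : C, IsNilpotent x → x ^ 3 = 0) {x y z : C}
    (hx : IsNilpotent x) (hy : IsNilpotent y) (hz : IsNilpotent z) : x * y * z = 0 := by
  have hxy := (Commute.all x y).isNilpotent_add hx hy
  have hxz := (Commute.all x z).isNilpotent_add hx hz
  have hyz := (Commute.all y z).isNilpotent_add hy hz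
  have hxyz := (Commute.all (x + y) z).isNilpotent_add hxy hz
  have h6 : (6 : k) • (x * y * z) = 0 := by
    rw [Algebra.smul_def, map_ofNat]
    linear_combination h _ hxyz - h _ hxy - h _ hxz - h _ hyz + h _ hx + h _ hy + h _ hz
  exact (smul_eq_zero.1 h6).resolve_left (by norm_num)

/-- A local Frobenius algebra of dimension four in which the cube of every nilpotent element
vanishes is `k[p, q]/(p², q²)`: the square `N²` of the maximal ideal `N` is the socle, and `p`, `q`
are isotropic vectors of the nondegenerate quadratic form on `N / N²` given by `x ↦ x²`. -/
theorem exists_algEquiv_truncPolyTwo_of_cube [CharZero k]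
    (hloc : ∀ x : C, IsNilpotent x ∨ IsUnit x) (hF : HasNondegenerateFunctional k C)
    (hC : Module.finrank k C = 4) (h3 : ∀ x : C, IsNilpotent x → x ^ 3 = 0) :
    Nonempty (C ≃ₐ[k] TruncPolyTwo k) := by
  obtain ⟨u, hu, hu2⟩ := exists_sq_ne_zero (k := k) hloc hF (by omega)
  have h0 {x y z : C} := mul_mul_eq_zero_of_cube (k := k) h3 (x := x) (y := y) (z := z)
  have hsoc (x y : C) (hx : IsNilpotent x) (hy : IsNilpotent y) : ∃ c : k, x * y = c • u ^ 2 :=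
    exists_eq_smul_of_mul_nilpotent hloc hF (fun z hz => by rw [pow_two]; exact h0 hu hu hz)
      (fun z hz => h0 hx hy hz) hu2
  have hu2n : IsNilpotent (u ^ 2) := hu.pow_succ 1
  obtain ⟨w₀, hw₀, hw₀'⟩ : ∃ w₀ ∈ nilSubspace k C, w₀ ∉ Submodule.span k {u, u ^ 2} := by
    by_contra! hcon
    have h1 := Submodule.finrank_mono (show nilSubspace k C ≤ _ from hcon)
    have h2 := finrank_le_nilSubspace (k := k) hloc
    classical
    have h4 := finrank_span_finset_le_card (R := k) ({u, u ^ 2} : Finset C)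
    have h5 := Finset.card_le_two (a := u) (b := u ^ 2)
    rw [Finset.coe_insert, Finset.coe_singleton, Set.finrank] at h4
    omega
  obtain ⟨c, hc⟩ := hsoc u w₀ hu hw₀
  set w := w₀ - c • u with hwdef
  have hw : IsNilpotent w := (nilSubspace k C).sub_mem hw₀ ((nilSubspace k C).smul_mem c hu)
  have huw : u * w = 0 := by rw [hwdef, mul_sub, hc, mul_smul_comm, pow_two, sub_self]
  have hw' : w ∉ Submodule.span k {u, u ^ 2} := fun h => hw₀' (by
    have := add_mem h (Submodule.smul_mem _ c (Submodule.subset_span (Set.mem_insert u {u ^ 2})))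
    rwa [hwdef, sub_add_cancel] at this)
  obtain ⟨γ, hγ⟩ := hsoc w w hw hw
  have hnil (c : k) (hc : IsNilpotent (c • (1 : C))) : c = 0 := by
    rw [← Algebra.algebraMap_eq_smul_one, IsNilpotent.map_iff (algebraMap k C).injective] at hc
    exact hc.eq_zero
  -- `1, u, u², w` is a basis.
  have hli : LinearIndependent k ![1, u, u ^ 2, w] := by
    rw [Fintype.linearIndependent_iff]
    intro d hd
    rw [Fin.sum_univ_four] at hd
    change d 0 • 1 + d 1 • u + d 2 • u ^ 2 + d 3 • w = 0 at hd
    have e0 : d 0 = 0 := by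
      apply hnil
      have : d 0 • (1 : C) = -(d 1 • u + d 2 • u ^ 2 + d 3 • w) := by
        rw [eq_neg_iff_add_eq_zero, ← hd]; abel
      rw [this]
      exact (nilSubspace k C).neg_mem (add_mem (add_mem ((nilSubspace k C).smul_mem _ hu)
        ((nilSubspace k C).smul_mem _ hu2n)) ((nilSubspace k C).smul_mem _ hw))
    rw [e0, zero_smul, zero_add] at hd
    have e3 : d 3 = 0 := by
      by_contra hne
      apply hw'
      have : w = (-(d 3)⁻¹ * d 1) • u + (-(d 3)⁻¹ * d 2) • u ^ 2 := by
        have h4 : d 3 • w = -(d 1 • u + d 2 • u ^ 2) := by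
          rw [eq_neg_iff_add_eq_zero, ← hd]; abel
        rw [← inv_smul_smul₀ hne w, h4, mul_smul, mul_smul, ← smul_add, neg_smul, smul_neg]
      rw [this]
      exact Submodule.mem_span_pair.2 ⟨_, _, rfl⟩
    rw [e3, zero_smul, add_zero] at hd
    have e1 : d 1 = 0 := by
      have h4 := congrArg (fun t => t * u) hd
      simp only [add_mul, smul_mul_assoc, zero_mul] at h4
      rw [pow_two, h0 hu hu hu, smul_zero, add_zero, ← pow_two] at h4
      exact (smul_eq_zero.1 h4).resolve_right hu2
    rw [e1, zero_smul, zero_add] at hd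
    have e2 := (smul_eq_zero.1 hd).resolve_right hu2
    intro i
    fin_cases i
    exacts [e0, e1, e2, e3]
  have hspan := hli.span_eq_top_of_card_eq_finrank' (by simp [hC])
  have hγ0 : γ ≠ 0 := by
    rintro rfl
    rw [zero_smul] at hγ
    have hann (y : C) (hy : IsNilpotent y) : w * y = 0 := by
      obtain ⟨d, rfl⟩ := (Submodule.mem_span_range_iff_exists_fun k).1
        (hspan ▸ Submodule.mem_top : y ∈ Submodule.span k (Set.range ![1, u, u ^ 2, w]))
      rw [Fin.sum_univ_four] at hy ⊢
      change IsNilpotent (d 0 • 1 + d 1 • u + d 2 • u ^ 2 + d 3 • w) at hy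
      change w * (d 0 • 1 + d 1 • u + d 2 • u ^ 2 + d 3 • w) = 0
      have e0 : d 0 = 0 := by
        apply hnil
        have h4 := (nilSubspace k C).sub_mem hy (add_mem (add_mem
          ((nilSubspace k C).smul_mem (d 1) hu)
          ((nilSubspace k C).smul_mem (d 2) hu2n)) ((nilSubspace k C).smul_mem (d 3) hw))
        convert h4 using 1
        change IsNilpotent _ ↔ IsNilpotent _
        rw [add_assoc, add_assoc, ← add_assoc (d 1 • u), add_sub_cancel_right]
      have e1 : w * u ^ 2 = 0 := by rw [pow_two, ← mul_assoc, mul_comm w, huw, zero_mul]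
      rw [e0, mul_add, mul_add, mul_add, mul_smul_comm, mul_smul_comm, mul_smul_comm,
        mul_smul_comm, mul_comm w u, huw, hγ, e1]
      simp
    obtain ⟨d, hd⟩ := exists_eq_smul_of_mul_nilpotent hloc hF
      (fun z hz => by rw [pow_two]; exact h0 hu hu hz) hann hu2
    exact hw' (hd ▸ Submodule.smul_mem _ d (Submodule.subset_span (by simp)))
  obtain ⟨s, hs⟩ := IsAlgClosed.exists_pow_nat_eq (-γ⁻¹) (n := 2) (by norm_num)
  have hs0 : s ≠ 0 := by
    rintro rfl
    rw [zero_pow two_ne_zero, eq_comm, neg_eq_zero, inv_eq_zero] at hs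
    exact hγ0 hs
  have hsw : (s • w) * (s • w) = -u ^ 2 := by
    rw [smul_mul_smul_comm, hγ, smul_smul, ← pow_two, hs, neg_mul, inv_mul_cancel₀ hγ0, neg_smul,
      one_smul]
  have husw : u * (s • w) = 0 := by rw [mul_smul_comm, huw, smul_zero]
  have hpair : IsConicPair (k := k) 0 0 0 0 (u + s • w) (u - s • w) := by
    refine ⟨?_, ?_, ?_⟩
    · rw [zero_smul, zero_smul, add_zero]
      linear_combination 2 * husw + hsw
    · rw [zero_smul, zero_smul, add_zero]
      linear_combination -2 * husw + hsw
    · have e : (u + s • w) * (u - s • w) = (2 : k) • u ^ 2 := by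
        rw [two_smul]
        linear_combination -hsw
      have m (i : Fin 4) := Submodule.subset_span (R := k) (Set.mem_range_self (f :=
        ![1, u + s • w, u - s • w, (u + s • w) * (u - s • w)]) i)
      rw [eq_top_iff, ← hspan, Submodule.span_le, Set.range_subset_iff]
      intro i
      fin_cases i
      · exact m 0
      · have h4 := Submodule.smul_mem _ (2⁻¹ : k) (add_mem (m 1) (m 2))
        change u ∈ Submodule.span k _
        convert h4 using 1
        change u = (2⁻¹ : k) • (u + s • w + (u - s • w))
        module
      · have h4 := Submodule.smul_mem _ (2⁻¹ : k) (m 3)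
        change u ^ 2 ∈ Submodule.span k _
        convert h4 using 1
        change u ^ 2 = (2⁻¹ : k) • ((u + s • w) * (u - s • w))
        rw [e]
        module
      · have h4 := Submodule.smul_mem _ ((2 * s)⁻¹ : k) (sub_mem (m 1) (m 2))
        change w ∈ Submodule.span k _
        convert h4 using 1
        change w = ((2 * s)⁻¹ : k) • (u + s • w - (u - s • w))
        have : u + s • w - (u - s • w) = (2 * s) • w := by module
        rw [this, inv_smul_smul₀ (mul_ne_zero two_ne_zero hs0)]
  obtain ⟨e⟩ := hpair.exists_algEquiv hC
  obtain ⟨e'⟩ := exists_algEquiv_truncPolyTwo (k := k)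
  exact ⟨e.symm.trans e'⟩

end Local

end NCConic

namespace NCConic

/-! ### Commutative Frobenius algebras of dimension four -/

section Classification

variable {k : Type u} [Field k] {C : Type v} [CommRing C] [Algebra k C] [Module.Finite k C]

omit [Module.Finite k C] in
theorem HasNondegenerateFunctional.snd {C₁ C₂ : Type v} [CommRing C₁] [CommRing C₂]
    [Algebra k C₁] [Algebra k C₂] (h : HasNondegenerateFunctional k C) (e : C ≃ₐ[k] C₁ × C₂) :
    HasNondegenerateFunctional k C₂ :=
  h.fst (e.trans (prodSwapEquiv k C₁ C₂))

/-- A Frobenius algebra is local or a product of Frobenius algebras of smaller dimension. -/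
theorem HasNondegenerateFunctional.local_or_prod (hF : HasNondegenerateFunctional k C) :
    (∀ x : C, IsNilpotent x ∨ IsUnit x) ∨ ∃ I J : Ideal C,
      0 < Module.finrank k (C ⧸ I) ∧ Module.finrank k (C ⧸ I) ≤ Module.finrank k (C ⧸ J) ∧
      Module.finrank k (C ⧸ I) + Module.finrank k (C ⧸ J) = Module.finrank k C ∧
      HasNondegenerateFunctional k (C ⧸ I) ∧ HasNondegenerateFunctional k (C ⧸ J) ∧
      Nonempty (C ≃ₐ[k] (C ⧸ I) × (C ⧸ J)) := by
  by_cases h : ∀ e : C, IsIdempotentElem e → e = 0 ∨ e = 1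
  · exact Or.inl fun x => isNilpotent_or_isUnit_of_idempotents (k := k) h x
  · right
    push Not at h
    obtain ⟨e, he, h0, h1⟩ := h
    obtain ⟨I, J, hI, hJ, ⟨φ⟩⟩ := exists_prod_of_isIdempotentElem (k := k) he h0 h1
    have hsum := φ.toLinearEquiv.finrank_eq
    rw [Module.finrank_prod] at hsum
    have hI' : 0 < Module.finrank k (C ⧸ I) := Module.finrank_pos
    have hJ' : 0 < Module.finrank k (C ⧸ J) := Module.finrank_pos
    rcases le_total (Module.finrank k (C ⧸ I)) (Module.finrank k (C ⧸ J)) with hle | hle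
    · exact ⟨I, J, hI', hle, hsum.symm, hF.fst φ, hF.snd φ, ⟨φ⟩⟩
    · exact ⟨J, I, hJ', hle, by omega, hF.snd φ, hF.fst φ, ⟨φ.trans (prodSwapEquiv k _ _)⟩⟩

theorem exists_algEquiv_of_finrank_eq_one (h : Module.finrank k C = 1) : Nonempty (C ≃ₐ[k] k) :=
  ⟨(AlgEquiv.ofBijective (Algebra.ofId k C)
    (Algebra.finrank_eq_one_iff_bijective_algebraMap.1 h)).symm⟩

/-- `k × k` as a power of `k`. -/
def prodEquivPiTwo (k : Type u) [Field k] : (k × k) ≃ₐ[k] (Fin 2 → k) where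
  toFun x := ![x.1, x.2]
  invFun y := (y 0, y 1)
  left_inv _ := rfl
  right_inv y := by ext i; fin_cases i <;> rfl
  map_mul' x y := by ext i; fin_cases i <;> rfl
  map_add' x y := by ext i; fin_cases i <;> rfl
  commutes' r := by ext i; fin_cases i <;> rfl

/-- Rearrangement of the factors of `k × (k × T)`. -/
def prodProdEquivProdPiTwo (k : Type u) [Field k] (T : Type*) [CommRing T] [Algebra k T] :
    (k × (k × T)) ≃ₐ[k] (T × (Fin 2 → k)) where
  toFun x := (x.2.2, ![x.1, x.2.1])
  invFun y := (y.2 0, y.2 1, y.1)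
  left_inv _ := rfl
  right_inv y := by
    refine Prod.ext rfl (funext fun i => ?_)
    fin_cases i <;> rfl
  map_mul' x y := by
    refine Prod.ext rfl (funext fun i => ?_)
    fin_cases i <;> rfl
  map_add' x y := by
    refine Prod.ext rfl (funext fun i => ?_)
    fin_cases i <;> rfl
  commutes' r := by
    refine Prod.ext rfl (funext fun i => ?_)
    fin_cases i <;> rfl

/-- `k² × k²` as a power of `k`. -/
def prodEquivPiFour (k : Type u) [Field k] : ((Fin 2 → k) × (Fin 2 → k)) ≃ₐ[k] (Fin 4 → k) where
  toFun x := ![x.1 0, x.1 1, x.2 0, x.2 1]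
  invFun y := (![y 0, y 1], ![y 2, y 3])
  left_inv x := by
    refine Prod.ext (funext fun i => ?_) (funext fun i => ?_) <;> fin_cases i <;> rfl
  right_inv y := by ext i; fin_cases i <;> rfl
  map_mul' x y := by ext i; fin_cases i <;> rfl
  map_add' x y := by ext i; fin_cases i <;> rfl
  commutes' r := by ext i; fin_cases i <;> rfl

variable [IsAlgClosed k]

theorem HasNondegenerateFunctional.classification_two (hF : HasNondegenerateFunctional k C)
    (h : Module.finrank k C = 2) :
    Nonempty (C ≃ₐ[k] TruncPoly k 2) ∨ Nonempty (C ≃ₐ[k] (Fin 2 → k)) := by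
  have : Nontrivial C := Module.nontrivial_of_finrank_pos (R := k) (by omega)
  rcases hF.local_or_prod with hloc | ⟨I, J, hI, hle, hsum, -, -, ⟨e⟩⟩
  · left
    have h1 := finrank_le_nilSubspace (k := k) hloc
    have : Nontrivial (nilSubspace k C) := Module.nontrivial_of_finrank_pos (R := k) (by omega)
    obtain ⟨⟨w, hw⟩, hw0⟩ := exists_ne (0 : nilSubspace k C)
    refine exists_algEquiv_truncPoly (w := w) (n := 1) ?_ (fun h0 => hw0 (Subtype.ext ?_)) h
    · have := pow_finrank_eq_zero (k := k) (w := w) hw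
      rwa [h] at this
    · rwa [pow_one] at h0
  · right
    obtain ⟨e₁⟩ := exists_algEquiv_of_finrank_eq_one (k := k) (C := C ⧸ I) (by omega)
    obtain ⟨e₂⟩ := exists_algEquiv_of_finrank_eq_one (k := k) (C := C ⧸ J) (by omega)
    exact ⟨(e.trans (AlgEquiv.prodCongr e₁ e₂)).trans (prodEquivPiTwo k)⟩

variable [CharZero k]

theorem HasNondegenerateFunctional.classification_three (hF : HasNondegenerateFunctional k C)
    (h : Module.finrank k C = 3) :
    Nonempty (C ≃ₐ[k] TruncPoly k 3) ∨ Nonempty (C ≃ₐ[k] (k × TruncPoly k 2)) ∨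
      Nonempty (C ≃ₐ[k] (k × (Fin 2 → k))) := by
  have : Nontrivial C := Module.nontrivial_of_finrank_pos (R := k) (by omega)
  rcases hF.local_or_prod with hloc | ⟨I, J, hI, hle, hsum, -, hJ, ⟨e⟩⟩
  · left
    obtain ⟨w, hw, hw2⟩ := exists_sq_ne_zero (k := k) hloc hF h.ge
    refine exists_algEquiv_truncPoly (w := w) (n := 2) ?_ hw2 h
    have := pow_finrank_eq_zero (k := k) (w := w) hw
    rwa [h] at this
  · right
    obtain ⟨e₁⟩ := exists_algEquiv_of_finrank_eq_one (k := k) (C := C ⧸ I) (by omega)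
    exact (hJ.classification_two (by omega)).imp (fun ⟨e₂⟩ => ⟨e.trans (AlgEquiv.prodCongr e₁ e₂)⟩)
      fun ⟨e₂⟩ => ⟨e.trans (AlgEquiv.prodCongr e₁ e₂)⟩

theorem HasNondegenerateFunctional.exists_isListed (hF : HasNondegenerateFunctional k C)
    (h : Module.finrank k C = 4) : ∃ i, IsListed k C i := by
  have : Nontrivial C := Module.nontrivial_of_finrank_pos (R := k) (by omega)
  rcases hF.local_or_prod with hloc | ⟨I, J, hI, hle, hsum, hFI, hFJ, ⟨e⟩⟩
  · by_cases h3 : ∀ x : C, IsNilpotent x → x ^ 3 = 0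
    · exact ⟨5, exists_algEquiv_truncPolyTwo_of_cube hloc hF h h3⟩
    · push Not at h3
      obtain ⟨w, hw, hw3⟩ := h3
      have hw4 := pow_finrank_eq_zero (k := k) hw
      rw [h] at hw4
      exact ⟨4, exists_algEquiv_truncPoly (n := 3) hw4 hw3 h⟩
  · have h12 : Module.finrank k (C ⧸ I) = 1 ∧ Module.finrank k (C ⧸ J) = 3 ∨
        Module.finrank k (C ⧸ I) = 2 ∧ Module.finrank k (C ⧸ J) = 2 := by omega
    rcases h12 with ⟨h1, h3⟩ | ⟨h2, h2'⟩
    · obtain ⟨e₁⟩ := exists_algEquiv_of_finrank_eq_one (k := k) h1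
      rcases hFJ.classification_three h3 with ⟨⟨e₂⟩⟩ | ⟨⟨e₂⟩⟩ | ⟨⟨e₂⟩⟩
      · exact ⟨3, ⟨(e.trans (AlgEquiv.prodCongr e₁ e₂)).trans (prodSwapEquiv k _ _)⟩⟩
      · exact ⟨1, ⟨(e.trans (AlgEquiv.prodCongr e₁ e₂)).trans (prodProdEquivProdPiTwo k _)⟩⟩
      · exact ⟨0, ⟨((e.trans (AlgEquiv.prodCongr e₁ e₂)).trans
          (prodProdEquivProdPiTwo k _)).trans (prodEquivPiFour k)⟩⟩
    · rcases hFI.classification_two h2 with ⟨⟨e₁⟩⟩ | ⟨⟨e₁⟩⟩ <;>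
        rcases hFJ.classification_two h2' with ⟨⟨e₂⟩⟩ | ⟨⟨e₂⟩⟩
      · exact ⟨2, ⟨e.trans (AlgEquiv.prodCongr e₁ e₂)⟩⟩
      · exact ⟨1, ⟨e.trans (AlgEquiv.prodCongr e₁ e₂)⟩⟩
      · exact ⟨1, ⟨(e.trans (AlgEquiv.prodCongr e₁ e₂)).trans (prodSwapEquiv k _ _)⟩⟩
      · exact ⟨0, ⟨(e.trans (AlgEquiv.prodCongr e₁ e₂)).trans (prodEquivPiFour k)⟩⟩

theorem IsCommFrobeniusOfDimFour.exists_isListed {B : Type v} [Ring B] [Algebra k B]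
    (h : IsCommFrobeniusOfDimFour k B) : ∃ i, IsListed k B i := by
  let _ : CommRing B := commRingOfComm h.comm
  have := h.frobenius.1
  exact (IsFrobeniusAlgebra.hasNondegenerateFunctional h.frobenius).exists_isListed h.finrank_eq

end Classification

end NCConic

namespace NCConic

/-! ### The listed algebras are pairwise non-isomorphic -/

section Distinct

variable {k : Type u} [Field k]

/-- There is an element with `x³ = 0 ≠ x²`. -/
def HasCubicNilpotent (R : Type v) [Ring R] : Prop := ∃ x : R, x ^ 2 ≠ 0 ∧ x ^ 3 = 0

/-- The only idempotents are `0` and `1`. -/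
def HasTrivialIdempotents (R : Type v) [Ring R] : Prop :=
  ∀ e : R, IsIdempotentElem e → e = 0 ∨ e = 1

/-- The elements with `x² = 0` are multiples of one element. -/
def HasSquareZeroLine (k : Type u) [Field k] (R : Type v) [Ring R] [Algebra k R] : Prop :=
  ∃ t : R, ∀ x : R, x ^ 2 = 0 → ∃ c : k, x = c • t

theorem HasCubicNilpotent.of_equiv {R S : Type*} [Ring R] [Ring S] [Algebra k R] [Algebra k S]
    (e : R ≃ₐ[k] S) (h : HasCubicNilpotent R) : HasCubicNilpotent S := by
  obtain ⟨x, h2, h3⟩ := h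
  refine ⟨e x, ?_, ?_⟩
  · rwa [← map_pow, Ne, map_eq_zero_iff e e.injective]
  · rw [← map_pow, h3, map_zero]

theorem HasTrivialIdempotents.of_equiv {R S : Type*} [Ring R] [Ring S] [Algebra k R] [Algebra k S]
    (e : R ≃ₐ[k] S) (h : HasTrivialIdempotents R) : HasTrivialIdempotents S := by
  intro a ha
  refine (h (e.symm a) (ha.map e.symm)).imp (fun h => ?_) fun h => ?_
  · rwa [map_eq_zero_iff e.symm e.symm.injective] at h
  · rwa [map_eq_one_iff e.symm e.symm.injective] at h

theorem HasSquareZeroLine.of_equiv {R S : Type*} [Ring R] [Ring S] [Algebra k R] [Algebra k S]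
    (e : R ≃ₐ[k] S) (h : HasSquareZeroLine k R) : HasSquareZeroLine k S := by
  obtain ⟨t, h⟩ := h
  refine ⟨e t, fun x hx => ?_⟩
  obtain ⟨c, hc⟩ := h (e.symm x) (by rw [← map_pow, hx, map_zero])
  exact ⟨c, by rw [← map_smul, ← hc, e.apply_symm_apply]⟩

theorem IsReduced.not_hasCubicNilpotent {R : Type*} [Ring R] (h : IsReduced R) :
    ¬ HasCubicNilpotent R := by
  rintro ⟨x, h2, h3⟩
  have : x = 0 := h.eq_zero x ⟨3, h3⟩
  exact h2 (by rw [this, zero_pow two_ne_zero])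

/-- If every element is the sum of a scalar and a nilpotent element, the idempotents are trivial. -/
theorem hasTrivialIdempotents_of_local {R : Type v} [CommRing R] [Algebra k R]
    (h : ∀ x : R, ∃ (c : k) (y : R), IsNilpotent y ∧ x = c • 1 + y) : HasTrivialIdempotents R := by
  intro e he
  obtain ⟨c, y, hy, hey⟩ := h e
  rcases eq_or_ne c 0 with rfl | hc
  · left
    rw [zero_smul, zero_add] at hey
    obtain ⟨n, hn⟩ := hey ▸ hy
    have := he.pow_succ_eq n
    rw [← this, pow_succ, hn, zero_mul]
  · right
    have hu : IsUnit (c • (1 : R)) := by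
      rw [← Algebra.algebraMap_eq_smul_one]
      exact (IsUnit.mk0 c hc).map _
    have : IsUnit e := hey ▸ hy.isUnit_add_left_of_commute hu (Commute.all _ _)
    exact (IsIdempotentElem.iff_eq_one_of_isUnit this).1 he

theorem not_hasTrivialIdempotents_prod (R S : Type*) [Ring R] [Ring S] [Nontrivial R]
    [Nontrivial S] : ¬ HasTrivialIdempotents (R × S) := by
  intro h
  have := h (1, 0) (by simp [IsIdempotentElem])
  simp [Prod.ext_iff] at this

theorem truncGen_pow_ne_zero {m j : ℕ} (h : j < m) : truncGen k m ^ j ≠ 0 := by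
  rw [← map_pow, Ne, Ideal.Quotient.eq_zero_iff_mem, Ideal.mem_span_singleton,
    pow_dvd_pow_iff Polynomial.X_ne_zero Polynomial.not_isUnit_X]
  omega

instance nontrivial_truncPoly (m : ℕ) [NeZero m] : Nontrivial (TruncPoly k m) :=
  ⟨⟨truncGen k m ^ 0, 0, truncGen_pow_ne_zero (Nat.pos_of_neZero m)⟩⟩

theorem isNilpotent_truncGen_mul {m : ℕ} (b : TruncPoly k m) : IsNilpotent (truncGen k m * b) :=
  (Commute.all _ _).isNilpotent_mul_right ⟨m, truncGen_pow m⟩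

theorem exists_eq_truncGen_mul {m : ℕ} [NeZero m] {x : TruncPoly k m} (hx : IsNilpotent x) :
    ∃ b, x = truncGen k m * b := by
  obtain ⟨c, b, rfl⟩ := exists_eq_smul_add_truncGen_mul x
  have hc : IsNilpotent (algebraMap k (TruncPoly k m) c) := by
    rw [Algebra.algebraMap_eq_smul_one]
    have := (Commute.all _ _).isNilpotent_sub hx (isNilpotent_truncGen_mul b)
    rwa [add_sub_cancel_right] at this
  rw [IsNilpotent.map_iff (algebraMap k (TruncPoly k m)).injective] at hc
  exact ⟨b, by rw [hc.eq_zero, zero_smul, zero_add]⟩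

theorem sq_eq_zero_of_isNilpotent {x : TruncPoly k 2} (hx : IsNilpotent x) : x ^ 2 = 0 := by
  obtain ⟨b, rfl⟩ := exists_eq_truncGen_mul hx
  rw [mul_pow, truncGen_pow, zero_mul]

theorem exists_eq_smul_truncGen {x : TruncPoly k 2} (hx : IsNilpotent x) :
    ∃ c : k, x = c • truncGen k 2 := by
  obtain ⟨b, rfl⟩ := exists_eq_truncGen_mul hx
  obtain ⟨c, d, rfl⟩ := exists_eq_smul_add_truncGen_mul b
  exact ⟨c, by rw [mul_add, ← mul_assoc, ← pow_two, truncGen_pow, zero_mul, add_zero,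
    mul_smul_comm, mul_one]⟩

theorem hasTrivialIdempotents_truncPoly (m : ℕ) : HasTrivialIdempotents (TruncPoly k m) :=
  hasTrivialIdempotents_of_local fun x => by
    obtain ⟨c, b, rfl⟩ := exists_eq_smul_add_truncGen_mul x
    exact ⟨c, _, isNilpotent_truncGen_mul b, rfl⟩

theorem not_hasCubicNilpotent_truncPoly_four : ¬ HasCubicNilpotent (TruncPoly k 4) := by
  rintro ⟨x, h2, h3⟩
  obtain ⟨b, rfl⟩ := exists_eq_truncGen_mul ⟨3, h3⟩
  obtain ⟨c, d, rfl⟩ := exists_eq_smul_add_truncGen_mul b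
  have h4 := truncGen_pow (k := k) 4
  have e : c ^ 3 • truncGen k 4 ^ 3 = 0 := by
    have key {R : Type u} [CommRing R] [Algebra k R] {ε d : R} (h4 : ε ^ 4 = 0) :
        (ε * (c • 1 + ε * d)) ^ 3 = c ^ 3 • ε ^ 3 := by
      rw [Algebra.smul_def, Algebra.smul_def, map_pow]
      linear_combination (3 * algebraMap k _ c ^ 2 * d + 3 * algebraMap k _ c * d ^ 2 * ε +
        d ^ 3 * ε ^ 2) * h4
    rw [← h3, key h4]
  have hc : c = 0 := by
    have := (smul_eq_zero.1 e).resolve_right (truncGen_pow_ne_zero (by norm_num))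
    exact pow_eq_zero_iff three_ne_zero |>.1 this
  apply h2
  rw [hc, zero_smul, zero_add]
  linear_combination d ^ 2 * h4

theorem hasTrivialIdempotents_pairQuot :
    HasTrivialIdempotents (PairQuot (0 : k) 0 0 0) := by
  have h := isConicPair_pairGen (0 : k) 0 0 0
  refine hasTrivialIdempotents_of_local (k := k) fun x => ?_
  obtain ⟨d, rfl⟩ := (Submodule.mem_span_range_iff_exists_fun k).1
    (h.span_eq ▸ Submodule.mem_top : x ∈ _)
  have h0 : IsNilpotent (pairGen (0 : k) 0 0 0 0) := ⟨2, by rw [pow_two, h.sq_left]; simp⟩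
  have h1 : IsNilpotent (pairGen (0 : k) 0 0 0 1) := ⟨2, by rw [pow_two, h.sq_right]; simp⟩
  refine ⟨d 0, d 1 • pairGen 0 0 0 0 0 + d 2 • pairGen 0 0 0 0 1 +
    d 3 • (pairGen 0 0 0 0 0 * pairGen 0 0 0 0 1), ?_, ?_⟩
  · exact (Commute.all _ _).isNilpotent_add ((Commute.all _ _).isNilpotent_add (h0.smul _)
      (h1.smul _)) (((Commute.all _ _).isNilpotent_mul_right h0).smul _)
  · simp [Fin.sum_univ_four, add_assoc]

theorem hasCubicNilpotent_pairQuot [NeZero (2 : k)] :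
    HasCubicNilpotent (PairQuot (0 : k) 0 0 0) := by
  have h := isConicPair_pairGen (0 : k) 0 0 0
  have hli := linearIndependent_of_top_le_span_of_card_eq_finrank h.span_eq.ge
    (by rw [finrank_pairQuot]; simp)
  have hne : pairGen (0 : k) 0 0 0 0 * pairGen 0 0 0 0 1 ≠ 0 := hli.ne_zero 3
  have h0 := h.sq_left
  have h1 := h.sq_right
  rw [zero_smul, zero_smul, add_zero] at h0 h1
  generalize pairGen (0 : k) 0 0 0 0 = p at *
  generalize pairGen (0 : k) 0 0 0 1 = q at *
  refine ⟨p + q, fun h2 => ?_, ?_⟩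
  · have : (2 : k) • (p * q) = 0 := by
      rw [two_smul]
      linear_combination h2 - h0 - h1
    exact hne ((smul_eq_zero.1 this).resolve_left two_ne_zero)
  · linear_combination (p + 3 * q) * h0 + (q + 3 * p) * h1

theorem not_isReduced_of_sq {R : Type*} [Ring R] {x : R} (hx : x ≠ 0) (h : x ^ 2 = 0) :
    ¬ IsReduced R := fun hR => hx (hR.eq_zero x ⟨2, h⟩)

theorem hasSquareZeroLine_prod_pi : HasSquareZeroLine k (TruncPoly k 2 × (Fin 2 → k)) := by
  refine ⟨(truncGen k 2, 0), fun x hx => ?_⟩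
  obtain ⟨c, hc⟩ := exists_eq_smul_truncGen ⟨2, congrArg Prod.fst hx⟩
  have h2 : x.2 = 0 := IsReduced.eq_zero _ ⟨2, congrArg Prod.snd hx⟩
  exact ⟨c, Prod.ext hc (by rw [h2, Prod.smul_snd, smul_zero])⟩

theorem not_hasSquareZeroLine_prod_self :
    ¬ HasSquareZeroLine k (TruncPoly k 2 × TruncPoly k 2) := by
  have h0 : truncGen k 2 ≠ 0 := by
    have := truncGen_pow_ne_zero (k := k) (m := 2) (j := 1) (by norm_num)
    rwa [pow_one] at this
  rintro ⟨⟨t₁, t₂⟩, ht⟩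
  obtain ⟨c, hc⟩ := ht (truncGen k 2, 0) (by
    rw [Prod.pow_mk, truncGen_pow, zero_pow two_ne_zero]; rfl)
  obtain ⟨d, hd⟩ := ht (0, truncGen k 2) (by
    rw [Prod.pow_mk, truncGen_pow, zero_pow two_ne_zero]; rfl)
  rw [Prod.smul_mk, Prod.mk.injEq] at hc hd
  rcases smul_eq_zero.1 hc.2.symm with rfl | rfl
  · exact h0 (by rw [hc.1, zero_smul])
  · exact h0 (by rw [hd.2, smul_zero])

theorem isReduced_iff_of_algEquiv {R S : Type*} [Ring R] [Ring S] [Algebra k R] [Algebra k S]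
    (e : R ≃ₐ[k] S) : IsReduced R ↔ IsReduced S :=
  ⟨fun _ => isReduced_of_injective e.symm e.symm.injective,
    fun _ => isReduced_of_injective e e.injective⟩

theorem hasCubicNilpotent_iff_of_algEquiv {R S : Type*} [Ring R] [Ring S] [Algebra k R]
    [Algebra k S] (e : R ≃ₐ[k] S) : HasCubicNilpotent R ↔ HasCubicNilpotent S :=
  ⟨.of_equiv e, .of_equiv e.symm⟩

theorem hasTrivialIdempotents_iff_of_algEquiv {R S : Type*} [Ring R] [Ring S] [Algebra k R]
    [Algebra k S] (e : R ≃ₐ[k] S) : HasTrivialIdempotents R ↔ HasTrivialIdempotents S :=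
  ⟨.of_equiv e, .of_equiv e.symm⟩

/-- The first three invariants determine the entry of the list, except for `k[u]/(u²) × k²` and
`k[u]/(u²) × k[u]/(u²)`, which are separated by the fourth. -/
theorem IsListed.invariants [NeZero (2 : k)] {B : Type v} [Ring B] [Algebra k B] {i : Fin 6}
    (h : IsListed k B i) :
    (IsReduced B ↔ i = 0) ∧ (HasCubicNilpotent B ↔ i = 3 ∨ i = 5) ∧
      (HasTrivialIdempotents B ↔ i = 4 ∨ i = 5) ∧
      (i = 1 → HasSquareZeroLine k B) ∧ (i = 2 → ¬ HasSquareZeroLine k B) := by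
  have hε {m : ℕ} (hm : 1 < m) : truncGen k m ≠ 0 := by
    have := truncGen_pow_ne_zero (k := k) hm
    rwa [pow_one] at this
  have hcub {R : Type u} [Ring R] (h : HasCubicNilpotent R) : ¬ IsReduced R := fun h' =>
    h'.not_hasCubicNilpotent h
  fin_cases i <;> obtain ⟨e⟩ := h <;>
    rw [isReduced_iff_of_algEquiv e, hasCubicNilpotent_iff_of_algEquiv e,
      hasTrivialIdempotents_iff_of_algEquiv e]
  · have h1 : IsReduced (Fin 4 → k) := inferInstance
    have h2 := h1.not_hasCubicNilpotent
    have h3 : ¬ HasTrivialIdempotents (Fin 4 → k) := fun h => by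
      rcases h (Pi.single 0 1) (by simp [IsIdempotentElem, ← Pi.single_mul]) with h | h
      · simpa using congrFun h 0
      · simpa using congrFun h 1
    simp [h1, h2, h3]
  · have h1 : ¬ IsReduced (TruncPoly k 2 × (Fin 2 → k)) :=
      not_isReduced_of_sq (x := (truncGen k 2, 0)) (fun h => hε one_lt_two (congrArg Prod.fst h))
        (by rw [Prod.pow_mk, truncGen_pow, zero_pow two_ne_zero]; rfl)
    have h2 : ¬ HasCubicNilpotent (TruncPoly k 2 × (Fin 2 → k)) := by
      rintro ⟨x, hx2, hx3⟩
      exact hx2 (Prod.ext (sq_eq_zero_of_isNilpotent ⟨3, congrArg Prod.fst hx3⟩)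
        (IsReduced.eq_zero _ ⟨2, by
          have : x.2 = 0 := IsReduced.eq_zero _ ⟨3, congrArg Prod.snd hx3⟩
          simp [this]⟩))
    have h3 := not_hasTrivialIdempotents_prod (TruncPoly k 2) (Fin 2 → k)
    have h4 := (hasSquareZeroLine_prod_pi (k := k)).of_equiv e.symm
    simp [h1, h2, h3, h4]
  · have h1 : ¬ IsReduced (TruncPoly k 2 × TruncPoly k 2) :=
      not_isReduced_of_sq (x := (truncGen k 2, 0)) (fun h => hε one_lt_two (congrArg Prod.fst h))
        (by rw [Prod.pow_mk, truncGen_pow, zero_pow two_ne_zero]; rfl)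
    have h2 : ¬ HasCubicNilpotent (TruncPoly k 2 × TruncPoly k 2) := by
      rintro ⟨x, hx2, hx3⟩
      exact hx2 (Prod.ext (sq_eq_zero_of_isNilpotent ⟨3, congrArg Prod.fst hx3⟩)
        (sq_eq_zero_of_isNilpotent ⟨3, congrArg Prod.snd hx3⟩))
    have h3 := not_hasTrivialIdempotents_prod (TruncPoly k 2) (TruncPoly k 2)
    have h4 : ¬ HasSquareZeroLine k B := fun h => not_hasSquareZeroLine_prod_self (h.of_equiv e)
    simp [h1, h2, h3, h4]
  · have h2 : HasCubicNilpotent (TruncPoly k 3 × k) := by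
      refine ⟨(truncGen k 3, 0), fun h => truncGen_pow_ne_zero (k := k) (m := 3) (j := 2)
        (by norm_num) (congrArg Prod.fst h), ?_⟩
      rw [Prod.pow_mk, truncGen_pow, zero_pow three_ne_zero]
      rfl
    have h3 := not_hasTrivialIdempotents_prod (TruncPoly k 3) k
    simp [hcub h2, h2, h3]
  · have h1 : ¬ IsReduced (TruncPoly k 4) :=
      not_isReduced_of_sq (x := truncGen k 4 ^ 2) (truncGen_pow_ne_zero (by norm_num))
        (by rw [← pow_mul, truncGen_pow])
    simp [h1, not_hasCubicNilpotent_truncPoly_four, hasTrivialIdempotents_truncPoly]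
  · obtain ⟨e'⟩ := exists_algEquiv_truncPolyTwo (k := k)
    have h2 := (hasCubicNilpotent_pairQuot (k := k)).of_equiv e'
    have h3 := (hasTrivialIdempotents_pairQuot (k := k)).of_equiv e'
    simp [hcub h2, h2, h3]

theorem IsListed.unique [NeZero (2 : k)] {B : Type v} [Ring B] [Algebra k B] {i j : Fin 6}
    (hi : IsListed k B i) (hj : IsListed k B j) : i = j := by
  obtain ⟨a1, a2, a3, a4, a5⟩ := hi.invariants
  obtain ⟨b1, b2, b3, b4, b5⟩ := hj.invariants
  rw [b1] at a1
  rw [b2] at a2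
  rw [b3] at a3
  clear hi hj b1 b2 b3
  fin_cases i <;> fin_cases j <;> simp_all

end Distinct

/-! ### The algebras `C(A)` are Frobenius -/

section Transfer

variable {k : Type u} [Field k]

theorem IsCommFrobeniusOfDimFour.of_algEquiv {R S : Type*} [Ring R] [Ring S] [Algebra k R]
    [Algebra k S] (e : R ≃ₐ[k] S) (h : IsCommFrobeniusOfDimFour k S) :
    IsCommFrobeniusOfDimFour k R := by
  obtain ⟨⟨hfin, β, hβ, hassoc⟩, hcomm, hrank⟩ := h
  have hc (a b : R) : a * b = b * a := e.injective (by rw [map_mul, map_mul, hcomm])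
  have : Module.Finite k R := Module.Finite.equiv e.symm.toLinearEquiv
  refine ⟨isFrobeniusAlgebra_of_functional hc (β 1 ∘ₗ e.toLinearMap) fun a ha => ?_, hc, ?_⟩
  · rw [← map_eq_zero_iff e e.injective]
    refine hβ.1 _ fun b => ?_
    have := ha (e.symm b)
    change β 1 (e (a * e.symm b)) = 0 at this
    rwa [map_mul, e.apply_symm_apply, ← hassoc, one_mul] at this
  · rw [e.toLinearEquiv.finrank_eq, hrank]

theorem IsAlgebraCOfSymmetricConic.isCommFrobeniusOfDimFour [Infinite k] [NeZero (2 : k)]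
    {B : Type v} [Ring B] [Algebra k B] (h : IsAlgebraCOfSymmetricConic k B) :
    IsCommFrobeniusOfDimFour k B := by
  obtain ⟨ω, f, g, hg, hω, hf, ⟨e⟩⟩ := h
  obtain ⟨r, rfl, hr⟩ := hf.exists_tensor hω
  exact ((hr.isConicDualAlgebra hg).isCommFrobeniusOfDimFour).of_algEquiv e

end Transfer

end NCConic

theorem corollary4p9 (k : Type*) [Field k] [IsAlgClosed k] [CharZero k] :
    -- `C(A)` is defined: an element `f^!` exists and is unique up to a nonzero scalar
    (∀ (ω : Potential k) (f : DerQuot ω),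
      IsSymmetricRegularSuperpotential ω → IsConicElement ω f →
      ∃ g : Subring.center (QuadDual k (conicGen f)), IsDualElement f g ∧
        ∀ g' : Subring.center (QuadDual k (conicGen f)), IsDualElement f g' →
          ∃ c : k, c ≠ 0 ∧
            (g' : QuadDual k (conicGen f)) = c • (g : QuadDual k (conicGen f))) ∧
    -- the two classes of algebras agree, and they consist of the six listed algebras,
    -- which are pairwise non-isomorphic
    (∀ (B : Type*) [Ring B] [Algebra k B],
      (IsCommFrobeniusOfDimFour k B ↔ IsAlgebraCOfSymmetricConic k B) ∧
      (IsCommFrobeniusOfDimFour k B ↔ ∃ i, IsListed k B i) ∧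
      (∀ i j, IsListed k B i → IsListed k B j → i = j)) := by
  refine ⟨fun ω f hω hf => exists_isDualElement hω hf, fun B _ _ => ⟨⟨fun h => ?_, fun h => ?_⟩,
    ⟨fun h => h.exists_isListed, fun ⟨i, h⟩ => ?_⟩, fun i j hi hj => hi.unique hj⟩⟩
  · obtain ⟨i, hi⟩ := h.exists_isListed
    exact hi.isAlgebraCOfSymmetricConic
  · exact h.isCommFrobeniusOfDimFour
  · exact h.isAlgebraCOfSymmetricConic.isCommFrobeniusOfDimFour
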